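/- Let $V$ be a finite-dimensional real normed space, $m\in\mathbb N$, let $T^{(m)}(V)$ be the tensor algebra of $V$ modulo $\bigoplus_{n>m}V^{\otimes n}$, $\mathcal G^m(V)\subset T^{(m)}(V)$ the Lie subalgebra (for the commutator bracket) generated by $V$, and $G^m(V)=\exp(\mathcal G^m(V))$ the free nilpotent group of step $m$. For a smooth path $y:[0,1]\to V$ let $$S_m(y)_{s,t}=\sum_{k=0}^m\int_{s<u_1<\cdots<u_k<t}dy_{u_1}\otimes\cdots\otimes dy_{u_k}$$ be its $m$-signature, and write $S_m(y)$ for the path $t\mapsto S_m(y)_{0,t}$. Let $\|\cdot\|_m$ be the Carnot–Carathéodory norm on $G^m(V)$, i.e. $\|g\|_m=\inf\int_0^1|\dot y_r|\,dr$ over all smooth $y:[0,1]\to V$ with $S_m(y)_{0,1}=g$, or any other symmetric sub-additive homogeneous norm on $G^m(V)$ (that is, a function $\|\cdot\|:G^m(V)\to[0,\infty)$ with $\|g\|=0\iff g=1$, $\|\delta_tg\|=|t|\,\|g\|$ for all $t\in\mathbb R$, where $\delta_t$ is the dilation multiplying the component in $V^{\otimes k}$ by $t^k$, $\|g\otimes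 h\|\le\|g\|+\|h\|$ and $\|g^{-1}\|=\|g\|$). Put $d_m(g,h)=\|g^{-1}\otimes h\|_m$. A $G^m(V)$-valued path is a continuous map $Y:[0,1]\to G^m(V)$ with $Y_0=1$; put $Y_{s,t}=Y_s^{-1}\otimes Y_t$. A control is a continuous function $\omega:\{0\le s\le t\le1\}\to[0,\infty)$ with $\omega(t,t)=0$ and $\omega(s,t)+\omega(t,u)\le\omega(s,u)$ for $s<t<u$. For $p\ge1$, it satisfies condition $(H_p)$ if it is not identically $0$ and there is a constant $C$ with $\frac{\omega(r,u)}{(u-r)^p}\le C\frac{\omega(s,t)}{(t-s)^p}$ for all $0\le r<s<t<u\le1$. Put $$d_{\omega,p}(X,Y)=\sup_{0\le s<t\le1}\frac{d_m(X_{s,t},Y_{s,t})}{\omega(s,t)^{1/p}},\qquad \|Y\|_{\omega,p}=d_{\omega,p}(Y,1),$$ and let $C^{\omega,p}(G^m(V))$ be the set of $G^m(V)$-valued paths $Y$ with $\|Y\|_{\omega,p}<\infty$. Theorem. Let $p\ge1$ and let $\omega$ be a control satisfying condition $(H_p)$. A $G^m(V)$-valued path $Y$ belongs to $C^{\omega,p}(G^m(V))$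 if and only if there exists a sequence of smooth paths $y(n):[0,1]\to V$ such that (i) $\sup_n\|S_m(y(n))\|_{\omega,p}<\infty$; (ii) $S_m(y(n))_{0,t}\to Y_t$ for every $t\in[0,1]$. Moreover, for every sequence of smooth paths $y(n)$ satisfying (i) and (ii) and every $q>p$, $d_{\omega,q}(S_m(y(n)),Y)\to0$. -/

import Mathlib

open Set Filter Topology
open scoped ENNReal

noncomputable section

namespace RoughPath

/-! ### The truncated tensor algebra and the free nilpotent group -/

section Algebra

variable (m : ℕ) (V : Type*) [AddCommGroup V] [Module ℝ V]

/-- The relation `x ∼ 0` for every homogeneous tensor `x` of degree `n > m`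
(`V^{⊗ n}` sits in the tensor algebra as the `n`-th power of the submodule `V`). -/
def TruncRel (x y : TensorAlgebra ℝ V) : Prop :=
  (∃ n, m < n ∧ x ∈ LinearMap.range (TensorAlgebra.ι ℝ (M := V)) ^ n) ∧ y = 0

/-- `T^{(m)}(V)`: the quotient of the tensor algebra of `V` by the two-sided ideal
`⨁_{n > m} V^{⊗ n}`. -/
def TruncTensor : Type _ := RingQuot (TruncRel m V)

instance : Ring (TruncTensor m V) := inferInstanceAs (Ring (RingQuot (TruncRel m V)))

instance : Algebra ℝ (TruncTensor m V) :=
  inferInstanceAs (Algebra ℝ (RingQuot (TruncRel m V)))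

/-- The projection of the tensor algebra onto `T^{(m)}(V)`. -/
def proj : TensorAlgebra ℝ V →ₐ[ℝ] TruncTensor m V := RingQuot.mkAlgHom ℝ (TruncRel m V)

/-- The canonical map `V → T^{(m)}(V)`. -/
def inc : V →ₗ[ℝ] TruncTensor m V := (proj m V).toLinearMap ∘ₗ TensorAlgebra.ι ℝ

theorem proj_surjective : Function.Surjective (proj m V) :=
  RingQuot.mkAlgHom_surjective ℝ (TruncRel m V)

theorem map_range_pow (n : ℕ) :
    (LinearMap.range (TensorAlgebra.ι ℝ (M := V)) ^ n).map (proj m V).toLinearMap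
      = LinearMap.range (inc m V) ^ n := by
  rw [Submodule.map_pow, inc, LinearMap.range_comp]

theorem range_inc_pow_eq_bot {n : ℕ} (hn : m < n) : LinearMap.range (inc m V) ^ n = ⊥ := by
  rw [← map_range_pow, eq_bot_iff]
  rintro _ ⟨x, hx, rfl⟩
  have h : proj m V x = proj m V 0 := RingQuot.mkAlgHom_rel ℝ ⟨⟨n, hn, hx⟩, rfl⟩
  simpa using h

theorem iSup_range_inc_pow :
    ⨆ i : Fin (m + 1), LinearMap.range (inc m V) ^ (i : ℕ) = ⊤ := by
  have h1 : ⨆ n : ℕ, LinearMap.range (TensorAlgebra.ι ℝ (M := V)) ^ n = ⊤ :=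
    (DirectSum.Decomposition.isInternal
      (fun n : ℕ => LinearMap.range (TensorAlgebra.ι ℝ (M := V)) ^ n)).submodule_iSup_eq_top
  have h2 := congrArg (Submodule.map (proj m V).toLinearMap) h1
  have h3 : LinearMap.range (proj m V).toLinearMap = ⊤ :=
    LinearMap.range_eq_top.2 (proj_surjective m V)
  rw [Submodule.map_iSup, Submodule.map_top, h3] at h2
  simp only [map_range_pow] at h2
  rw [eq_top_iff, ← h2]
  refine iSup_le fun n => ?_
  by_cases hn : m < n
  · rw [range_inc_pow_eq_bot m V hn]
    exact bot_le
  · exact le_iSup (fun i : Fin (m + 1) => LinearMap.range (inc m V) ^ (i : ℕ))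
      ⟨n, by omega⟩

instance [FiniteDimensional ℝ V] : FiniteDimensional ℝ (TruncTensor m V) := by
  refine ⟨?_⟩
  rw [← iSup_range_inc_pow]
  exact Submodule.fg_iSup _ fun i => Submodule.FG.pow Submodule.FG.of_finite _

/-- The dilation `δ_t (v₀ + v₁ + ⋯ + v_m) = v₀ + t v₁ + ⋯ + t^m v_m`: the algebra
endomorphism of `T^{(m)}(V)` which multiplies the elements of `V` by `t`. -/
def dilation (t : ℝ) : TruncTensor m V →ₐ[ℝ] TruncTensor m V :=
  RingQuot.liftAlgHom ℝ ⟨TensorAlgebra.lift ℝ (t • inc m V), by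
    rintro x y ⟨⟨n, hn, hx⟩, rfl⟩
    rw [map_zero]
    have h : TensorAlgebra.lift ℝ (t • inc m V) x ∈
        (LinearMap.range (TensorAlgebra.ι ℝ (M := V)) ^ n).map
          (TensorAlgebra.lift ℝ (t • inc m V)).toLinearMap := ⟨x, hx, rfl⟩
    rw [Submodule.map_pow, ← LinearMap.range_comp] at h
    have h3 : LinearMap.range ((TensorAlgebra.lift ℝ (t • inc m V)).toLinearMap ∘ₗ
        TensorAlgebra.ι ℝ) ≤ LinearMap.range (inc m V) := by
      rintro _ ⟨v, rfl⟩
      exact ⟨t • v, by simp⟩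
    have h4 := pow_le_pow_left' h3 n h
    rw [range_inc_pow_eq_bot m V hn] at h4
    simpa using h4⟩

/-- The bracket `[a, b] = a b - b a` on `T^{(m)}(V)`. -/
instance : LieRing (TruncTensor m V) := LieRing.ofAssociativeRing

instance : LieAlgebra ℝ (TruncTensor m V) := LieAlgebra.ofAssociativeAlgebra

/-- The Lie subalgebra `𝒢^m(V)` of `T^{(m)}(V)` generated by `V`. -/
def freeNilpotentLie : LieSubalgebra ℝ (TruncTensor m V) :=
  LieSubalgebra.lieSpan ℝ (TruncTensor m V) (Set.range (inc m V))

variable {m V} in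
/-- The exponential series. On elements without scalar part, such as those of `𝒢^m(V)`,
its terms of order `k > m` vanish in `T^{(m)}(V)`. -/
def texp (x : TruncTensor m V) : TruncTensor m V :=
  ∑ k ∈ Finset.range (m + 1), ((k.factorial : ℝ)⁻¹) • x ^ k

/-- The free nilpotent group `G^m(V) = exp (𝒢^m(V))` of step `m`, as a subset of `T^{(m)}(V)`;
its product and neutral element are those of `T^{(m)}(V)`, and since all its elements are
invertible, its inverse is `Ring.inverse`. -/
def freeNilpotentGroup : Set (TruncTensor m V) := texp '' (freeNilpotentLie m V : Set _)

end Algebra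

/-! ### Topology, signatures, homogeneous norms -/

section Analysis

variable {m : ℕ} {V : Type*} [NormedAddCommGroup V] [NormedSpace ℝ V] [FiniteDimensional ℝ V]

/-- A norm on the finite-dimensional space `T^{(m)}(V)`. As all such norms are equivalent the
choice does not matter; it serves only for the topology of `T^{(m)}(V)` and for integrating
functions with values in it. -/
instance : NormedAddCommGroup (TruncTensor m V) :=
  NormedAddCommGroup.induced (TruncTensor m V) _
    (Module.finBasis ℝ (TruncTensor m V)).equivFun
    (Module.finBasis ℝ (TruncTensor m V)).equivFun.injective

instance : NormedSpace ℝ (TruncTensor m V) :=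
  NormedSpace.induced ℝ (TruncTensor m V) _
    (Module.finBasis ℝ (TruncTensor m V)).equivFun

/-- A smooth path `[0,1] → V` (only the values on `[0,1]` matter). -/
def IsSmoothPath (y : ℝ → V) : Prop := ContDiffOn ℝ (⊤ : ℕ∞) y (Icc 0 1)

/-- The derivative of a path on `[0,1]` (one-sided at the end points). -/
def velocity (y : ℝ → V) (u : ℝ) : V := derivWithin y (Icc 0 1) u

variable (m) in
/-- The iterated integral `∫_{s < u₁ < ⋯ < u_k < t} dy_{u₁} ⊗ ⋯ ⊗ dy_{u_k}`. -/
def iteratedIntegral (y : ℝ → V) (s : ℝ) : ℕ → ℝ → TruncTensor m V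
  | 0, _ => 1
  | k + 1, t => ∫ u in s..t, iteratedIntegral y s k u * inc m V (velocity y u)

variable (m) in
/-- The `m`-signature `S_m(y)_{s,t}`. -/
def signature (y : ℝ → V) (s t : ℝ) : TruncTensor m V :=
  ∑ k ∈ Finset.range (m + 1), iteratedIntegral m y s k t

variable (m) in
/-- The path `t ↦ S_m(y)_{0,t}`. -/
def signaturePath (y : ℝ → V) : ℝ → TruncTensor m V := signature m y 0

variable (m V) in
/-- The Carnot–Carathéodory norm of `g ∈ G^m(V)`: the infimum of the lengths of the smooth paths
`y : [0,1] → V` with `S_m(y)_{0,1} = g`. -/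
def ccNorm (g : TruncTensor m V) : ℝ :=
  sInf {L | ∃ y : ℝ → V, IsSmoothPath y ∧ signature m y 0 1 = g ∧
    L = ∫ u in (0 : ℝ)..1, ‖velocity y u‖}

/-- `N` is a symmetric sub-additive homogeneous norm on `G^m(V)`
(only the values on `G^m(V)` matter). -/
structure IsHomogeneousNorm (N : TruncTensor m V → ℝ) : Prop where
  nonneg : ∀ g ∈ freeNilpotentGroup m V, 0 ≤ N g
  eq_zero_iff : ∀ g ∈ freeNilpotentGroup m V, N g = 0 ↔ g = 1
  dilation : ∀ g ∈ freeNilpotentGroup m V, ∀ t : ℝ, N (dilation m V t g) = |t| * N g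
  mul_le : ∀ g ∈ freeNilpotentGroup m V, ∀ h ∈ freeNilpotentGroup m V, N (g * h) ≤ N g + N h
  inverse : ∀ g ∈ freeNilpotentGroup m V, N (Ring.inverse g) = N g

/-- The left invariant distance `d_m(g,h) = ‖g⁻¹ ⊗ h‖_m` attached to the norm `N`. -/
def groupDist (N : TruncTensor m V → ℝ) (g h : TruncTensor m V) : ℝ := N (Ring.inverse g * h)

/-! ### Group-valued paths -/

/-- The increment `Y_{s,t} = Y_s⁻¹ ⊗ Y_t`. -/
def increment (Y : ℝ → TruncTensor m V) (s t : ℝ) : TruncTensor m V := Ring.inverse (Y s) * Y t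

/-- `Y ∈ C₀([0,1], G^m(V))`: a continuous `G^m(V)`-valued path on `[0,1]` that starts at the
neutral element (only the values on `[0,1]` matter). -/
structure IsGroupPath (Y : ℝ → TruncTensor m V) : Prop where
  continuousOn : ContinuousOn Y (Icc 0 1)
  mem : ∀ t ∈ Icc (0 : ℝ) 1, Y t ∈ freeNilpotentGroup m V
  start : Y 0 = 1

/-- `d_{ω,p}(X,Y) = sup_{0 ≤ s < t ≤ 1} d_m(X_{s,t}, Y_{s,t}) / ω(s,t)^{1/p} ∈ [0,∞]`. -/
def omegaDist (N : TruncTensor m V → ℝ) (ω : ℝ → ℝ → ℝ) (p : ℝ)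
    (X Y : ℝ → TruncTensor m V) : ℝ≥0∞ :=
  ⨆ (s : ℝ) (t : ℝ) (_ : 0 ≤ s ∧ s < t ∧ t ≤ 1),
    ENNReal.ofReal (groupDist N (increment X s t) (increment Y s t)) /
      ENNReal.ofReal (ω s t ^ (1 / p))

/-- `‖Y‖_{ω,p}`, the `d_{ω,p}`-distance of `Y` to the constant path at the neutral element. -/
def omegaNorm (N : TruncTensor m V → ℝ) (ω : ℝ → ℝ → ℝ) (p : ℝ)
    (Y : ℝ → TruncTensor m V) : ℝ≥0∞ :=
  omegaDist N ω p Y fun _ => 1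

/-- The path space `C^{ω,p}(G^m(V))`. -/
def omegaPathSpace (N : TruncTensor m V → ℝ) (ω : ℝ → ℝ → ℝ) (p : ℝ) :
    Set (ℝ → TruncTensor m V) :=
  {Y | IsGroupPath Y ∧ omegaNorm N ω p Y < ⊤}

end Analysis

/-! ### Controls -/

/-- `ω` is a control on `{(s,t) : 0 ≤ s ≤ t ≤ 1}`. -/
structure IsControl (ω : ℝ → ℝ → ℝ) : Prop where
  nonneg : ∀ s t, 0 ≤ s → s ≤ t → t ≤ 1 → 0 ≤ ω s t
  continuousOn : ContinuousOn (fun x : ℝ × ℝ => ω x.1 x.2) {x | 0 ≤ x.1 ∧ x.1 ≤ x.2 ∧ x.2 ≤ 1}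
  superadditive : ∀ s t u, 0 ≤ s → s < t → t < u → u ≤ 1 → ω s t + ω t u ≤ ω s u
  diag : ∀ t, 0 ≤ t → t ≤ 1 → ω t t = 0

/-- Condition `(H_p)`. -/
structure ConditionH (p : ℝ) (ω : ℝ → ℝ → ℝ) : Prop where
  ne_zero : ∃ s t, 0 ≤ s ∧ s ≤ t ∧ t ≤ 1 ∧ ω s t ≠ 0
  bound : ∃ C : ℝ, ∀ r s t u, 0 ≤ r → r < s → s < t → t < u → u ≤ 1 →
    ω r u / (u - r) ^ p ≤ C * (ω s t / (t - s) ^ p)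

end RoughPath

end

open RoughPath

/-!
The algebra `T^{(m)}(V)` is filtered by the ideals `filt m V j` of tensors of degree at least `j`,
which vanish for `j > m`. Many arguments are inductions along this filtration: a curve whose
derivative lies in a subspace stays in a coset of that subspace (`sub_mem_of_deriv_mem`), so that
an equation `S' = S a`, with `a` without scalar part, transfers information about `S` from one
degree to the next.

*The group.* Exponential and logarithm are inverse to each other on elements without scalar part.
If `S' = S a` with `a` in `𝒢^m(V)`, and `S` starts in `G^m(V)`, then the logarithm of `S` is a Lie
element in more and more degrees, hence `S` stays in `G^m(V)` (`mem_group_of_ode`). This replaces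
the Baker–Campbell–Hausdorff formula: it shows that `G^m(V)` is a group and that it contains the
signatures, which solve `S' = S y'`.

*Chow's theorem.* The leading term of an iterated group commutator of elements `exp (t e_i)` is the
corresponding iterated bracket, so these elements generate `G^m(V)` (`group_le_words`). The
products of at most `k` factors with `|t| ≤ n` form compact sets which exhaust the closed set
`G^m(V)`. By the Baire category theorem one of them has an interior point, so that a neighbourhood
of `1` consists of such products for fixed `n` and `k` (`exists_nhds_subset_letters_pow`).

*Homogeneous norms.* By dilation this neighbourhood determines everything else: a homogeneous norm
is continuous on the group; it is small only near `1` (by compactness of a sphere in the closed set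
`G^m(V)`); every `g` is the signature of a smooth path that extends smoothly by constants, with
speed at most `C ‖g‖` (`IsHomogeneousNorm.exists_isReached`); and the norm of a signature is at
most `C` times the length of the path (`IsHomogeneousNorm.exists_le_length`). The
Carnot–Carathéodory norm is one of these norms (`isHomogeneousNorm_ccNorm`).

*The theorem.* A path `Y` in `C^{ω,p}` is interpolated at the nodes `k / n` by the signature of a
concatenation of smooth paths with speed proportional to the norms of the increments of `Y`.
Condition `(H_p)` bounds this signature on short intervals, and superadditivity of `ω` on long ones
(`exists_interpolation`). Conversely, bounds pass to pointwise limits because the norm is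
continuous. Finally, a sequence that is bounded in `C^{ω,p}` is equicontinuous, so that its
pointwise convergence is uniform, and interpolating between the uniform distance and the bound gives
convergence in `d_{ω,q}` for `q > p` (`tendsto_omegaDist`).
-/

set_option linter.unusedSectionVars false

noncomputable section

namespace RoughPath

/-! ### The degree filtration of the truncated tensor algebra -/

section Filtration

variable (m : ℕ) (V : Type*) [AddCommGroup V] [Module ℝ V]

/-- The ideal of `T^{(m)}(V)` spanned by the tensors of degree at least `j`. -/
def filt (j : ℕ) : Submodule ℝ (TruncTensor m V) :=
  ⨆ k : ℕ, ⨆ _ : j ≤ k, LinearMap.range (inc m V) ^ k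

variable {m V}

theorem range_inc_pow_le_filt {j k : ℕ} (h : j ≤ k) :
    LinearMap.range (inc m V) ^ k ≤ filt m V j :=
  le_iSup₂ (f := fun k (_ : j ≤ k) => LinearMap.range (inc m V) ^ k) k h

theorem filt_antitone {i j : ℕ} (h : i ≤ j) : filt m V j ≤ filt m V i :=
  iSup₂_le fun _ hk => range_inc_pow_le_filt (h.trans hk)

theorem filt_zero : filt m V 0 = ⊤ := by
  rw [eq_top_iff, ← iSup_range_inc_pow]
  exact iSup_le fun i => range_inc_pow_le_filt (Nat.zero_le _)

theorem filt_eq_bot {j : ℕ} (h : m < j) : filt m V j = ⊥ := by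
  rw [eq_bot_iff]
  exact iSup₂_le fun k hk => (range_inc_pow_eq_bot m V (h.trans_le hk)).le

theorem mem_filt_zero (x : TruncTensor m V) : x ∈ filt m V 0 := by simp [filt_zero]

theorem eq_zero_of_mem_filt {x : TruncTensor m V} {j : ℕ} (hj : m < j) (h : x ∈ filt m V j) :
    x = 0 := by
  rw [filt_eq_bot hj] at h
  simpa using h

theorem filt_mul_le (i j : ℕ) : filt m V i * filt m V j ≤ filt m V (i + j) := by
  simp only [filt, Submodule.iSup_mul, Submodule.mul_iSup]
  refine iSup₂_le fun k hk => iSup₂_le fun l hl => ?_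
  rw [← pow_add]
  exact range_inc_pow_le_filt (by omega)

theorem mul_mem_filt {x y : TruncTensor m V} {i j : ℕ} (hx : x ∈ filt m V i)
    (hy : y ∈ filt m V j) : x * y ∈ filt m V (i + j) :=
  filt_mul_le i j (Submodule.mul_mem_mul hx hy)

theorem mul_mem_filt_left {x : TruncTensor m V} (y : TruncTensor m V) {i : ℕ}
    (hx : x ∈ filt m V i) : x * y ∈ filt m V i := by
  simpa using mul_mem_filt hx (mem_filt_zero y)

theorem mul_mem_filt_right (x : TruncTensor m V) {y : TruncTensor m V} {i : ℕ}
    (hy : y ∈ filt m V i) : x * y ∈ filt m V i := by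
  simpa using mul_mem_filt (mem_filt_zero x) hy

theorem pow_mem_filt {x : TruncTensor m V} (hx : x ∈ filt m V 1) (k : ℕ) :
    x ^ k ∈ filt m V k := by
  induction k with
  | zero => exact mem_filt_zero _
  | succ k ih => rw [pow_succ]; exact mul_mem_filt ih hx

theorem pow_eq_zero_of_mem_filt {x : TruncTensor m V} (hx : x ∈ filt m V 1) :
    x ^ (m + 1) = 0 :=
  eq_zero_of_mem_filt (Nat.lt_add_one m) (pow_mem_filt hx _)

theorem inc_mem_filt (v : V) : inc m V v ∈ filt m V 1 :=
  range_inc_pow_le_filt le_rfl (by rw [pow_one]; exact ⟨v, rfl⟩)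

theorem bracket_mem_filt {x y : TruncTensor m V} {i j : ℕ} (hx : x ∈ filt m V i)
    (hy : y ∈ filt m V j) : ⁅x, y⁆ ∈ filt m V (i + j) := by
  rw [Ring.lie_def]
  exact sub_mem (mul_mem_filt hx hy) (add_comm i j ▸ mul_mem_filt hy hx)

theorem freeNilpotentLie_le_filt {x : TruncTensor m V} (hx : x ∈ freeNilpotentLie m V) :
    x ∈ filt m V 1 := by
  let K : LieSubalgebra ℝ (TruncTensor m V) :=
    { filt m V 1 with
      lie_mem' := fun {x y} hx hy => filt_antitone (by omega) (bracket_mem_filt hx hy) }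
  have h : freeNilpotentLie m V ≤ K := by
    refine LieSubalgebra.lieSpan_le.2 ?_
    rintro _ ⟨v, rfl⟩
    exact inc_mem_filt v
  exact h hx

theorem inc_mem_freeNilpotentLie (v : V) : inc m V v ∈ freeNilpotentLie m V :=
  LieSubalgebra.subset_lieSpan ⟨v, rfl⟩

/-! ### Dilations -/

theorem dilation_inc (t : ℝ) (v : V) : dilation m V t (inc m V v) = t • inc m V v := by
  refine (RingQuot.liftAlgHom_mkAlgHom_apply ℝ _ _ (TensorAlgebra.ι ℝ v)).trans ?_
  simp

theorem dilation_of_mem_pow (t : ℝ) {k : ℕ} {x : TruncTensor m V}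
    (hx : x ∈ LinearMap.range (inc m V) ^ k) : dilation m V t x = t ^ k • x := by
  induction k generalizing x with
  | zero =>
    rw [pow_zero, Submodule.mem_one] at hx
    obtain ⟨r, rfl⟩ := hx
    simp
  | succ k ih =>
    rw [pow_succ] at hx
    induction hx using Submodule.mul_induction_on' with
    | mem_mul_mem a ha b hb =>
      obtain ⟨v, rfl⟩ := hb
      rw [map_mul, ih ha, dilation_inc, smul_mul_smul_comm, pow_succ]
    | add a _ b _ h1 h2 => rw [map_add, h1, h2, smul_add]

/-- An induction principle: `T^{(m)}(V)` is spanned by homogeneous tensors. -/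
theorem induction_homogeneous {P : TruncTensor m V → Prop}
    (hom : ∀ k, ∀ x ∈ LinearMap.range (inc m V) ^ k, P x)
    (add : ∀ x y, P x → P y → P (x + y)) (x : TruncTensor m V) : P x := by
  have hx : x ∈ ⨆ i : Fin (m + 1), LinearMap.range (inc m V) ^ (i : ℕ) := by
    rw [iSup_range_inc_pow]; trivial
  exact Submodule.iSup_induction _ (motive := P) hx (fun i x h => hom i x h)
    (hom 0 0 (zero_mem _)) add

theorem dilation_one (x : TruncTensor m V) : dilation m V 1 x = x := by
  refine induction_homogeneous (P := fun x => dilation m V 1 x = x) (fun k x hx => ?_)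
    (fun x y hx hy => by rw [map_add, hx, hy]) x
  rw [dilation_of_mem_pow 1 hx, one_pow, one_smul]

theorem dilation_dilation (s t : ℝ) (x : TruncTensor m V) :
    dilation m V s (dilation m V t x) = dilation m V (s * t) x := by
  refine induction_homogeneous
    (P := fun x => dilation m V s (dilation m V t x) = dilation m V (s * t) x)
    (fun k x hx => ?_) (fun x y hx hy => by simp only [map_add, hx, hy]) x
  rw [dilation_of_mem_pow t hx, map_smul, dilation_of_mem_pow s hx, dilation_of_mem_pow _ hx,
    smul_smul, mul_pow, mul_comm]

theorem dilation_zero_of_mem_filt {x : TruncTensor m V} (hx : x ∈ filt m V 1) :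
    dilation m V 0 x = 0 := by
  have h : filt m V 1 ≤ LinearMap.ker (dilation m V 0).toLinearMap := by
    refine iSup₂_le fun k hk x hx => ?_
    rw [LinearMap.mem_ker, AlgHom.toLinearMap_apply, dilation_of_mem_pow 0 hx,
      zero_pow (by omega), zero_smul]
  exact h hx

/-- The homogeneous components are the eigenspaces of a dilation, hence independent. -/
theorem iSupIndep_range_inc_pow : iSupIndep fun k : ℕ => LinearMap.range (inc m V) ^ k := by
  have hinj : Function.Injective fun k : ℕ => (2 : ℝ) ^ k :=
    pow_right_injective₀ (by norm_num) (by norm_num)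
  refine ((Module.End.eigenspaces_iSupIndep (dilation m V 2).toLinearMap).comp hinj).mono ?_
  intro k x hx
  simpa [Module.End.mem_eigenspace_iff] using dilation_of_mem_pow 2 hx

theorem map_dilation_freeNilpotentLie (t : ℝ) {x : TruncTensor m V}
    (hx : x ∈ freeNilpotentLie m V) : dilation m V t x ∈ freeNilpotentLie m V := by
  have h : freeNilpotentLie m V ≤
      (freeNilpotentLie m V).comap (dilation m V t : TruncTensor m V →ₗ⁅ℝ⁆ TruncTensor m V) := by
    refine LieSubalgebra.lieSpan_le.2 ?_
    rintro _ ⟨v, rfl⟩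
    change dilation m V t (inc m V v) ∈ freeNilpotentLie m V
    rw [dilation_inc]
    exact (freeNilpotentLie m V).smul_mem t (inc_mem_freeNilpotentLie v)
  exact h hx

theorem dilation_texp (t : ℝ) (x : TruncTensor m V) :
    dilation m V t (texp x) = texp (dilation m V t x) := by
  simp [texp, map_sum, map_smul, map_pow]

theorem dilation_mem_group (t : ℝ) {g : TruncTensor m V} (hg : g ∈ freeNilpotentGroup m V) :
    dilation m V t g ∈ freeNilpotentGroup m V := by
  obtain ⟨x, hx, rfl⟩ := hg
  exact ⟨dilation m V t x, map_dilation_freeNilpotentLie t hx, (dilation_texp t x).symm⟩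

theorem texp_zero : texp (0 : TruncTensor m V) = 1 := by
  rw [texp, Finset.sum_eq_single 0] <;> simp +contextual

/-- The exponential of `x` agrees with `1 + x` up to terms of degree higher than that of `x`. -/
theorem texp_sub_one_mem_filt {x : TruncTensor m V} {j : ℕ} (hj : 1 ≤ j) (hx : x ∈ filt m V j) :
    texp x - 1 - x ∈ filt m V (j + 1) ∧ texp x - 1 ∈ filt m V j := by
  have h : texp x - 1 - x ∈ filt m V (j + 1) := by
    have key : ∀ n, (∑ k ∈ Finset.range (n + 2), ((k.factorial : ℝ)⁻¹) • x ^ k) - 1 - x ∈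
        filt m V (j + 1) := by
      intro n
      induction n with
      | zero => simp [Finset.sum_range_succ]
      | succ n ih =>
        rw [Finset.sum_range_succ]
        have h2 : x ^ (n + 2) ∈ filt m V (j + 1) := by
          rw [pow_add, pow_two]
          exact mul_mem_filt_right _ (filt_antitone (by omega) (mul_mem_filt hx hx))
        have := add_mem ih (Submodule.smul_mem _ (((n + 2).factorial : ℝ)⁻¹) h2)
        convert this using 1
        abel
    rcases m with _ | n
    · rw [filt_eq_bot (by omega)] at hx ⊢
      rw [Submodule.mem_bot] at hx ⊢
      rw [hx, texp_zero]; simp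
    · exact key n
  refine ⟨h, ?_⟩
  have := add_mem (filt_antitone (Nat.le_succ j) h) hx
  simpa using this

theorem sub_one_mem_filt_of_mem_group {g : TruncTensor m V} (hg : g ∈ freeNilpotentGroup m V) :
    g - 1 ∈ filt m V 1 := by
  obtain ⟨x, hx, rfl⟩ := hg
  exact (texp_sub_one_mem_filt le_rfl (freeNilpotentLie_le_filt hx)).2

theorem one_mem_group : (1 : TruncTensor m V) ∈ freeNilpotentGroup m V :=
  ⟨0, (freeNilpotentLie m V).zero_mem, texp_zero⟩

theorem dilation_zero_of_mem_group {g : TruncTensor m V} (hg : g ∈ freeNilpotentGroup m V) :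
    dilation m V 0 g = 1 := by
  have h := dilation_zero_of_mem_filt (sub_one_mem_filt_of_mem_group hg)
  rwa [map_sub, map_one, sub_eq_zero] at h

end Filtration

/-! ### Curves and subspaces -/

section Curves

variable {E : Type*} [NormedAddCommGroup E] [NormedSpace ℝ E] [FiniteDimensional ℝ E]

/-- A curve whose derivative lies in a subspace `p` stays in a coset of `p`. -/
theorem sub_mem_of_deriv_mem {p : Submodule ℝ E} {f f' : ℝ → E} {a b : ℝ}
    (hf : ∀ t ∈ Icc a b, HasDerivWithinAt f (f' t) (Icc a b) t)
    (hp : ∀ t ∈ Icc a b, f' t ∈ p) {t : ℝ} (ht : t ∈ Icc a b) : f t - f a ∈ p := by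
  by_contra hn
  obtain ⟨φ, hφ, hker⟩ := Submodule.exists_le_ker_of_notMem hn
  have hd : ∀ t ∈ Icc a b,
      HasDerivWithinAt (fun t => φ.toContinuousLinearMap (f t)) 0 (Icc a b) t := by
    intro t ht
    have h := φ.toContinuousLinearMap.hasFDerivAt.comp_hasDerivWithinAt t (hf t ht)
    have h0 : φ.toContinuousLinearMap (f' t) = 0 := hker (hp t ht)
    rwa [h0] at h
  have hc := constant_of_has_deriv_right_zero (fun t ht => (hd t ht).continuousWithinAt)
    (fun t ht => (hd t (Ico_subset_Icc_self ht)).mono_of_mem_nhdsWithin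
      (Icc_mem_nhdsGE_of_mem ht)) t ht
  apply hφ
  rw [map_sub, sub_eq_zero]
  exact hc

/-- The derivative of a curve in a subspace lies in that subspace. -/
theorem deriv_mem_of_mem {p : Submodule ℝ E} {f : ℝ → E} {f' : E} {a b t : ℝ} (hab : a < b)
    (ht : t ∈ Icc a b) (hf : HasDerivWithinAt f f' (Icc a b) t)
    (hp : ∀ t ∈ Icc a b, f t ∈ p) : f' ∈ p := by
  by_contra hn
  obtain ⟨φ, hφ, hker⟩ := Submodule.exists_le_ker_of_notMem hn
  have h := φ.toContinuousLinearMap.hasFDerivAt.comp_hasDerivWithinAt t hf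
  have h0 : HasDerivWithinAt (fun _ : ℝ => (0 : ℝ)) (φ.toContinuousLinearMap f') (Icc a b) t :=
    h.congr (fun s hs => (hker (hp s hs)).symm) (hker (hp t ht)).symm
  exact hφ ((uniqueDiffOn_Icc hab t ht).eq_deriv _ h0 (hasDerivWithinAt_const _ _ _))

end Curves

/-! ### Calculus in the truncated tensor algebra -/

section Calculus

variable {m : ℕ} {V : Type*} [NormedAddCommGroup V] [NormedSpace ℝ V] [FiniteDimensional ℝ V]

variable (m V) in
/-- The product of `T^{(m)}(V)` as a continuous bilinear map. -/
def mulCLM : TruncTensor m V →L[ℝ] TruncTensor m V →L[ℝ] TruncTensor m V :=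
  (LinearMap.mul ℝ (TruncTensor m V)).toContinuousBilinearMap

@[simp] theorem mulCLM_apply (x y : TruncTensor m V) : mulCLM m V x y = x * y := rfl

instance : ContinuousMul (TruncTensor m V) :=
  ⟨(mulCLM m V).continuous₂⟩

theorem hasDerivWithinAt_mul {f g : ℝ → TruncTensor m V} {f' g' : TruncTensor m V} {s : Set ℝ}
    {t : ℝ} (hf : HasDerivWithinAt f f' s t) (hg : HasDerivWithinAt g g' s t) :
    HasDerivWithinAt (fun t => f t * g t) (f' * g t + f t * g') s t := by
  have h := (mulCLM m V).hasDerivWithinAt_of_bilinear hf hg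
  rw [add_comm] at h
  exact h

/-- The derivative of `L ↦ L ^ k` at `L` in the direction `H`. -/
def dpow (L H : TruncTensor m V) : ℕ → TruncTensor m V
  | 0 => 0
  | k + 1 => L * dpow L H k + H * L ^ k

/-- The derivative of the exponential at `L` in the direction `H`. -/
def dexp (L H : TruncTensor m V) : TruncTensor m V :=
  ∑ k ∈ Finset.range (m + 1), ((k.factorial : ℝ)⁻¹) • dpow L H k

theorem hasDerivWithinAt_pow {L : ℝ → TruncTensor m V} {L' : TruncTensor m V} {s : Set ℝ}
    {t : ℝ} (hL : HasDerivWithinAt L L' s t) (k : ℕ) :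
    HasDerivWithinAt (fun t => L t ^ k) (dpow (L t) L' k) s t := by
  induction k with
  | zero => simpa [dpow] using hasDerivWithinAt_const t s (1 : TruncTensor m V)
  | succ k ih =>
    have h := hasDerivWithinAt_mul hL ih
    rw [add_comm] at h
    simp only [pow_succ']
    exact h

theorem hasDerivWithinAt_texp {L : ℝ → TruncTensor m V} {L' : TruncTensor m V} {s : Set ℝ}
    {t : ℝ} (hL : HasDerivWithinAt L L' s t) :
    HasDerivWithinAt (fun t => texp (L t)) (dexp (L t) L') s t := by
  simp only [texp, dexp]
  exact HasDerivWithinAt.fun_sum fun k _ => (hasDerivWithinAt_pow hL k).fun_const_smul _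

theorem dpow_mem_filt {L H : TruncTensor m V} (hL : L ∈ filt m V 1) (hH : H ∈ filt m V 1)
    (k : ℕ) : dpow L H k ∈ filt m V k := by
  induction k with
  | zero => exact mem_filt_zero _
  | succ k ih =>
    refine add_mem ?_ ?_
    · exact add_comm 1 k ▸ mul_mem_filt hL ih
    · exact add_comm 1 k ▸ mul_mem_filt hH (pow_mem_filt hL k)

/-- Differentiating a truncated exponential generating function shifts its coefficients. -/
theorem hasDerivWithinAt_sum_pow {c : ℕ → TruncTensor m V} (hc : c (m + 1) = 0) (D : Set ℝ)
    (s : ℝ) :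
    HasDerivWithinAt (fun s : ℝ => ∑ k ∈ Finset.range (m + 1), (s ^ k * (k.factorial : ℝ)⁻¹) • c k)
      (∑ k ∈ Finset.range (m + 1), (s ^ k * (k.factorial : ℝ)⁻¹) • c (k + 1)) D s := by
  have h : ∀ k, HasDerivWithinAt (fun s : ℝ => (s ^ k * (k.factorial : ℝ)⁻¹) • c k)
      ((k * s ^ (k - 1) * (k.factorial : ℝ)⁻¹) • c k) D s := fun k =>
    (((hasDerivAt_pow k s).mul_const _).smul_const (c k)).hasDerivWithinAt
  refine (HasDerivWithinAt.fun_sum (u := Finset.range (m + 1)) fun k _ => h k).congr_deriv ?_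
  symm
  rw [Finset.sum_range_succ, hc, smul_zero, add_zero, Finset.sum_range_succ']
  simp only [Nat.cast_zero, zero_mul, zero_smul, add_zero]
  refine Finset.sum_congr rfl fun k _ => ?_
  congr 1
  have h1 : ((k + 1 : ℕ) : ℝ) ≠ 0 := by positivity
  have h2 : (k.factorial : ℝ) ≠ 0 := by positivity
  rw [Nat.factorial_succ, Nat.add_sub_cancel]
  push_cast at h1 ⊢
  field_simp

theorem texp_smul (s : ℝ) (L : TruncTensor m V) :
    texp (s • L) = ∑ k ∈ Finset.range (m + 1), (s ^ k * (k.factorial : ℝ)⁻¹) • L ^ k := by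
  refine Finset.sum_congr rfl fun k _ => ?_
  rw [smul_pow, smul_smul, mul_comm]

theorem hasDerivWithinAt_texp_smul {L : TruncTensor m V} (hL : L ∈ filt m V 1) (D : Set ℝ)
    (s : ℝ) : HasDerivWithinAt (fun s : ℝ => texp (s • L)) (L * texp (s • L)) D s := by
  simp only [texp_smul]
  have h := hasDerivWithinAt_sum_pow (c := fun k => L ^ k) (pow_eq_zero_of_mem_filt hL) D s
  refine h.congr_deriv ?_
  symm
  rw [Finset.mul_sum]
  exact Finset.sum_congr rfl fun k _ => by rw [mul_smul_comm, pow_succ']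

theorem commute_texp_smul (s : ℝ) (L : TruncTensor m V) : Commute L (texp (s • L)) := by
  rw [texp_smul]
  exact Commute.sum_right _ _ _ fun k _ => ((Commute.refl L).pow_right k).smul_right _

theorem eq_of_deriv_eq_zero {f f' : ℝ → TruncTensor m V} {a b : ℝ}
    (hf : ∀ t ∈ Icc a b, HasDerivWithinAt f (f' t) (Icc a b) t)
    (h0 : ∀ t ∈ Icc a b, f' t = 0) {t : ℝ} (ht : t ∈ Icc a b) : f t = f a := by
  have := sub_mem_of_deriv_mem (p := ⊥) hf (fun t ht => by simp [h0 t ht]) ht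
  simpa [sub_eq_zero] using this

theorem texp_neg_mul_texp {L : TruncTensor m V} (hL : L ∈ filt m V 1) :
    texp (-L) * texp L = 1 := by
  have hd : ∀ s ∈ Icc (0 : ℝ) 1, HasDerivWithinAt (fun s : ℝ => texp (s • -L) * texp (s • L))
      ((-L * texp (s • -L)) * texp (s • L) + texp (s • -L) * (L * texp (s • L))) (Icc 0 1) s :=
    fun s _ => hasDerivWithinAt_mul (hasDerivWithinAt_texp_smul (neg_mem hL) _ s)
      (hasDerivWithinAt_texp_smul hL _ s)
  have h := eq_of_deriv_eq_zero hd (fun s _ => by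
    rw [(commute_texp_smul s (-L)).eq]
    noncomm_ring) (right_mem_Icc.2 zero_le_one)
  simpa [texp_zero] using h

theorem texp_mul_texp_neg {L : TruncTensor m V} (hL : L ∈ filt m V 1) :
    texp L * texp (-L) = 1 := by
  simpa using texp_neg_mul_texp (neg_mem hL)

/-! ### The logarithm -/

/-- The logarithm of `1 + z`, for `z` without scalar part: the terms of the logarithmic series of
order greater than `m` vanish. -/
def tlog (z : TruncTensor m V) : TruncTensor m V :=
  ∑ k ∈ Finset.range m, ((-1 : ℝ) ^ k * ((k : ℝ) + 1)⁻¹) • z ^ (k + 1)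

theorem dpow_of_commute {L H : TruncTensor m V} (h : Commute L H) (k : ℕ) :
    dpow L H (k + 1) = ((k : ℝ) + 1) • (L ^ k * H) := by
  induction k with
  | zero => simp [dpow]
  | succ k ih =>
    rw [dpow, ih, mul_smul_comm, ← mul_assoc, ← pow_succ', ← (h.pow_left (k + 1)).eq]
    push_cast
    module

theorem dexp_of_commute {L H : TruncTensor m V} (hL : L ∈ filt m V 1) (hH : H ∈ filt m V 1)
    (h : Commute L H) : dexp L H = texp L * H := by
  have htop : L ^ m * H = 0 :=
    eq_zero_of_mem_filt (Nat.lt_add_one m) (mul_mem_filt (pow_mem_filt hL m) hH)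
  rw [dexp, Finset.sum_range_succ', texp, Finset.sum_range_succ, add_mul, smul_mul_assoc, htop]
  simp only [dpow, smul_zero, add_zero, Finset.sum_mul]
  refine Finset.sum_congr rfl fun k _ => ?_
  change _ • dpow L H (k + 1) = _
  rw [dpow_of_commute h, smul_smul, smul_mul_assoc]
  congr 1
  have h1 : (k : ℝ) + 1 ≠ 0 := by positivity
  have h2 : (k.factorial : ℝ) ≠ 0 := by positivity
  rw [Nat.factorial_succ]
  push_cast
  field_simp

/-- The derivative of the logarithm along a curve commuting with its velocity. -/
theorem hasDerivWithinAt_tlog_of_commute {z : ℝ → TruncTensor m V} {z' : TruncTensor m V}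
    {D : Set ℝ} {s : ℝ} (hz : HasDerivWithinAt z z' D s) (h : Commute (z s) z') :
    HasDerivWithinAt (fun s => tlog (z s)) ((∑ k ∈ Finset.range m, (-z s) ^ k) * z') D s := by
  simp only [tlog]
  refine (HasDerivWithinAt.fun_sum (u := Finset.range m) fun k _ =>
    (hasDerivWithinAt_pow hz (k + 1)).fun_const_smul
      ((-1 : ℝ) ^ k * ((k : ℝ) + 1)⁻¹)).congr_deriv ?_
  symm
  rw [Finset.sum_mul]
  refine Finset.sum_congr rfl fun k _ => ?_
  have h1 : (k : ℝ) + 1 ≠ 0 := by positivity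
  rw [dpow_of_commute h, smul_smul, mul_assoc, inv_mul_cancel₀ h1, mul_one,
    ← neg_one_smul ℝ (z s), smul_pow, smul_mul_assoc]

/-- A truncated geometric series inverts `1 + z` on elements without scalar part. -/
theorem geom_sum_mul_one_add {z : TruncTensor m V} (hz : z ∈ filt m V 1) (w : TruncTensor m V)
    (hw : w ∈ filt m V 1) :
    (∑ k ∈ Finset.range m, (-z) ^ k) * ((1 + z) * w) = w := by
  have h := geom_sum_mul_neg (-z) m
  rw [sub_neg_eq_add] at h
  rw [← mul_assoc, h, sub_mul, one_mul, sub_eq_self]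
  exact eq_zero_of_mem_filt (Nat.lt_add_one m) (mul_mem_filt (pow_mem_filt (neg_mem hz) m) hw)

theorem tlog_mem_filt {z : TruncTensor m V} (hz : z ∈ filt m V 1) : tlog z ∈ filt m V 1 :=
  sum_mem fun k _ => Submodule.smul_mem _ _ (filt_antitone (by omega) (pow_mem_filt hz (k + 1)))

theorem tlog_zero : tlog (0 : TruncTensor m V) = 0 := by simp [tlog]

/-- The derivative of `s ↦ log (exp (s L))` is `L`. -/
theorem tlog_texp {L : TruncTensor m V} (hL : L ∈ filt m V 1) : tlog (texp L - 1) = L := by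
  have hmem : ∀ s : ℝ, texp (s • L) - 1 ∈ filt m V 1 := fun s =>
    (texp_sub_one_mem_filt le_rfl (Submodule.smul_mem _ s hL)).2
  have hd : ∀ s ∈ Icc (0 : ℝ) 1, HasDerivWithinAt (fun s : ℝ => tlog (texp (s • L) - 1) - s • L)
      0 (Icc 0 1) s := by
    intro s _
    have h1 := hasDerivWithinAt_tlog_of_commute
      ((hasDerivWithinAt_texp_smul hL (Icc 0 1) s).sub_const 1)
      (((commute_texp_smul s L).mul_left (Commute.refl _)).sub_right (Commute.one_right _)).symm
    have h2 := h1.sub ((hasDerivAt_id s).smul_const L).hasDerivWithinAt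
    refine h2.congr_deriv ?_
    have h3 := geom_sum_mul_one_add (hmem s) L hL
    rw [add_sub_cancel, ← (commute_texp_smul s L).eq] at h3
    rw [h3]; simp
  have h := eq_of_deriv_eq_zero hd (fun _ _ => rfl) (right_mem_Icc.2 zero_le_one)
  simpa [texp_zero, tlog_zero, sub_eq_zero] using h

theorem commute_tlog {z w : TruncTensor m V} (h : Commute w z) : Commute w (tlog z) :=
  Commute.sum_right _ _ _ fun _ _ => (h.pow_right _).smul_right _

/-- The curve `s ↦ exp (-log (1 + s z)) (1 + s z)` is constant. -/
theorem texp_tlog {z : TruncTensor m V} (hz : z ∈ filt m V 1) : texp (tlog z) = 1 + z := by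
  have hs : ∀ s : ℝ, s • z ∈ filt m V 1 := fun s => Submodule.smul_mem _ s hz
  have hd : ∀ s ∈ Icc (0 : ℝ) 1,
      HasDerivWithinAt (fun s : ℝ => texp (-tlog (s • z)) * (1 + s • z)) 0 (Icc 0 1) s := by
    intro s _
    have hcz : Commute (s • z) z := (Commute.refl z).smul_left s
    have h0 := ((hasDerivAt_id s).smul_const z).hasDerivWithinAt (s := Icc 0 1)
    simp only [id, one_smul] at h0
    have h1 := (hasDerivWithinAt_tlog_of_commute h0 hcz).fun_neg
    set w := (∑ k ∈ Finset.range m, (-(s • z)) ^ k) * z with hw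
    have hwz : Commute w z :=
      (Commute.sum_left _ _ _ fun k _ => hcz.neg_left.pow_left k).mul_left (Commute.refl z)
    have hwm : w ∈ filt m V 1 := mul_mem_filt_right _ hz
    have h2 := hasDerivWithinAt_texp h1
    rw [dexp_of_commute (neg_mem (tlog_mem_filt (hs s))) (neg_mem hwm)
      (commute_tlog (hwz.smul_right s)).symm.neg_left.neg_right] at h2
    refine (hasDerivWithinAt_mul h2 (h0.const_add 1)).congr_deriv ?_
    have h3 := geom_sum_mul_one_add (hs s) z hz
    have h4 : Commute (1 + s • z) z := (Commute.one_left z).add_left hcz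
    rw [h4.eq, ← mul_assoc, ← hw] at h3
    rw [mul_neg, neg_mul, mul_assoc, h3, neg_add_cancel]
  have h := eq_of_deriv_eq_zero hd (fun _ _ => rfl) (right_mem_Icc.2 zero_le_one)
  simp only [one_smul, zero_smul, tlog_zero, neg_zero, texp_zero, add_zero, mul_one] at h
  have h5 := congrArg (texp (tlog z) * ·) h
  simp only [← mul_assoc, texp_mul_texp_neg (tlog_mem_filt hz), one_mul, mul_one] at h5
  exact h5.symm

theorem hasDerivWithinAt_tlog {z : ℝ → TruncTensor m V} {z' : TruncTensor m V}
    {D : Set ℝ} {s : ℝ} (hz : HasDerivWithinAt z z' D s) :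
    ∃ w, HasDerivWithinAt (fun s => tlog (z s)) w D s :=
  ⟨_, HasDerivWithinAt.fun_sum (u := Finset.range m) fun k _ =>
    (hasDerivWithinAt_pow hz (k + 1)).fun_const_smul ((-1 : ℝ) ^ k * ((k : ℝ) + 1)⁻¹)⟩

theorem continuous_tlog : Continuous (tlog : TruncTensor m V → TruncTensor m V) :=
  continuous_finsetSum _ fun _ _ => (continuous_pow _).fun_const_smul _

theorem continuous_texp : Continuous (texp : TruncTensor m V → TruncTensor m V) :=
  continuous_finsetSum _ fun _ _ => (continuous_pow _).fun_const_smul _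

/-- `G^m(V)` consists of the elements with scalar part `1` and logarithm in `𝒢^m(V)`. -/
theorem mem_group_iff {g : TruncTensor m V} :
    g ∈ freeNilpotentGroup m V ↔ g - 1 ∈ filt m V 1 ∧ tlog (g - 1) ∈ freeNilpotentLie m V := by
  constructor
  · intro hg
    refine ⟨sub_one_mem_filt_of_mem_group hg, ?_⟩
    obtain ⟨x, hx, rfl⟩ := hg
    rw [tlog_texp (freeNilpotentLie_le_filt hx)]
    exact hx
  · rintro ⟨h1, h2⟩
    exact ⟨_, h2, by rw [texp_tlog h1, add_sub_cancel]⟩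

theorem isClosed_group : IsClosed (freeNilpotentGroup m V) := by
  have h : freeNilpotentGroup m V = (fun g => g - 1) ⁻¹' (filt m V 1 : Set (TruncTensor m V)) ∩
      (fun g => tlog (g - 1)) ⁻¹'
        ((freeNilpotentLie m V).toSubmodule : Set (TruncTensor m V)) := by
    ext g
    exact mem_group_iff
  rw [h]
  have hc : Continuous fun g : TruncTensor m V => g - 1 := continuous_id.sub continuous_const
  exact ((Submodule.closed_of_finiteDimensional _).preimage hc).inter
    ((Submodule.closed_of_finiteDimensional _).preimage (continuous_tlog.comp hc))

end Calculus

/-! ### Differential equations in the free nilpotent group -/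

section GroupODE

variable {m : ℕ} {V : Type*} [NormedAddCommGroup V] [NormedSpace ℝ V] [FiniteDimensional ℝ V]

variable (m V) in
/-- The elements which agree with an element of `𝒢^m(V)` up to tensors of degree at least `j`. -/
def lieModFilt (j : ℕ) : Submodule ℝ (TruncTensor m V) :=
  (freeNilpotentLie m V).toSubmodule ⊔ filt m V j

theorem lieModFilt_antitone {i j : ℕ} (h : i ≤ j) : lieModFilt m V j ≤ lieModFilt m V i :=
  sup_le_sup_left (filt_antitone h) _

theorem mem_lieModFilt_of_mem_lie {x : TruncTensor m V} (hx : x ∈ freeNilpotentLie m V) (j : ℕ) :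
    x ∈ lieModFilt m V j :=
  Submodule.mem_sup_left hx

theorem mem_lieModFilt_of_mem_filt {x : TruncTensor m V} {j : ℕ} (hx : x ∈ filt m V j) :
    x ∈ lieModFilt m V j :=
  Submodule.mem_sup_right hx

theorem mem_lie_of_mem_lieModFilt {x : TruncTensor m V} (hx : x ∈ lieModFilt m V (m + 1)) :
    x ∈ freeNilpotentLie m V := by
  rw [lieModFilt, filt_eq_bot (Nat.lt_add_one m), sup_bot_eq] at hx
  exact hx

theorem mem_filt_of_mem_lieModFilt {x : TruncTensor m V} {j : ℕ} (hj : 1 ≤ j)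
    (hx : x ∈ lieModFilt m V j) : x ∈ filt m V 1 := by
  have h : lieModFilt m V j ≤ filt m V 1 :=
    sup_le (fun _ => freeNilpotentLie_le_filt) (filt_antitone hj)
  exact h hx

/-- Since `𝒢^m(V)` is closed under brackets and has no scalar part, a bracket is known to be a
Lie element in one degree more than its arguments. -/
theorem commutator_mem_lieModFilt {x y : TruncTensor m V} {j : ℕ} (hj : 1 ≤ j)
    (hx : x ∈ lieModFilt m V j) (hy : y ∈ lieModFilt m V j) :
    x * y - y * x ∈ lieModFilt m V (j + 1) := by
  obtain ⟨g, hg, a, ha, rfl⟩ := Submodule.mem_sup.1 hx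
  obtain ⟨h, hh, b, hb, rfl⟩ := Submodule.mem_sup.1 hy
  have hg1 := freeNilpotentLie_le_filt hg
  have h1 : (g + a) ∈ filt m V 1 := add_mem hg1 (filt_antitone hj ha)
  have h2 : h ∈ filt m V 1 := freeNilpotentLie_le_filt hh
  have e : (g + a) * (h + b) - (h + b) * (g + a) = ⁅g, h⁆ + (⁅a, h⁆ + ⁅g + a, b⁆) := by
    simp only [Ring.lie_def]; noncomm_ring
  rw [e]
  refine add_mem (mem_lieModFilt_of_mem_lie ((freeNilpotentLie m V).lie_mem hg hh) _)
    (mem_lieModFilt_of_mem_filt (add_mem (bracket_mem_filt ha h2) ?_))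
  exact add_comm 1 j ▸ bracket_mem_filt h1 hb

/-- The curve `s ↦ C s = exp (-s L) H exp (s L)` solves `C' = [C, L]`, so it is `H` up to
elements known to be Lie in one degree more than `L` and `H`. -/
theorem conj_texp_sub_mem {L H : TruncTensor m V} {j : ℕ} (hj : 1 ≤ j)
    (hL : L ∈ lieModFilt m V j) (hH : H ∈ lieModFilt m V j) {s : ℝ} (hs : s ∈ Icc (0 : ℝ) 1) :
    texp (s • -L) * H * texp (s • L) - H ∈ lieModFilt m V (j + 1) := by
  have hL1 := mem_filt_of_mem_lieModFilt hj hL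
  set C : ℝ → TruncTensor m V := fun s => texp (s • -L) * H * texp (s • L) with hC
  have hd : ∀ s ∈ Icc (0 : ℝ) 1, HasDerivWithinAt C (C s * L - L * C s) (Icc 0 1) s := by
    intro s _
    have h1 := hasDerivWithinAt_mul (hasDerivWithinAt_mul
      (hasDerivWithinAt_texp_smul (neg_mem hL1) (Icc 0 1) s)
      (hasDerivWithinAt_const s (Icc 0 1) H)) (hasDerivWithinAt_texp_smul hL1 (Icc 0 1) s)
    refine h1.congr_deriv ?_
    have h2 := (commute_texp_smul s L).eq
    simp only [hC, mul_zero, add_zero]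
    rw [h2]
    noncomm_ring
  have hmem : ∀ i, 1 ≤ i → i ≤ j → ∀ s ∈ Icc (0 : ℝ) 1, C s ∈ lieModFilt m V i := by
    intro i hi
    induction i, hi using Nat.le_induction with
    | base =>
      intro _ s _
      refine mem_lieModFilt_of_mem_filt (mul_mem_filt_left _ (mul_mem_filt_right _ ?_))
      exact mem_filt_of_mem_lieModFilt hj hH
    | succ i hi ih =>
      intro hij s hs
      have h1 := sub_mem_of_deriv_mem hd (fun s hs => commutator_mem_lieModFilt hi
        (ih (by omega) s hs) (lieModFilt_antitone (by omega) hL)) hs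
      have h2 : C 0 ∈ lieModFilt m V (i + 1) := by
        simpa [hC, texp_zero] using lieModFilt_antitone hij hH
      simpa using add_mem h1 h2
  have h := sub_mem_of_deriv_mem hd (fun s hs => commutator_mem_lieModFilt hj
        (hmem j hj le_rfl s hs) hL) hs
  simpa [hC, texp_zero] using h

/-- The logarithmic derivative of the exponential in the direction `H` is `H` up to brackets,
so it is `H` up to elements known to be Lie in one degree more. It is the integral over `[0,1]`
of `s ↦ exp (-s L) H exp (s L)`. -/
theorem texp_neg_mul_dexp_sub_mem {L H : TruncTensor m V} {j : ℕ} (hj : 1 ≤ j)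
    (hL : L ∈ lieModFilt m V j) (hH : H ∈ lieModFilt m V j) :
    texp (-L) * dexp L H - H ∈ lieModFilt m V (j + 1) := by
  have hL1 := mem_filt_of_mem_lieModFilt hj hL
  have hH1 := mem_filt_of_mem_lieModFilt hj hH
  set E : ℝ → TruncTensor m V := fun s =>
    ∑ k ∈ Finset.range (m + 1), (s ^ k * (k.factorial : ℝ)⁻¹) • dpow L H k with hE
  have hEd : ∀ s, HasDerivWithinAt E (L * E s + H * texp (s • L)) (Icc 0 1) s := by
    intro s
    refine (hasDerivWithinAt_sum_pow (c := dpow L H) (eq_zero_of_mem_filt (Nat.lt_add_one m)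
      (dpow_mem_filt hL1 hH1 (m + 1))) (Icc 0 1) s).congr_deriv ?_
    simp only [hE, texp_smul, Finset.mul_sum, ← Finset.sum_add_distrib, dpow, mul_smul_comm,
      smul_add]
  have hd : ∀ s ∈ Icc (0 : ℝ) 1, HasDerivWithinAt (fun s => texp (s • -L) * E s - s • H)
      (texp (s • -L) * H * texp (s • L) - H) (Icc 0 1) s := by
    intro s _
    have h1 := hasDerivWithinAt_mul (hasDerivWithinAt_texp_smul (neg_mem hL1) (Icc 0 1) s) (hEd s)
    have h2 := h1.fun_sub ((hasDerivAt_id s).smul_const H).hasDerivWithinAt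
    refine h2.congr_deriv ?_
    rw [(commute_texp_smul s (-L)).eq]
    simp only [one_smul]
    noncomm_ring
  have h := sub_mem_of_deriv_mem hd (fun s hs => conj_texp_sub_mem hj hL hH hs)
    (right_mem_Icc.2 zero_le_one)
  have h0 : E 0 = 0 := by
    refine Finset.sum_eq_zero fun k _ => ?_
    rcases k with _ | k <;> simp [dpow]
  have h1 : E 1 = dexp L H := by simp [hE, dexp]
  simpa [h0, h1] using h

/-- The free nilpotent group is invariant under differential equations `S' = S a` driven by a
curve `a` in its Lie algebra. The logarithm of `S` is shown to be a Lie element in more and more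
degrees. -/
theorem mem_group_of_ode {S a : ℝ → TruncTensor m V} {α β : ℝ}
    (hS : ∀ t ∈ Icc α β, HasDerivWithinAt S (S t * a t) (Icc α β) t)
    (ha : ∀ t ∈ Icc α β, a t ∈ freeNilpotentLie m V) (h0 : S α ∈ freeNilpotentGroup m V)
    {t : ℝ} (ht : t ∈ Icc α β) : S t ∈ freeNilpotentGroup m V := by
  rcases (ht.1.trans ht.2).eq_or_lt with hαβ | hαβ
  · have : t = α := le_antisymm (hαβ ▸ ht.2) ht.1
    rwa [this]
  have hS1 : ∀ t ∈ Icc α β, S t - 1 ∈ filt m V 1 := by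
    intro t ht
    have h := sub_mem_of_deriv_mem hS (fun t ht => mul_mem_filt_right (S t)
      (freeNilpotentLie_le_filt (ha t ht))) ht
    simpa using add_mem h (sub_one_mem_filt_of_mem_group h0)
  set L : ℝ → TruncTensor m V := fun t => tlog (S t - 1) with hLdef
  have hexp : ∀ t ∈ Icc α β, texp (L t) = S t := fun t ht => by
    rw [hLdef, texp_tlog (hS1 t ht), add_sub_cancel]
  have hLd : ∀ t ∈ Icc α β, ∃ w, HasDerivWithinAt L w (Icc α β) t := fun t ht =>
    hasDerivWithinAt_tlog ((hS t ht).sub_const 1)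
  choose! L' hL' using hLd
  have hL0 : L α ∈ freeNilpotentLie m V := (mem_group_iff.1 h0).2
  have hL1 : ∀ t ∈ Icc α β, L t ∈ filt m V 1 := fun t ht => tlog_mem_filt (hS1 t ht)
  -- the logarithmic derivative of `S = exp L` is `a`
  have hrel : ∀ t ∈ Icc α β, texp (-L t) * dexp (L t) (L' t) = a t := by
    intro t ht
    have h1 := (hasDerivWithinAt_texp (hL' t ht)).congr (fun s hs => (hexp s hs).symm)
      (hexp t ht).symm
    rw [(uniqueDiffOn_Icc hαβ t ht).eq_deriv _ h1 (hS t ht), ← hexp t ht, ← mul_assoc,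
      texp_neg_mul_texp (hL1 t ht), one_mul]
  have key : ∀ j, 1 ≤ j → ∀ t ∈ Icc α β, L t ∈ lieModFilt m V j := by
    intro j hj
    induction j, hj using Nat.le_induction with
    | base => exact fun t ht => mem_lieModFilt_of_mem_filt (hL1 t ht)
    | succ j hj ih =>
      intro t ht
      have h1 : ∀ t ∈ Icc α β, L' t ∈ lieModFilt m V (j + 1) := by
        intro t ht
        have h2 := texp_neg_mul_dexp_sub_mem hj (ih t ht)
          (deriv_mem_of_mem hαβ ht (hL' t ht) ih)
        rw [hrel t ht] at h2
        simpa using sub_mem (mem_lieModFilt_of_mem_lie (ha t ht) (j + 1)) h2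
      have h2 := sub_mem_of_deriv_mem hL' h1 ht
      simpa using add_mem h2 (mem_lieModFilt_of_mem_lie hL0 (j + 1))
  exact mem_group_iff.2 ⟨hS1 t ht, mem_lie_of_mem_lieModFilt (key (m + 1) (by omega) t ht)⟩

theorem mul_mem_group {g h : TruncTensor m V} (hg : g ∈ freeNilpotentGroup m V)
    (hh : h ∈ freeNilpotentGroup m V) : g * h ∈ freeNilpotentGroup m V := by
  obtain ⟨x, hx, rfl⟩ := hh
  have hd : ∀ s ∈ Icc (0 : ℝ) 1, HasDerivWithinAt (fun s : ℝ => g * texp (s • x))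
      (g * texp (s • x) * x) (Icc 0 1) s := by
    intro s _
    refine (hasDerivWithinAt_mul (hasDerivWithinAt_const s _ g)
      (hasDerivWithinAt_texp_smul (freeNilpotentLie_le_filt hx) _ s)).congr_deriv ?_
    rw [(commute_texp_smul s x).eq, zero_mul, zero_add, mul_assoc]
  have := mem_group_of_ode (a := fun _ => x) hd (fun _ _ => hx) (by simpa [texp_zero] using hg)
    (right_mem_Icc.2 zero_le_one)
  simpa using this

theorem exists_inverse_of_mem_group {g : TruncTensor m V} (hg : g ∈ freeNilpotentGroup m V) :
    ∃ h ∈ freeNilpotentGroup m V, g * h = 1 ∧ h * g = 1 := by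
  obtain ⟨x, hx, rfl⟩ := hg
  have hx1 := freeNilpotentLie_le_filt hx
  exact ⟨texp (-x), ⟨-x, neg_mem hx, rfl⟩, texp_mul_texp_neg hx1, texp_neg_mul_texp hx1⟩

theorem ring_inverse_eq {g h : TruncTensor m V} (h1 : g * h = 1) (h2 : h * g = 1) :
    Ring.inverse g = h :=
  Ring.inverse_unit (⟨g, h, h1, h2⟩ : (TruncTensor m V)ˣ)

theorem inverse_mem_group {g : TruncTensor m V} (hg : g ∈ freeNilpotentGroup m V) :
    Ring.inverse g ∈ freeNilpotentGroup m V := by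
  obtain ⟨h, hh, h1, h2⟩ := exists_inverse_of_mem_group hg
  rwa [ring_inverse_eq h1 h2]

theorem mul_inverse_of_mem_group {g : TruncTensor m V} (hg : g ∈ freeNilpotentGroup m V) :
    g * Ring.inverse g = 1 := by
  obtain ⟨h, hh, h1, h2⟩ := exists_inverse_of_mem_group hg
  rwa [ring_inverse_eq h1 h2]

theorem inverse_mul_of_mem_group {g : TruncTensor m V} (hg : g ∈ freeNilpotentGroup m V) :
    Ring.inverse g * g = 1 := by
  obtain ⟨h, hh, h1, h2⟩ := exists_inverse_of_mem_group hg
  rwa [ring_inverse_eq h1 h2]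

theorem inverse_inverse_of_mem_group {g : TruncTensor m V} (hg : g ∈ freeNilpotentGroup m V) :
    Ring.inverse (Ring.inverse g) = g :=
  ring_inverse_eq (inverse_mul_of_mem_group hg) (mul_inverse_of_mem_group hg)

theorem inverse_mul_rev {g h : TruncTensor m V} (hg : g ∈ freeNilpotentGroup m V)
    (hh : h ∈ freeNilpotentGroup m V) :
    Ring.inverse (g * h) = Ring.inverse h * Ring.inverse g := by
  refine ring_inverse_eq ?_ ?_
  · rw [mul_assoc, ← mul_assoc h, mul_inverse_of_mem_group hh, one_mul,
      mul_inverse_of_mem_group hg]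
  · rw [mul_assoc, ← mul_assoc _ g, inverse_mul_of_mem_group hg, one_mul,
      inverse_mul_of_mem_group hh]

/-- On the group the inverse is a polynomial, namely `exp (-log g)`. -/
theorem inverse_eq_texp_neg_tlog {g : TruncTensor m V} (hg : g ∈ freeNilpotentGroup m V) :
    Ring.inverse g = texp (-tlog (g - 1)) := by
  have h1 := sub_one_mem_filt_of_mem_group hg
  have h2 := texp_tlog h1
  rw [add_sub_cancel] at h2
  have h3 := tlog_mem_filt h1
  apply ring_inverse_eq
  · nth_rw 1 [← h2]; exact texp_mul_texp_neg h3
  · nth_rw 2 [← h2]; exact texp_neg_mul_texp h3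

theorem continuousOn_inverse : ContinuousOn (Ring.inverse : TruncTensor m V → TruncTensor m V)
    (freeNilpotentGroup m V) :=
  ((continuous_texp.comp (continuous_tlog.comp (continuous_id.sub
    continuous_const)).neg).continuousOn).congr fun _ hg => inverse_eq_texp_neg_tlog hg

/-- The solutions of `S' = S a` with `a` without scalar part are unique: their difference has
higher and higher degree. -/
theorem ode_unique {S T a : ℝ → TruncTensor m V} {α β : ℝ}
    (hS : ∀ t ∈ Icc α β, HasDerivWithinAt S (S t * a t) (Icc α β) t)
    (hT : ∀ t ∈ Icc α β, HasDerivWithinAt T (T t * a t) (Icc α β) t)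
    (ha : ∀ t ∈ Icc α β, a t ∈ filt m V 1) (h0 : S α = T α) {t : ℝ} (ht : t ∈ Icc α β) :
    S t = T t := by
  have key : ∀ j, ∀ t ∈ Icc α β, S t - T t ∈ filt m V j := by
    intro j
    induction j with
    | zero => exact fun _ _ => mem_filt_zero _
    | succ j ih =>
      intro t ht
      have h := sub_mem_of_deriv_mem (p := filt m V (j + 1))
        (fun t ht => (hS t ht).fun_sub (hT t ht))
        (fun t ht => by
          rw [← sub_mul]
          exact mul_mem_filt (ih t ht) (ha t ht)) ht
      simpa [h0] using h
  exact sub_eq_zero.1 (eq_zero_of_mem_filt (Nat.lt_add_one m) (key (m + 1) t ht))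

end GroupODE

/-! ### Generation of the free nilpotent group by one-parameter subgroups -/

section Generation

open scoped Pointwise

variable {m : ℕ} {V : Type*} [NormedAddCommGroup V] [NormedSpace ℝ V] [FiniteDimensional ℝ V]

variable (m V) in
/-- The span of the brackets `[[v₀, v₁], …, v_k]` of vectors of `V`. -/
def brackets : ℕ → Submodule ℝ (TruncTensor m V)
  | 0 => LinearMap.range (inc m V)
  | k + 1 => Submodule.span ℝ {z | ∃ x ∈ brackets k, ∃ v, z = ⁅x, inc m V v⁆}

theorem bracket_mem_brackets {k : ℕ} {x : TruncTensor m V} (hx : x ∈ brackets m V k) (v : V) :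
    ⁅x, inc m V v⁆ ∈ brackets m V (k + 1) :=
  Submodule.subset_span ⟨x, hx, v, rfl⟩

theorem brackets_le_range_inc_pow (k : ℕ) :
    brackets m V k ≤ LinearMap.range (inc m V) ^ (k + 1) := by
  induction k with
  | zero => rw [zero_add, pow_one]; exact le_rfl
  | succ k ih =>
    refine Submodule.span_le.2 ?_
    rintro _ ⟨x, hx, v, rfl⟩
    rw [Ring.lie_def]
    refine sub_mem ?_ ?_
    · rw [pow_succ]; exact Submodule.mul_mem_mul (ih hx) ⟨v, rfl⟩
    · rw [pow_succ']; exact Submodule.mul_mem_mul ⟨v, rfl⟩ (ih hx)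

/-- The left-normed brackets span a Lie subalgebra, by the Jacobi identity. -/
theorem lie_mem_iSup_brackets (l : ℕ) {x y : TruncTensor m V} (hx : x ∈ ⨆ k, brackets m V k)
    (hy : y ∈ brackets m V l) : ⁅x, y⁆ ∈ ⨆ k, brackets m V k := by
  have hv : ∀ x ∈ ⨆ k, brackets m V k, ∀ v, ⁅x, inc m V v⁆ ∈ ⨆ k, brackets m V k := by
    intro x hx v
    refine Submodule.iSup_induction _ (motive := fun x => ⁅x, inc m V v⁆ ∈ ⨆ k, brackets m V k)
      hx (fun k x hk => ?_) (by simp) (fun x y h1 h2 => by rw [add_lie]; exact add_mem h1 h2)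
    exact Submodule.mem_iSup_of_mem (k + 1) (bracket_mem_brackets hk v)
  induction l generalizing x y with
  | zero =>
    obtain ⟨v, rfl⟩ := hy
    exact hv x hx v
  | succ l ih =>
    induction hy using Submodule.span_induction with
    | mem z hz =>
      obtain ⟨y, hy, v, rfl⟩ := hz
      have e : ⁅x, ⁅y, inc m V v⁆⁆ = ⁅⁅x, y⁆, inc m V v⁆ - ⁅⁅x, inc m V v⁆, y⁆ := by
        simp only [Ring.lie_def]; noncomm_ring
      rw [e]
      exact sub_mem (hv _ (ih hx hy) v) (ih (hv x hx v) hy)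
    | zero => simp
    | add a b _ _ h1 h2 => rw [lie_add]; exact add_mem h1 h2
    | smul c a _ h1 => rw [lie_smul]; exact Submodule.smul_mem _ _ h1

theorem freeNilpotentLie_le_iSup_brackets {x : TruncTensor m V} (hx : x ∈ freeNilpotentLie m V) :
    x ∈ ⨆ k, brackets m V k := by
  let K : LieSubalgebra ℝ (TruncTensor m V) :=
    { (⨆ k, brackets m V k) with
      lie_mem' := fun {x y} hx hy => by
        refine Submodule.iSup_induction _ (motive := fun y => ⁅x, y⁆ ∈ ⨆ k, brackets m V k)
          hy (fun k y hk => lie_mem_iSup_brackets k hx hk) (by simp)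
          (fun a b h1 h2 => by rw [lie_add]; exact add_mem h1 h2) }
  have h : freeNilpotentLie m V ≤ K := by
    refine LieSubalgebra.lieSpan_le.2 ?_
    rintro _ ⟨v, rfl⟩
    exact Submodule.mem_iSup_of_mem 0 (show inc m V v ∈ brackets m V 0 from ⟨v, rfl⟩)
  exact h hx

variable (m V) in
/-- The element `exp (t e_i)`, for the `i`-th vector `e_i` of a basis of `V`. -/
def letter (i : Fin (Module.finrank ℝ V)) (t : ℝ) : TruncTensor m V :=
  texp (t • inc m V (Module.finBasis ℝ V i))

variable (m V) in
/-- The monoid (in fact group) generated by the elements `exp (t e_i)`. -/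
def words : Submonoid (TruncTensor m V) :=
  Submonoid.closure {g | ∃ i t, g = letter m V i t}

theorem letter_mem_group (i : Fin (Module.finrank ℝ V)) (t : ℝ) :
    letter m V i t ∈ freeNilpotentGroup m V :=
  ⟨_, (freeNilpotentLie m V).smul_mem t (inc_mem_freeNilpotentLie _), rfl⟩

theorem letter_mul_letter_neg (i : Fin (Module.finrank ℝ V)) (t : ℝ) :
    letter m V i t * letter m V i (-t) = 1 := by
  rw [letter, letter, neg_smul]
  exact texp_mul_texp_neg (Submodule.smul_mem _ _ (inc_mem_filt _))

theorem dilation_letter (r : ℝ) (i : Fin (Module.finrank ℝ V)) (t : ℝ) :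
    dilation m V r (letter m V i t) = letter m V i (r * t) := by
  rw [letter, dilation_texp, map_smul, dilation_inc, smul_smul, mul_comm, letter]

theorem words_le_group {g : TruncTensor m V} (hg : g ∈ words m V) :
    g ∈ freeNilpotentGroup m V := by
  induction hg using Submonoid.closure_induction with
  | mem x hx => obtain ⟨i, t, rfl⟩ := hx; exact letter_mem_group i t
  | one => exact one_mem_group
  | mul x y _ _ h1 h2 => exact mul_mem_group h1 h2

theorem exists_inverse_words {g : TruncTensor m V} (hg : g ∈ words m V) :
    ∃ h ∈ words m V, g * h = 1 ∧ h * g = 1 := by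
  induction hg using Submonoid.closure_induction with
  | mem x hx =>
    obtain ⟨i, t, rfl⟩ := hx
    refine ⟨letter m V i (-t), Submonoid.subset_closure ⟨i, -t, rfl⟩,
      letter_mul_letter_neg i t, ?_⟩
    simpa using letter_mul_letter_neg (m := m) i (-t)
  | one => exact ⟨1, one_mem _, by simp, by simp⟩
  | mul x y _ _ h1 h2 =>
    obtain ⟨a, ha, h1, h1'⟩ := h1
    obtain ⟨b, hb, h2, h2'⟩ := h2
    refine ⟨b * a, mul_mem hb ha, ?_, ?_⟩
    · rw [mul_assoc, ← mul_assoc y, h2, one_mul, h1]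
    · rw [mul_assoc, ← mul_assoc a, h1', one_mul, h2']

/-- `x` has degree at least `j`, and is the leading term of `h - 1` for some word `h`. -/
def IsLeadingTerm (j : ℕ) (x : TruncTensor m V) : Prop :=
  x ∈ filt m V j ∧ ∃ h ∈ words m V, h - 1 - x ∈ filt m V (j + 1)

theorem isLeadingTerm_zero (j : ℕ) : IsLeadingTerm j (0 : TruncTensor m V) :=
  ⟨zero_mem _, 1, one_mem _, by simp⟩

theorem IsLeadingTerm.add {j : ℕ} (hj : 1 ≤ j) {x y : TruncTensor m V} (hx : IsLeadingTerm j x)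
    (hy : IsLeadingTerm j y) : IsLeadingTerm j (x + y) := by
  obtain ⟨hx, h, hh, h1⟩ := hx
  obtain ⟨hy, k, hk, h2⟩ := hy
  refine ⟨add_mem hx hy, h * k, mul_mem hh hk, ?_⟩
  have h3 : h - 1 ∈ filt m V j := by
    simpa using add_mem (filt_antitone (Nat.le_succ j) h1) hx
  have h4 : k - 1 ∈ filt m V j := by
    simpa using add_mem (filt_antitone (Nat.le_succ j) h2) hy
  have e : h * k - 1 - (x + y) = (h - 1 - x) + (k - 1 - y) + (h - 1) * (k - 1) := by noncomm_ring
  rw [e]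
  exact add_mem (add_mem h1 h2) (filt_antitone (by omega) (mul_mem_filt h3 h4))

theorem isLeadingTerm_inc (v : V) : IsLeadingTerm 1 (inc m V v) := by
  have hb := (Module.finBasis ℝ V).sum_repr v
  rw [← hb, map_sum]
  refine Finset.sum_induction _ (IsLeadingTerm 1) (fun x y => IsLeadingTerm.add le_rfl)
    (isLeadingTerm_zero 1) fun i _ => ?_
  rw [map_smul]
  have h := Submodule.smul_mem _ ((Module.finBasis ℝ V).repr v i)
    (inc_mem_filt (m := m) (Module.finBasis ℝ V i))
  exact ⟨h, letter m V i _, Submonoid.subset_closure ⟨i, _, rfl⟩,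
    (texp_sub_one_mem_filt le_rfl h).1⟩

/-- The leading term of a group commutator is the bracket of the leading terms. -/
theorem IsLeadingTerm.bracket_inc {j : ℕ} {x : TruncTensor m V} (hx : IsLeadingTerm j x)
    (v : V) : IsLeadingTerm (j + 1) ⁅x, inc m V v⁆ := by
  obtain ⟨hx, h, hh, h1⟩ := hx
  obtain ⟨hy, k, hk, h2⟩ := isLeadingTerm_inc (m := m) v
  set y := inc m V v
  obtain ⟨h', hh', e1, -⟩ := exists_inverse_words hh
  obtain ⟨k', hk', e2, -⟩ := exists_inverse_words hk
  refine ⟨bracket_mem_filt hx hy, h * k * (h' * k'), mul_mem (mul_mem hh hk) (mul_mem hh' hk'), ?_⟩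
  have h3 : h - 1 ∈ filt m V j := by
    simpa using add_mem (filt_antitone (Nat.le_succ j) h1) hx
  have h4 : h' * k' - 1 ∈ filt m V 1 :=
    sub_one_mem_filt_of_mem_group (words_le_group (mul_mem hh' hk'))
  have h5 : h * k - k * h - ⁅x, y⁆ ∈ filt m V (j + 1 + 1) := by
    have e : h * k - k * h - ⁅x, y⁆ = ⁅h - 1 - x, y⁆ + ⁅h - 1, k - 1 - y⁆ := by
      simp only [Ring.lie_def]; noncomm_ring
    rw [e]
    exact add_mem (bracket_mem_filt h1 hy) (by simpa [add_assoc] using bracket_mem_filt h3 h2)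
  have e3 : k * h * (h' * k') = 1 := by
    rw [mul_assoc, ← mul_assoc h, e1, one_mul, e2]
  have e : h * k * (h' * k') - 1 - ⁅x, y⁆ =
      (h * k - k * h - ⁅x, y⁆) * (h' * k') + ⁅x, y⁆ * (h' * k' - 1) := by
    trans h * k * (h' * k') - k * h * (h' * k') - ⁅x, y⁆
    · rw [e3]
    · noncomm_ring
  rw [e]
  exact add_mem (mul_mem_filt_left _ h5) (mul_mem_filt (bracket_mem_filt hx hy) h4)

theorem isLeadingTerm_of_mem_brackets (k : ℕ) {x : TruncTensor m V} (hx : x ∈ brackets m V k) :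
    IsLeadingTerm (k + 1) x := by
  suffices h : ∀ c : ℝ, IsLeadingTerm (k + 1) (c • x) by simpa using h 1
  induction k generalizing x with
  | zero =>
    obtain ⟨v, rfl⟩ := hx
    intro c
    rw [← map_smul]
    exact isLeadingTerm_inc _
  | succ k ih =>
    induction hx using Submodule.span_induction with
    | mem z hz =>
      obtain ⟨y, hy, v, rfl⟩ := hz
      intro c
      rw [← smul_lie]
      exact (ih hy c).bracket_inc v
    | zero => intro c; rw [smul_zero]; exact isLeadingTerm_zero _
    | add a b _ _ h1 h2 => intro c; rw [smul_add]; exact (h1 c).add (by omega) (h2 c)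
    | smul r a _ h1 => intro c; rw [smul_smul]; exact h1 _

/-- A Lie element of degree at least `j` is a combination of brackets of `j` vectors, up to
higher degree. -/
theorem exists_brackets_of_mem_lie {k : ℕ} {x : TruncTensor m V}
    (hx : x ∈ freeNilpotentLie m V) (hxk : x ∈ filt m V (k + 1)) :
    ∃ y ∈ brackets m V k, x - y ∈ filt m V (k + 2) := by
  have hle : ⨆ l, brackets m V l ≤
      (⨆ i ∈ Iio (k + 1), LinearMap.range (inc m V) ^ i) ⊔
        (brackets m V k ⊔ filt m V (k + 2)) := by
    refine iSup_le fun l => ?_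
    rcases lt_trichotomy l k with h | rfl | h
    · refine (brackets_le_range_inc_pow l).trans (le_sup_of_le_left ?_)
      exact le_iSup₂_of_le (f := fun i (_ : i ∈ Iio (k + 1)) => LinearMap.range (inc m V) ^ i)
        (l + 1) (by simpa using h) le_rfl
    · exact le_sup_of_le_right le_sup_left
    · refine (brackets_le_range_inc_pow l).trans (le_sup_of_le_right (le_sup_of_le_right ?_))
      exact range_inc_pow_le_filt (by omega)
  obtain ⟨p, hp, q, hq, rfl⟩ := Submodule.mem_sup.1 (hle (freeNilpotentLie_le_iSup_brackets hx))
  obtain ⟨y, hy, r, hr, rfl⟩ := Submodule.mem_sup.1 hq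
  -- `p` has degree at most `k` and at least `k + 1`
  have hpf : p ∈ filt m V (k + 1) := by
    have h1 : y ∈ filt m V (k + 1) :=
      range_inc_pow_le_filt le_rfl (brackets_le_range_inc_pow k hy)
    have h2 := sub_mem hxk (add_mem h1 (filt_antitone (by omega) hr))
    simpa using h2
  have hdisj := (iSupIndep_range_inc_pow (m := m) (V := V)).disjoint_biSup_biSup'
    (s := Iio (k + 1)) (t := Ici (k + 1))
    (Set.disjoint_left.2 fun i hi hi' => (not_le.2 (mem_Iio.1 hi)) (mem_Ici.1 hi'))
    (Set.finite_Iio _)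
  have hp0 : p = 0 := Submodule.disjoint_def.1 hdisj p hp hpf
  refine ⟨y, hy, ?_⟩
  rw [hp0]
  simpa using hr

theorem tlog_mem_filt_of_mem {z : TruncTensor m V} {j : ℕ} (hz : z ∈ filt m V j) :
    tlog z ∈ filt m V j :=
  sum_mem fun _ _ => Submodule.smul_mem _ _ (by rw [pow_succ]; exact mul_mem_filt_right _ hz)

/-- Every element of the group becomes arbitrarily close to `1`, in the sense of the degree, after
multiplication by a word: the leading term of its logarithm is a combination of brackets, and can
be cancelled. -/
theorem exists_words_mul_sub_one_mem {g : TruncTensor m V} (hg : g ∈ freeNilpotentGroup m V)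
    (j : ℕ) : ∃ h ∈ words m V, h * g - 1 ∈ filt m V (j + 1) := by
  induction j with
  | zero => exact ⟨1, one_mem _, by simpa using sub_one_mem_filt_of_mem_group hg⟩
  | succ j ih =>
    obtain ⟨h, hh, h1⟩ := ih
    obtain ⟨h1', h2⟩ := mem_group_iff.1 (mul_mem_group (words_le_group hh) hg)
    set x := tlog (h * g - 1) with hx
    have hxj : x ∈ filt m V (j + 1) := tlog_mem_filt_of_mem h1
    obtain ⟨y, hy, hxy⟩ := exists_brackets_of_mem_lie h2 hxj
    obtain ⟨-, k, hk, h3⟩ := isLeadingTerm_of_mem_brackets j (neg_mem hy)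
    refine ⟨k * h, mul_mem hk hh, ?_⟩
    have hyj : y ∈ filt m V (j + 1) :=
      range_inc_pow_le_filt le_rfl (brackets_le_range_inc_pow j hy)
    have h4 : k - 1 ∈ filt m V (j + 1) := by
      have := sub_mem (filt_antitone (Nat.le_succ _) h3) hyj
      simpa using this
    have h5 : h * g - 1 - x ∈ filt m V (j + 2) := by
      have := (texp_sub_one_mem_filt (by omega) hxj).1
      rwa [hx, texp_tlog h1', ← hx, add_sub_cancel_left] at this
    have e : k * h * g - 1 = (k - 1 - -y) + (h * g - 1 - x) + (x - y) +
        (k - 1) * (h * g - 1) := by noncomm_ring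
    rw [e]
    exact add_mem (add_mem (add_mem h3 h5) hxy) (filt_antitone (by omega) (mul_mem_filt h4 h1))

/-- Every element of the free nilpotent group is a finite product of elements `exp (t e_i)`. -/
theorem group_le_words {g : TruncTensor m V} (hg : g ∈ freeNilpotentGroup m V) :
    g ∈ words m V := by
  obtain ⟨h, hh, h1⟩ := exists_words_mul_sub_one_mem hg m
  have h2 : h * g = 1 := sub_eq_zero.1 (eq_zero_of_mem_filt (Nat.lt_add_one m) h1)
  obtain ⟨k, hk, -, h3⟩ := exists_inverse_words hh
  have : g = k := by rw [← one_mul g, ← h3, mul_assoc, h2, mul_one]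
  rwa [this]

variable (m V) in
/-- The neutral element and the elements `exp (t e_i)` with `|t| ≤ n`. -/
def letters (n : ℕ) : Set (TruncTensor m V) :=
  insert 1 (⋃ i, letter m V i '' Icc (-n : ℝ) n)

theorem letters_mono {a b : ℕ} (h : a ≤ b) : letters m V a ⊆ letters m V b := by
  have h' : (a : ℝ) ≤ b := by exact_mod_cast h
  exact insert_subset_insert (iUnion_mono fun i => image_mono (Icc_subset_Icc (by linarith) h'))

theorem isCompact_letters_pow (n k : ℕ) : IsCompact (letters m V n ^ k) := by
  have h : IsCompact (letters m V n) := (isCompact_iUnion fun i => isCompact_Icc.image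
    (continuous_texp.comp (continuous_id.smul continuous_const))).insert 1
  induction k with
  | zero => rw [pow_zero]; exact isCompact_singleton
  | succ k ih => rw [pow_succ]; exact ih.mul h

theorem letters_subset_group (n : ℕ) : letters m V n ⊆ freeNilpotentGroup m V := by
  refine insert_subset one_mem_group (iUnion_subset fun i => ?_)
  rintro _ ⟨t, -, rfl⟩
  exact letter_mem_group i t

theorem letters_pow_subset_group (n k : ℕ) : letters m V n ^ k ⊆ freeNilpotentGroup m V := by
  induction k with
  | zero => rw [pow_zero]; rintro _ rfl; exact one_mem_group
  | succ k ih =>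
    rw [pow_succ]
    rintro _ ⟨x, hx, y, hy, rfl⟩
    exact mul_mem_group (ih hx) (letters_subset_group n hy)

theorem inverse_mem_letters_pow (n k : ℕ) {g : TruncTensor m V} (hg : g ∈ letters m V n ^ k) :
    Ring.inverse g ∈ letters m V n ^ k := by
  induction k generalizing g with
  | zero =>
    rw [pow_zero] at hg ⊢
    rw [Set.mem_one.1 hg, Ring.inverse_one]
    rfl
  | succ k ih =>
    rw [pow_succ] at hg
    obtain ⟨x, hx, y, hy, rfl⟩ := hg
    change Ring.inverse (x * y) ∈ _
    rw [inverse_mul_rev (letters_pow_subset_group n k hx) (letters_subset_group n hy), pow_succ']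
    refine mul_mem_mul ?_ (ih hx)
    rcases hy with rfl | hy
    · rw [Ring.inverse_one]; exact mem_insert _ _
    · obtain ⟨i, t, ht, rfl⟩ := mem_iUnion.1 hy
      refine mem_insert_of_mem _ (mem_iUnion.2
        ⟨i, -t, ⟨by linarith [ht.2], by linarith [ht.1]⟩, ?_⟩)
      rw [ring_inverse_eq (letter_mul_letter_neg i t)
        (by simpa using letter_mul_letter_neg (m := m) i (-t))]

theorem exists_mem_letters_pow {g : TruncTensor m V} (hg : g ∈ freeNilpotentGroup m V) :
    ∃ n k, g ∈ letters m V n ^ k := by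
  have h := group_le_words hg
  induction h using Submonoid.closure_induction with
  | mem x hx =>
    obtain ⟨i, t, rfl⟩ := hx
    obtain ⟨n, hn⟩ := exists_nat_ge |t|
    refine ⟨n, 1, ?_⟩
    rw [pow_one]
    exact mem_insert_of_mem _ (mem_iUnion.2 ⟨i, t, abs_le.1 hn, rfl⟩)
  | one => exact ⟨0, 0, by rw [pow_zero]; rfl⟩
  | mul x y h1 h2 ih1 ih2 =>
    obtain ⟨a, k, hx⟩ := ih1 (words_le_group h1)
    obtain ⟨b, l, hy⟩ := ih2 (words_le_group h2)
    refine ⟨max a b, k + l, ?_⟩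
    rw [pow_add]
    exact mul_mem_mul (Set.pow_subset_pow_left (letters_mono (le_max_left a b)) hx)
      (Set.pow_subset_pow_left (letters_mono (le_max_right a b)) hy)

variable (m V) in
/-- A quantitative form of the generation of `G^m(V)` by the `exp (t e_i)`: near the neutral
element, products of a bounded number of factors with bounded parameters suffice. By the Baire
category theorem, one of the compact sets of such products has an interior point. -/
theorem exists_nhds_subset_letters_pow : ∃ n k : ℕ, ∃ ε > 0, ∀ g ∈ freeNilpotentGroup m V,
    ‖g - 1‖ < ε → g ∈ letters m V n ^ k := by
  let X := freeNilpotentGroup m V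
  have : Nonempty X := ⟨⟨1, one_mem_group⟩⟩
  have : CompleteSpace (TruncTensor m V) := FiniteDimensional.complete ℝ _
  have : CompleteSpace X := isClosed_group.completeSpace_coe
  obtain ⟨⟨n, k⟩, ⟨g₀, hg₀⟩, hint⟩ := nonempty_interior_of_iUnion_of_closed (X := X)
    (f := fun q : ℕ × ℕ => (Subtype.val : X → TruncTensor m V) ⁻¹' (letters m V q.1 ^ q.2))
    (fun q => (isCompact_letters_pow q.1 q.2).isClosed.preimage continuous_subtype_val)
    (by
      refine eq_univ_of_forall fun g => ?_
      obtain ⟨n, k, h⟩ := exists_mem_letters_pow g.2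
      exact mem_iUnion.2 ⟨(n, k), h⟩)
  rw [mem_interior_iff_mem_nhds, mem_nhds_subtype] at hint
  obtain ⟨U, hU, hUs⟩ := hint
  have hc : Continuous fun g : TruncTensor m V => g₀ * g := continuous_const.mul continuous_id
  have h1 : (fun g : TruncTensor m V => g₀ * g) ⁻¹' U ∈ 𝓝 (1 : TruncTensor m V) :=
    hc.continuousAt.preimage_mem_nhds (by simpa using hU)
  obtain ⟨ε, hε, hball⟩ := Metric.mem_nhds_iff.1 h1
  refine ⟨n, k + k, ε, hε, fun g hg hgε => ?_⟩
  have h2 : g₀ * g ∈ letters m V n ^ k :=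
    hUs (a := ⟨g₀ * g, mul_mem_group hg₀ hg⟩) (hball (by rwa [Metric.mem_ball, dist_eq_norm]))
  have h3 : g₀ ∈ letters m V n ^ k := hUs (a := ⟨g₀, hg₀⟩) (mem_of_mem_nhds (s := U) hU)
  have h4 : g = Ring.inverse g₀ * (g₀ * g) := by
    rw [← mul_assoc, inverse_mul_of_mem_group hg₀, one_mul]
  rw [h4, pow_add]
  exact mul_mem_mul (inverse_mem_letters_pow n k h3) h2

end Generation

/-! ### Homogeneous norms -/

section HomogeneousNorm

open scoped Pointwise

variable {m : ℕ} {V : Type*} [NormedAddCommGroup V] [NormedSpace ℝ V] [FiniteDimensional ℝ V]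

theorem continuous_dilation (t : ℝ) : Continuous (dilation m V t) :=
  (dilation m V t).toLinearMap.continuous_of_finiteDimensional

theorem continuous_dilation_left (x : TruncTensor m V) :
    Continuous fun t : ℝ => dilation m V t x := by
  refine induction_homogeneous (P := fun x => Continuous fun t : ℝ => dilation m V t x)
    (fun k x hx => ?_) (fun x y hx hy => ?_) x
  · simp only [dilation_of_mem_pow _ hx]
    exact (continuous_pow k).smul continuous_const
  · simp only [map_add]
    exact hx.add hy

variable {N : TruncTensor m V → ℝ}

theorem IsHomogeneousNorm.one (hN : IsHomogeneousNorm N) : N 1 = 0 :=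
  (hN.eq_zero_iff 1 one_mem_group).2 rfl

theorem IsHomogeneousNorm.bounded_letters (hN : IsHomogeneousNorm N) (n k : ℕ) :
    ∃ C : ℝ, ∀ g ∈ letters m V n ^ k, N g ≤ C := by
  set A : ℝ := n * ∑ i, N (letter m V i 1) with hA
  have h0 : ∀ i, 0 ≤ N (letter m V i 1) := fun i => hN.nonneg _ (letter_mem_group i 1)
  have hA0 : 0 ≤ A := mul_nonneg (by positivity) (Finset.sum_nonneg fun i _ => h0 i)
  have h1 : ∀ g ∈ letters m V n, N g ≤ A := by
    rintro g (rfl | hg)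
    · rwa [hN.one]
    · obtain ⟨i, t, ht, rfl⟩ := mem_iUnion.1 hg
      have h2 := hN.dilation _ (letter_mem_group i 1) t
      rw [dilation_letter, mul_one] at h2
      rw [h2]
      refine mul_le_mul (abs_le.2 ht) ?_ (h0 i) (by positivity)
      exact Finset.single_le_sum (f := fun i => N (letter m V i 1)) (fun i _ => h0 i)
        (Finset.mem_univ i)
  refine ⟨k * A, ?_⟩
  induction k with
  | zero => rw [pow_zero]; rintro _ rfl; simp [hN.one]
  | succ k ih =>
    rw [pow_succ]
    rintro _ ⟨x, hx, y, hy, rfl⟩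
    have h2 := hN.mul_le x (letters_pow_subset_group n k hx) y (letters_subset_group n hy)
    have h3 := ih x hx
    have h4 := h1 y hy
    push_cast
    change N (x * y) ≤ _
    linarith

theorem IsHomogeneousNorm.exists_bound_nhds (hN : IsHomogeneousNorm N) :
    ∃ C > 0, ∃ ε > 0, ∀ g ∈ freeNilpotentGroup m V, ‖g - 1‖ < ε → N g ≤ C := by
  obtain ⟨n, k, ε, hε, h⟩ := exists_nhds_subset_letters_pow m V
  obtain ⟨C, hC⟩ := hN.bounded_letters n k
  exact ⟨max C 1, by positivity, ε, hε, fun g hg hgε => (hC g (h g hg hgε)).trans (le_max_left _ _)⟩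

/-- A homogeneous norm is continuous at the neutral element: a bound near that element improves
itself under dilation. -/
theorem IsHomogeneousNorm.exists_lt_nhds (hN : IsHomogeneousNorm N) {η : ℝ} (hη : 0 < η) :
    ∃ δ > 0, ∀ g ∈ freeNilpotentGroup m V, ‖g - 1‖ < δ → N g < η := by
  obtain ⟨C, hC, ε, hε, h⟩ := hN.exists_bound_nhds
  set r : ℝ := η / (2 * C) with hr
  have hr0 : 0 < r := by positivity
  obtain ⟨δ, hδ, hδ'⟩ := Metric.continuousAt_iff.1
    ((continuous_dilation (m := m) (V := V) r⁻¹).tendsto 1) ε hε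
  refine ⟨δ, hδ, fun g hg hgδ => ?_⟩
  have h1 := hδ' (by rwa [dist_eq_norm])
  rw [map_one, dist_eq_norm] at h1
  have h2 := h _ (dilation_mem_group _ hg) h1
  have h3 := hN.dilation _ (dilation_mem_group r⁻¹ hg) r
  rw [dilation_dilation, mul_inv_cancel₀ hr0.ne', dilation_one, abs_of_pos hr0] at h3
  rw [h3]
  calc r * _ ≤ r * C := by gcongr
    _ = η / 2 := by rw [hr]; field_simp
    _ < η := by linarith

theorem IsHomogeneousNorm.tendsto_zero (hN : IsHomogeneousNorm N) {ι : Type*} {l : Filter ι}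
    {g : ι → TruncTensor m V} (hg : ∀ i, g i ∈ freeNilpotentGroup m V) (h : Tendsto g l (𝓝 1)) :
    Tendsto (fun i => N (g i)) l (𝓝 0) := by
  refine Metric.tendsto_nhds.2 fun η hη => ?_
  obtain ⟨δ, hδ, hδ'⟩ := hN.exists_lt_nhds hη
  filter_upwards [Metric.tendsto_nhds.1 h δ hδ] with i hi
  rw [Real.dist_eq, sub_zero, abs_of_nonneg (hN.nonneg _ (hg i))]
  exact hδ' _ (hg i) (by rwa [← dist_eq_norm])

theorem IsHomogeneousNorm.abs_sub_le (hN : IsHomogeneousNorm N) {g h : TruncTensor m V}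
    (hg : g ∈ freeNilpotentGroup m V) (hh : h ∈ freeNilpotentGroup m V) :
    |N h - N g| ≤ N (Ring.inverse g * h) := by
  have hgh := mul_mem_group (inverse_mem_group hg) hh
  have h1 := hN.mul_le g hg _ hgh
  rw [← mul_assoc, mul_inverse_of_mem_group hg, one_mul] at h1
  have h2 := hN.mul_le h hh _ (inverse_mem_group hgh)
  rw [inverse_mul_rev (inverse_mem_group hg) hh, inverse_inverse_of_mem_group hg, ← mul_assoc,
    mul_inverse_of_mem_group hh, one_mul] at h2
  have h3 := hN.inverse _ hgh
  rw [inverse_mul_rev (inverse_mem_group hg) hh, inverse_inverse_of_mem_group hg] at h3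
  rw [abs_le]
  constructor <;> linarith

theorem tendsto_inverse_mul {ι : Type*} {l : Filter ι} {g h : ι → TruncTensor m V}
    {a b : TruncTensor m V} (hg : ∀ i, g i ∈ freeNilpotentGroup m V)
    (ha : a ∈ freeNilpotentGroup m V) (h1 : Tendsto g l (𝓝 a)) (h2 : Tendsto h l (𝓝 b)) :
    Tendsto (fun i => Ring.inverse (g i) * h i) l (𝓝 (Ring.inverse a * b)) := by
  refine Tendsto.mul ?_ h2
  exact (continuousOn_inverse a ha).tendsto.comp
    (tendsto_nhdsWithin_iff.2 ⟨h1, Eventually.of_forall hg⟩)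

theorem IsHomogeneousNorm.tendsto (hN : IsHomogeneousNorm N) {ι : Type*} {l : Filter ι}
    {g : ι → TruncTensor m V} {a : TruncTensor m V} (hg : ∀ i, g i ∈ freeNilpotentGroup m V)
    (ha : a ∈ freeNilpotentGroup m V) (h : Tendsto g l (𝓝 a)) :
    Tendsto (fun i => N (g i)) l (𝓝 (N a)) := by
  have h1 : Tendsto (fun i => Ring.inverse a * g i) l (𝓝 1) := by
    rw [← inverse_mul_of_mem_group ha]
    exact tendsto_const_nhds.mul h
  have h2 := hN.tendsto_zero (fun i => mul_mem_group (inverse_mem_group ha) (hg i)) h1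
  exact tendsto_iff_norm_sub_tendsto_zero.2
    (squeeze_zero (fun _ => norm_nonneg _) (fun i => hN.abs_sub_le ha (hg i)) h2)

theorem IsHomogeneousNorm.continuousOn (hN : IsHomogeneousNorm N) :
    ContinuousOn N (freeNilpotentGroup m V) := by
  rw [continuousOn_iff_continuous_domRestrict, continuous_iff_continuousAt]
  intro g
  exact hN.tendsto (fun i => i.2) g.2 (continuous_subtype_val.tendsto g)

/-- Elements of small homogeneous norm are close to the neutral element. On the compact sphere
`‖g - 1‖ = ε` the norm has a positive minimum, and dilations shrink every element outside the
ball onto that sphere. -/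
theorem IsHomogeneousNorm.exists_norm_sub_one_lt (hN : IsHomogeneousNorm N) {ε : ℝ}
    (hε : 0 < ε) : ∃ c > 0, ∀ g ∈ freeNilpotentGroup m V, N g < c → ‖g - 1‖ < ε := by
  set K : Set (TruncTensor m V) := freeNilpotentGroup m V ∩ Metric.sphere 1 ε with hK
  have : ProperSpace (TruncTensor m V) := FiniteDimensional.proper_real _
  have hKc : IsCompact K := (isCompact_sphere 1 ε).inter_left isClosed_group
  have hmin : ∃ c > 0, ∀ g ∈ K, c ≤ N g := by
    rcases K.eq_empty_or_nonempty with h | h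
    · exact ⟨1, one_pos, by simp [h]⟩
    · obtain ⟨g, hg, hmin⟩ := hKc.exists_isMinOn h (hN.continuousOn.mono inter_subset_left)
      refine ⟨N g, ?_, fun x hx => hmin hx⟩
      refine (hN.nonneg g hg.1).lt_of_ne' fun h0 => ?_
      have h1 := (hN.eq_zero_iff g hg.1).1 h0
      have h2 := hg.2
      rw [h1, Metric.mem_sphere, dist_self] at h2
      exact hε.ne h2
  obtain ⟨c, hc, hcK⟩ := hmin
  refine ⟨c, hc, fun g hg hgc => ?_⟩
  by_contra hge
  rw [not_lt] at hge
  have hcont : ContinuousOn (fun t : ℝ => ‖RoughPath.dilation m V t g - 1‖) (Icc 0 1) :=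
    ((continuous_dilation_left g).sub continuous_const).norm.continuousOn
  have himg := intermediate_value_Icc zero_le_one hcont
  obtain ⟨t, ht, hte⟩ := himg (show ε ∈ Icc _ _ by
    simp only [dilation_zero_of_mem_group hg, dilation_one, sub_self, norm_zero]
    exact ⟨hε.le, hge⟩)
  have h1 := hcK (RoughPath.dilation m V t g) ⟨dilation_mem_group t hg, by
    rw [Metric.mem_sphere, dist_eq_norm]; exact hte⟩
  rw [hN.dilation g hg, abs_of_nonneg ht.1] at h1
  have h2 := mul_le_mul_of_nonneg_right ht.2 (hN.nonneg g hg)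
  linarith

theorem IsHomogeneousNorm.tendsto_one (hN : IsHomogeneousNorm N) {ι : Type*} {l : Filter ι}
    {g : ι → TruncTensor m V} (hg : ∀ i, g i ∈ freeNilpotentGroup m V)
    (h : Tendsto (fun i => N (g i)) l (𝓝 0)) : Tendsto g l (𝓝 1) := by
  refine Metric.tendsto_nhds.2 fun ε hε => ?_
  obtain ⟨c, hc, hc'⟩ := hN.exists_norm_sub_one_lt hε
  filter_upwards [h.eventually_lt_const hc] with i hi
  rw [dist_eq_norm]
  exact hc' _ (hg i) hi

end HomogeneousNorm

/-! ### Signatures -/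

section Signature

variable {m : ℕ} {V : Type*} [NormedAddCommGroup V] [NormedSpace ℝ V] [FiniteDimensional ℝ V]

instance : CompleteSpace (TruncTensor m V) := FiniteDimensional.complete ℝ _

variable (m V) in
/-- The inclusion of `V` in `T^{(m)}(V)` as a continuous linear map. -/
def incCLM : V →L[ℝ] TruncTensor m V := (inc m V).toContinuousLinearMap

@[simp] theorem incCLM_apply (v : V) : incCLM m V v = inc m V v := rfl

theorem continuous_inc : Continuous (inc m V) := (incCLM m V).continuous

variable {y : ℝ → V}

theorem IsSmoothPath.hasDerivWithinAt (hy : IsSmoothPath y) {t : ℝ} (ht : t ∈ Icc (0 : ℝ) 1) :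
    HasDerivWithinAt y (velocity y t) (Icc 0 1) t :=
  (hy.differentiableOn (by simp) t ht).hasDerivWithinAt

theorem IsSmoothPath.continuousOn_velocity (hy : IsSmoothPath y) :
    ContinuousOn (velocity y) (Icc 0 1) :=
  hy.continuousOn_derivWithin (uniqueDiffOn_Icc zero_lt_one) (by simp)

theorem velocity_eq_of_hasDerivWithinAt {t : ℝ} {v : V} (ht : t ∈ Icc (0 : ℝ) 1)
    (h : HasDerivWithinAt y v (Icc 0 1) t) : velocity y t = v :=
  h.derivWithin (uniqueDiffOn_Icc zero_lt_one t ht)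

theorem IsSmoothPath.intervalIntegrable_norm_velocity (hy : IsSmoothPath y) {s t : ℝ}
    (h0 : 0 ≤ s) (hst : s ≤ t) (h1 : t ≤ 1) :
    IntervalIntegrable (fun u => ‖velocity y u‖) MeasureTheory.volume s t := by
  refine ContinuousOn.intervalIntegrable ?_
  rw [uIcc_of_le hst]
  exact (hy.continuousOn_velocity.mono (Icc_subset_Icc h0 h1)).norm

theorem iteratedIntegral_succ_hasDerivWithinAt (hy : IsSmoothPath y) {s : ℝ} (h0 : 0 ≤ s)
    {k : ℕ} (hk : ContinuousOn (iteratedIntegral m y s k) (Icc s 1)) {t : ℝ}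
    (ht : t ∈ Icc s 1) :
    HasDerivWithinAt (iteratedIntegral m y s (k + 1))
      (iteratedIntegral m y s k t * inc m V (velocity y t)) (Icc s 1) t := by
  have hc : ContinuousOn (fun u => iteratedIntegral m y s k u * inc m V (velocity y u))
      (Icc s 1) :=
    hk.mul (continuous_inc.comp_continuousOn
      (hy.continuousOn_velocity.mono (Icc_subset_Icc_left h0)))
  have : Fact (t ∈ Icc s 1) := ⟨ht⟩
  refine intervalIntegral.integral_hasDerivWithinAt_right (t := Icc s 1) ?_
    (hc.stronglyMeasurableAtFilter_nhdsWithin measurableSet_Icc t) (hc t ht)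
  refine ContinuousOn.intervalIntegrable ?_
  rw [uIcc_of_le ht.1]
  exact hc.mono (Icc_subset_Icc_right ht.2)

theorem continuousOn_iteratedIntegral (hy : IsSmoothPath y) {s : ℝ} (h0 : 0 ≤ s) (k : ℕ) :
    ContinuousOn (iteratedIntegral m y s k) (Icc s 1) := by
  induction k with
  | zero => exact continuousOn_const
  | succ k ih =>
    exact fun t ht => (iteratedIntegral_succ_hasDerivWithinAt hy h0 ih ht).continuousWithinAt

theorem iteratedIntegral_succ_self (k : ℕ) (s : ℝ) : iteratedIntegral m y s (k + 1) s = 0 := by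
  simp [iteratedIntegral]

theorem iteratedIntegral_mem_filt (hy : IsSmoothPath y) {s : ℝ} (h0 : 0 ≤ s) (k : ℕ) {t : ℝ}
    (ht : t ∈ Icc s 1) : iteratedIntegral m y s k t ∈ filt m V k := by
  induction k generalizing t with
  | zero => exact mem_filt_zero _
  | succ k ih =>
    have h := sub_mem_of_deriv_mem (p := filt m V (k + 1)) (fun t ht =>
      iteratedIntegral_succ_hasDerivWithinAt hy h0 (continuousOn_iteratedIntegral hy h0 k) ht)
      (fun t ht => mul_mem_filt (ih ht) (inc_mem_filt _)) ht
    simpa [iteratedIntegral_succ_self] using h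

theorem signature_self (y : ℝ → V) (s : ℝ) : signature m y s s = 1 := by
  rw [signature, Finset.sum_range_succ', Finset.sum_eq_zero, zero_add]
  · rfl
  · exact fun k _ => iteratedIntegral_succ_self k s

/-- The signature solves the differential equation `S' = S y'`. -/
theorem signature_hasDerivWithinAt (hy : IsSmoothPath y) {s : ℝ} (h0 : 0 ≤ s) {t : ℝ}
    (ht : t ∈ Icc s 1) :
    HasDerivWithinAt (signature m y s) (signature m y s t * inc m V (velocity y t))
      (Icc s 1) t := by
  have h : HasDerivWithinAt (fun t => ∑ k ∈ Finset.range m, iteratedIntegral m y s (k + 1) t +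
      iteratedIntegral m y s 0 t) (∑ k ∈ Finset.range m,
        iteratedIntegral m y s k t * inc m V (velocity y t) + 0) (Icc s 1) t :=
    (HasDerivWithinAt.fun_sum fun k _ => iteratedIntegral_succ_hasDerivWithinAt hy h0
      (continuousOn_iteratedIntegral hy h0 k) ht).fun_add (hasDerivWithinAt_const _ _ _)
  have e : signature m y s = fun t => ∑ k ∈ Finset.range m, iteratedIntegral m y s (k + 1) t +
      iteratedIntegral m y s 0 t := by
    ext t
    exact Finset.sum_range_succ' _ _
  rw [← e] at h
  refine h.congr_deriv ?_
  rw [signature, Finset.sum_range_succ, add_mul, Finset.sum_mul, eq_zero_of_mem_filt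
    (Nat.lt_add_one m) (mul_mem_filt (iteratedIntegral_mem_filt hy h0 m ht) (inc_mem_filt _))]

theorem signature_mem_group (hy : IsSmoothPath y) {s t : ℝ} (h0 : 0 ≤ s) (hst : s ≤ t)
    (h1 : t ≤ 1) : signature m y s t ∈ freeNilpotentGroup m V :=
  mem_group_of_ode (a := fun t => inc m V (velocity y t))
    (fun _ ht => signature_hasDerivWithinAt hy h0 ht)
    (fun _ _ => inc_mem_freeNilpotentLie _) (by rw [signature_self]; exact one_mem_group) ⟨hst, h1⟩

/-- A solution of `T' = T y'` is a left translate of the signature of `y`. -/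
theorem eq_mul_signature (hy : IsSmoothPath y) {T : ℝ → TruncTensor m V} {α β : ℝ} (h0 : 0 ≤ α)
    (h1 : β ≤ 1)
    (hT : ∀ t ∈ Icc α β, HasDerivWithinAt T (T t * inc m V (velocity y t)) (Icc α β) t) {t : ℝ}
    (ht : t ∈ Icc α β) : T t = T α * signature m y α t := by
  refine ode_unique (a := fun t => inc m V (velocity y t)) hT
    (T := fun t => T α * signature m y α t) (fun t ht => ?_)
    (fun _ _ => inc_mem_filt _) (by rw [signature_self, mul_one]) ht
  have h := hasDerivWithinAt_mul (hasDerivWithinAt_const t (Icc α β) (T α))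
    ((signature_hasDerivWithinAt hy h0 ⟨ht.1, ht.2.trans h1⟩).mono (Icc_subset_Icc_right h1))
  rwa [zero_mul, zero_add, ← mul_assoc] at h

/-- Chen's identity. -/
theorem signature_mul_signature (hy : IsSmoothPath y) {r s t : ℝ} (h0 : 0 ≤ r) (hrs : r ≤ s)
    (hst : s ≤ t) (h1 : t ≤ 1) :
    signature m y r s * signature m y s t = signature m y r t := by
  refine (eq_mul_signature hy (h0.trans hrs) h1 (fun u hu => ?_) (right_mem_Icc.2 hst)).symm
  exact (signature_hasDerivWithinAt hy h0 ⟨hrs.trans hu.1, hu.2.trans h1⟩).mono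
    (Icc_subset_Icc hrs h1)

theorem increment_signaturePath (hy : IsSmoothPath y) {s t : ℝ} (h0 : 0 ≤ s) (hst : s ≤ t)
    (h1 : t ≤ 1) : increment (signaturePath m y) s t = signature m y s t := by
  rw [increment, signaturePath, ← signature_mul_signature hy le_rfl h0 hst h1, ← mul_assoc,
    inverse_mul_of_mem_group (signature_mem_group hy le_rfl h0 (hst.trans h1)), one_mul]

/-- Signatures are invariant under changes of parameter, monotone or not. -/
theorem signature_reparam {z : ℝ → V} (hy : IsSmoothPath y) (hz : IsSmoothPath z)
    {φ φ' : ℝ → ℝ} {α β : ℝ} (h0 : 0 ≤ α) (h1 : β ≤ 1)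
    (hφ : ∀ t ∈ Icc α β, HasDerivWithinAt φ (φ' t) (Icc α β) t)
    (hmap : MapsTo φ (Icc α β) (Icc 0 1))
    (hv : ∀ t ∈ Icc α β, velocity y t = φ' t • velocity z (φ t)) {t : ℝ} (ht : t ∈ Icc α β) :
    signature m z 0 (φ t) = signature m z 0 (φ α) * signature m y α t := by
  refine eq_mul_signature hy (T := fun t => signature m z 0 (φ t)) h0 h1 (fun t ht => ?_) ht
  have h := (signature_hasDerivWithinAt (m := m) hz le_rfl (hmap ht)).scomp t (hφ t ht) hmap
  rw [hv t ht, map_smul, mul_smul_comm]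
  exact h

theorem velocity_const_smul (r : ℝ) (hy : IsSmoothPath y) {t : ℝ} (ht : t ∈ Icc (0 : ℝ) 1) :
    velocity (fun t => r • y t) t = r • velocity y t :=
  velocity_eq_of_hasDerivWithinAt ht ((hy.hasDerivWithinAt ht).fun_const_smul r)

theorem IsSmoothPath.const_smul (r : ℝ) (hy : IsSmoothPath y) :
    IsSmoothPath fun t => r • y t :=
  ContDiffOn.const_smul r hy

theorem dilation_signature (r : ℝ) (hy : IsSmoothPath y) {s t : ℝ} (h0 : 0 ≤ s) (hst : s ≤ t)
    (h1 : t ≤ 1) :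
    dilation m V r (signature m y s t) = signature m (fun t => r • y t) s t := by
  have h := eq_mul_signature (m := m) (hy.const_smul r)
    (T := fun t => dilation m V r (signature m y s t)) h0 h1 (fun u hu => ?_)
    (right_mem_Icc.2 hst)
  · rwa [signature_self, map_one, one_mul] at h
  · have h2 := (dilation m V r).toLinearMap.toContinuousLinearMap.hasFDerivAt.comp_hasDerivWithinAt
      u ((signature_hasDerivWithinAt (m := m) hy h0 ⟨hu.1, hu.2.trans h1⟩).mono
        (Icc_subset_Icc_right h1))
    refine h2.congr_deriv ?_
    change dilation m V r (signature m y s u * inc m V (velocity y u)) = _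
    rw [map_mul, dilation_inc, velocity_const_smul r hy ⟨h0.trans hu.1, hu.2.trans h1⟩, map_smul]

theorem norm_mul_inc_le (x : TruncTensor m V) (v : V) :
    ‖x * inc m V v‖ ≤ ‖mulCLM m V‖ * ‖x‖ * (‖incCLM m V‖ * ‖v‖) :=
  ((mulCLM m V).le_opNorm₂ x (inc m V v)).trans
    (mul_le_mul_of_nonneg_left ((incCLM m V).le_opNorm v) (by positivity))

theorem norm_iteratedIntegral_le (hy : IsSmoothPath y) {s T L : ℝ} (h0 : 0 ≤ s) (hT : T ≤ 1)
    (hL : ∀ t ∈ Icc s T, ∫ u in s..t, ‖velocity y u‖ ≤ L) (k : ℕ) {t : ℝ} (ht : t ∈ Icc s T) :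
    ‖iteratedIntegral m y s k t‖ ≤
      ‖(1 : TruncTensor m V)‖ * (‖mulCLM m V‖ * ‖incCLM m V‖ * L) ^ k := by
  have hL0 : 0 ≤ L := by simpa using hL s (left_mem_Icc.2 (ht.1.trans ht.2))
  induction k generalizing t with
  | zero => simp [iteratedIntegral]
  | succ k ih =>
    set B := ‖(1 : TruncTensor m V)‖ * (‖mulCLM m V‖ * ‖incCLM m V‖ * L) ^ k
    have h2 : ‖iteratedIntegral m y s (k + 1) t‖ ≤
        ∫ u in s..t, ‖mulCLM m V‖ * B * (‖incCLM m V‖ * ‖velocity y u‖) := by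
      refine intervalIntegral.norm_integral_le_of_norm_le ht.1 (Eventually.of_forall fun u hu => ?_)
        (((hy.intervalIntegrable_norm_velocity h0 ht.1 (ht.2.trans hT)).const_mul _).const_mul _)
      refine (norm_mul_inc_le _ _).trans ?_
      have := ih (t := u) ⟨hu.1.le, hu.2.trans ht.2⟩
      gcongr
    rw [intervalIntegral.integral_const_mul, intervalIntegral.integral_const_mul] at h2
    refine h2.trans ?_
    calc ‖mulCLM m V‖ * B * (‖incCLM m V‖ * ∫ u in s..t, ‖velocity y u‖)
        ≤ ‖mulCLM m V‖ * B * (‖incCLM m V‖ * L) := by gcongr; exact hL t ht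
      _ = _ := by rw [pow_succ]; ring

variable (m V) in
/-- Signatures of short paths are close to the neutral element. -/
theorem exists_norm_signature_sub_one_lt {ε : ℝ} (hε : 0 < ε) : ∃ η > 0, ∀ y : ℝ → V,
    IsSmoothPath y → ∀ s t, 0 ≤ s → s ≤ t → t ≤ 1 → ∫ u in s..t, ‖velocity y u‖ ≤ η →
      ‖signature m y s t - 1‖ < ε := by
  set F : ℝ → ℝ := fun L => ∑ k ∈ Finset.range m,
    ‖(1 : TruncTensor m V)‖ * (‖mulCLM m V‖ * ‖incCLM m V‖ * L) ^ (k + 1) with hF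
  have hFc : Continuous F := by fun_prop
  have hF0 : F 0 = 0 := by simp [hF]
  obtain ⟨δ, hδ, hδ'⟩ := Metric.continuousAt_iff.1 (hFc.continuousAt (x := 0)) ε hε
  refine ⟨δ / 2, by positivity, fun y hy s t h0 hst h1 hL => ?_⟩
  set L := ∫ u in s..t, ‖velocity y u‖ with hLdef
  have hL0 : 0 ≤ L := intervalIntegral.integral_nonneg hst fun _ _ => norm_nonneg _
  have h2 : ‖signature m y s t - 1‖ ≤ F L := by
    have e : signature m y s t - 1 = ∑ k ∈ Finset.range m, iteratedIntegral m y s (k + 1) t := by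
      rw [signature, Finset.sum_range_succ']
      exact add_sub_cancel_right _ _
    rw [e]
    refine norm_sum_le_of_le _ fun k _ => norm_iteratedIntegral_le hy h0 h1 (fun u hu => ?_) _
      (right_mem_Icc.2 hst)
    refine intervalIntegral.integral_mono_interval le_rfl hu.1 hu.2
      (Eventually.of_forall fun _ => norm_nonneg _)
      (hy.intervalIntegrable_norm_velocity h0 hst h1)
  have h3 := hδ' (x := L) (by rw [Real.dist_eq, sub_zero, abs_of_nonneg hL0]; linarith)
  rw [hF0, Real.dist_eq, sub_zero] at h3
  exact h2.trans_lt ((le_abs_self _).trans_lt h3)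

theorem signature_eq_one_of_length_eq_zero (hy : IsSmoothPath y) {s t : ℝ} (h0 : 0 ≤ s)
    (hst : s ≤ t) (h1 : t ≤ 1) (hl : ∫ u in s..t, ‖velocity y u‖ = 0) :
    signature m y s t = 1 := by
  by_contra hne
  obtain ⟨η, hη, h⟩ := exists_norm_signature_sub_one_lt m V (norm_pos_iff.2 (sub_ne_zero.2 hne))
  exact lt_irrefl _ (h y hy s t h0 hst h1 (hl.trans_le hη.le))

theorem length_const_smul {r : ℝ} (hr : 0 ≤ r) (hy : IsSmoothPath y) {s t : ℝ} (h0 : 0 ≤ s)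
    (hst : s ≤ t) (h1 : t ≤ 1) : ∫ u in s..t, ‖velocity (fun t => r • y t) u‖ =
      r * ∫ u in s..t, ‖velocity y u‖ := by
  rw [← intervalIntegral.integral_const_mul]
  refine intervalIntegral.integral_congr fun u hu => ?_
  rw [uIcc_of_le hst] at hu
  rw [velocity_const_smul r hy ⟨h0.trans hu.1, hu.2.trans h1⟩, norm_smul, Real.norm_of_nonneg hr]

/-- A homogeneous norm of a signature is at most a constant times the length of the path. By
dilation it is enough to consider paths of one fixed small length. -/
theorem IsHomogeneousNorm.exists_le_length {N : TruncTensor m V → ℝ} (hN : IsHomogeneousNorm N) :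
    ∃ C > 0, ∀ y : ℝ → V, IsSmoothPath y → ∀ s t, 0 ≤ s → s ≤ t → t ≤ 1 →
      N (signature m y s t) ≤ C * ∫ u in s..t, ‖velocity y u‖ := by
  obtain ⟨C, hC, ε, hε, h⟩ := hN.exists_bound_nhds
  obtain ⟨η, hη, hη'⟩ := exists_norm_signature_sub_one_lt m V hε
  refine ⟨C / η, by positivity, fun y hy s t h0 hst h1 => ?_⟩
  set L := ∫ u in s..t, ‖velocity y u‖ with hL
  have hL0 : 0 ≤ L := intervalIntegral.integral_nonneg hst fun _ _ => norm_nonneg _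
  rcases hL0.eq_or_lt with h2 | h2
  · rw [signature_eq_one_of_length_eq_zero hy h0 hst h1 h2.symm, hN.one, ← h2, mul_zero]
  · have hr : 0 ≤ η / L := by positivity
    have h3 := hη' _ (hy.const_smul (η / L)) s t h0 hst h1 (by
      rw [length_const_smul hr hy h0 hst h1, ← hL, div_mul_cancel₀ _ h2.ne'])
    have hmem := signature_mem_group (m := m) hy h0 hst h1
    rw [← dilation_signature _ hy h0 hst h1] at h3
    have h4 := h _ (dilation_mem_group _ hmem) h3
    rw [hN.dilation _ hmem, abs_of_nonneg hr] at h4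
    rw [div_mul_eq_mul_div, le_div_iff₀ hη]
    rw [div_mul_eq_mul_div, div_le_iff₀ h2] at h4
    linarith

end Signature

/-! ### Flat paths and concatenation -/

section FlatPath

open scoped Pointwise

variable {m : ℕ} {V : Type*} [NormedAddCommGroup V] [NormedSpace ℝ V] [FiniteDimensional ℝ V]

/-- A smooth path which is constant before time `0` and after time `1`, so that such paths can be
concatenated smoothly. -/
structure IsFlatPath (z : ℝ → V) : Prop where
  contDiff : ContDiff ℝ (⊤ : ℕ∞) z
  deriv_eq_zero : ∀ t, t ∉ Ioo (0 : ℝ) 1 → deriv z t = 0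

theorem isSmoothPath_of_contDiff {z : ℝ → V} (hz : ContDiff ℝ (⊤ : ℕ∞) z) : IsSmoothPath z :=
  hz.contDiffOn

theorem hasDerivAt_of_contDiff {z : ℝ → V} (hz : ContDiff ℝ (⊤ : ℕ∞) z) (t : ℝ) :
    HasDerivAt z (deriv z t) t :=
  (hz.differentiable (by simp) t).hasDerivAt

theorem velocity_eq_of_hasDerivAt {z : ℝ → V} {v : V} {t : ℝ} (ht : t ∈ Icc (0 : ℝ) 1)
    (h : HasDerivAt z v t) : velocity z t = v :=
  velocity_eq_of_hasDerivWithinAt ht h.hasDerivWithinAt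

/-- The concatenation of the `n` paths `z 0, …, z (n - 1)`, run one after the other with equal
time lengths `1 / n`. -/
def concat (n : ℕ) (z : ℕ → ℝ → V) (t : ℝ) : V := ∑ k ∈ Finset.range n, z k (n * t - k)

variable {n : ℕ} {z : ℕ → ℝ → V}

theorem contDiff_concat (hz : ∀ k < n, IsFlatPath (z k)) :
    ContDiff ℝ (⊤ : ℕ∞) (concat n z) :=
  ContDiff.sum fun k hk => (hz k (Finset.mem_range.1 hk)).contDiff.comp
    ((contDiff_const.mul contDiff_id).sub contDiff_const)

theorem hasDerivAt_concat (hz : ∀ k < n, IsFlatPath (z k)) (t : ℝ) :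
    HasDerivAt (concat n z) (∑ k ∈ Finset.range n, (n : ℝ) • deriv (z k) (n * t - k)) t := by
  refine HasDerivAt.fun_sum fun k hk => ?_
  have h1 : HasDerivAt (fun t : ℝ => n * t - k) (n : ℝ) t := by
    simpa using ((hasDerivAt_id t).const_mul (n : ℝ)).sub_const (k : ℝ)
  exact (hasDerivAt_of_contDiff (hz k (Finset.mem_range.1 hk)).contDiff _).scomp t h1

theorem mem_piece {k : ℕ} (hk : k < n) {t : ℝ} :
    t ∈ Icc ((k : ℝ) / n) ((k + 1) / n) ↔ n * t - k ∈ Icc (0 : ℝ) 1 := by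
  have hn : (0 : ℝ) < n := by exact_mod_cast (Nat.zero_le k).trans_lt hk
  rw [mem_Icc, mem_Icc, div_le_iff₀ hn, le_div_iff₀ hn]
  constructor <;> rintro ⟨h1, h2⟩ <;> constructor <;> linarith

theorem piece_subset {k : ℕ} (hk : k < n) : (0 : ℝ) ≤ k / n ∧ ((k : ℝ) + 1) / n ≤ 1 := by
  have hn : (0 : ℝ) < n := by exact_mod_cast (Nat.zero_le k).trans_lt hk
  have hk' : (k : ℝ) + 1 ≤ n := by exact_mod_cast hk
  exact ⟨by positivity, (div_le_one hn).2 hk'⟩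

theorem velocity_concat (hz : ∀ k < n, IsFlatPath (z k)) {k : ℕ} (hk : k < n) {t : ℝ}
    (ht : t ∈ Icc ((k : ℝ) / n) ((k + 1) / n)) :
    velocity (concat n z) t = (n : ℝ) • velocity (z k) (n * t - k) := by
  have h01 := piece_subset hk
  rw [velocity_eq_of_hasDerivAt ⟨h01.1.trans ht.1, ht.2.trans h01.2⟩ (hasDerivAt_concat hz t)]
  have ht' := (mem_piece hk).1 ht
  rw [velocity_eq_of_hasDerivAt ht' (hasDerivAt_of_contDiff (hz k hk).contDiff _)]
  refine Finset.sum_eq_single k (fun j hj hjk => ?_) (by simp [hk])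
  rw [(hz j (Finset.mem_range.1 hj)).deriv_eq_zero, smul_zero]
  rintro ⟨h1, h2⟩
  rcases lt_or_gt_of_ne hjk with h | h
  · have : (j : ℝ) + 1 ≤ k := by exact_mod_cast h
    linarith [ht'.1]
  · have : (k : ℝ) + 1 ≤ j := by exact_mod_cast h
    linarith [ht'.2]

theorem isFlatPath_concat (hz : ∀ k < n, IsFlatPath (z k)) : IsFlatPath (concat n z) := by
  refine ⟨contDiff_concat hz, fun t ht => ?_⟩
  rw [(hasDerivAt_concat hz t).deriv]
  refine Finset.sum_eq_zero fun k hk => ?_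
  have hk' := Finset.mem_range.1 hk
  rw [(hz k hk').deriv_eq_zero, smul_zero]
  rintro ⟨h1, h2⟩
  have hn : (0 : ℝ) < n := by exact_mod_cast (Nat.zero_le k).trans_lt hk'
  have hkn : (k : ℝ) + 1 ≤ n := by exact_mod_cast hk'
  refine ht ⟨?_, ?_⟩
  · have h0 : (0 : ℝ) ≤ k := by positivity
    by_contra h
    nlinarith
  · by_contra h
    nlinarith

theorem signature_concat_piece (hz : ∀ k < n, IsFlatPath (z k)) {k : ℕ} (hk : k < n) {t : ℝ}
    (ht : t ∈ Icc ((k : ℝ) / n) ((k + 1) / n)) :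
    signature m (concat n z) (k / n) t = signature m (z k) 0 (n * t - k) := by
  have h01 := piece_subset hk
  have hn : (n : ℝ) ≠ 0 := by exact_mod_cast ((Nat.zero_le k).trans_lt hk).ne'
  have h := signature_reparam (m := m) (isSmoothPath_of_contDiff (contDiff_concat hz))
    (isSmoothPath_of_contDiff (hz k hk).contDiff) (φ := fun t => n * t - k) (φ' := fun _ => (n : ℝ))
    h01.1 h01.2 (fun t _ => by
      simpa using (((hasDerivAt_id t).const_mul (n : ℝ)).sub_const (k : ℝ)).hasDerivWithinAt)
    (fun t ht => (mem_piece hk).1 ht) (fun t ht => velocity_concat hz hk ht) ht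
  rw [show (n : ℝ) * (k / n) - k = 0 by field_simp; ring, signature_self, one_mul] at h
  exact h.symm

/-- Paths whose signatures are the successive increments of `g` concatenate to a path whose
signature takes the values of `g` at the nodes `k / n`. -/
theorem signature_concat_node (hz : ∀ k < n, IsFlatPath (z k)) {g : ℕ → TruncTensor m V}
    (h0 : g 0 = 1) (hg : ∀ k < n, g (k + 1) = g k * signature m (z k) 0 1) {k : ℕ}
    (hk : k ≤ n) : signature m (concat n z) 0 (k / n) = g k := by
  induction k with
  | zero => rw [Nat.cast_zero, zero_div, signature_self, h0]
  | succ k ih =>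
    have h01 := piece_subset hk
    have hle : (k : ℝ) / n ≤ (k + 1) / n := by gcongr; linarith
    have hn : (n : ℝ) ≠ 0 := by exact_mod_cast ((Nat.zero_le k).trans_lt hk).ne'
    rw [hg k hk, ← ih (Nat.le_of_succ_le hk), Nat.cast_succ,
      ← signature_mul_signature (isSmoothPath_of_contDiff (contDiff_concat hz)) le_rfl h01.1 hle
        h01.2, signature_concat_piece hz hk (right_mem_Icc.2 hle)]
    congr 2
    field_simp
    ring

theorem length_concat_piece (hz : ∀ k < n, IsFlatPath (z k)) {k : ℕ} (hk : k < n) :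
    ∫ u in (k : ℝ) / n..(k + 1) / n, ‖velocity (concat n z) u‖ =
      ∫ u in (0 : ℝ)..1, ‖velocity (z k) u‖ := by
  have hn : (n : ℝ) ≠ 0 := by exact_mod_cast ((Nat.zero_le k).trans_lt hk).ne'
  have hle : (k : ℝ) / n ≤ (k + 1) / n := by gcongr; linarith
  have h1 : ∫ u in (k : ℝ) / n..(k + 1) / n, ‖velocity (concat n z) u‖ =
      ∫ u in (k : ℝ) / n..(k + 1) / n, n * ‖velocity (z k) (n * u - k)‖ := by
    refine intervalIntegral.integral_congr fun u hu => ?_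
    rw [uIcc_of_le hle] at hu
    simp only [velocity_concat hz hk hu, norm_smul, Real.norm_natCast]
  rw [h1, intervalIntegral.integral_const_mul]
  have h2 := intervalIntegral.smul_integral_comp_mul_sub (fun u => ‖velocity (z k) u‖)
    (a := (k : ℝ) / n) (b := (k + 1) / n) (n : ℝ) (k : ℝ)
  rw [smul_eq_mul] at h2
  rw [h2]
  congr 1 <;> field_simp <;> ring

/-! ### Smooth reparametrisation -/

/-- Outside `(0, 1)` the function is at its minimum `0` or at its maximum `1`. -/
theorem deriv_smoothTransition_eq_zero {t : ℝ} (ht : t ∉ Ioo (0 : ℝ) 1) :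
    deriv Real.smoothTransition t = 0 := by
  rcases le_or_gt t 0 with h | h
  · refine IsLocalMin.deriv_eq_zero (Eventually.of_forall fun s => ?_)
    rw [Real.smoothTransition.zero_of_nonpos h]
    exact Real.smoothTransition.nonneg s
  · refine IsLocalMax.deriv_eq_zero (Eventually.of_forall fun s => ?_)
    rw [Real.smoothTransition.one_of_one_le (not_lt.1 fun h1 => ht ⟨h, h1⟩)]
    exact Real.smoothTransition.le_one s

theorem hasDerivAt_smoothTransition (t : ℝ) :
    HasDerivAt Real.smoothTransition (deriv Real.smoothTransition t) t :=
  hasDerivAt_of_contDiff Real.smoothTransition.contDiff t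

theorem exists_bound_deriv_smoothTransition :
    ∃ C > 0, ∀ t, ‖deriv Real.smoothTransition t‖ ≤ C := by
  have hc : Continuous (deriv Real.smoothTransition) :=
    (Real.smoothTransition.contDiff (n := 1)).continuous_deriv le_rfl
  obtain ⟨C, hC⟩ := isCompact_Icc.exists_bound_of_continuousOn (hc.continuousOn (s := Icc 0 1))
  refine ⟨max C 1, by positivity, fun t => ?_⟩
  by_cases ht : t ∈ Ioo (0 : ℝ) 1
  · exact (hC t (Ioo_subset_Icc_self ht)).trans (le_max_left _ _)
  · rw [deriv_smoothTransition_eq_zero ht, norm_zero]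
    positivity

theorem smoothTransition_mem_Icc (t : ℝ) : Real.smoothTransition t ∈ Icc (0 : ℝ) 1 :=
  ⟨Real.smoothTransition.nonneg t, Real.smoothTransition.le_one t⟩

theorem IsSmoothPath.hasDerivAt_comp_smoothTransition {y : ℝ → V} (hy : IsSmoothPath y) (t : ℝ) :
    HasDerivAt (fun t => y (Real.smoothTransition t))
      (deriv Real.smoothTransition t • velocity y (Real.smoothTransition t)) t := by
  rw [← hasDerivWithinAt_univ]
  exact (hy.hasDerivWithinAt (smoothTransition_mem_Icc t)).scomp t
    (hasDerivAt_smoothTransition t).hasDerivWithinAt fun s _ => smoothTransition_mem_Icc s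

theorem IsSmoothPath.isFlatPath_comp_smoothTransition {y : ℝ → V} (hy : IsSmoothPath y) :
    IsFlatPath fun t => y (Real.smoothTransition t) := by
  refine ⟨?_, fun t ht => ?_⟩
  · rw [← contDiffOn_univ]
    exact ContDiffOn.comp hy Real.smoothTransition.contDiff.contDiffOn
      fun t _ => smoothTransition_mem_Icc t
  · rw [(hy.hasDerivAt_comp_smoothTransition t).deriv, deriv_smoothTransition_eq_zero ht, zero_smul]

theorem IsSmoothPath.velocity_comp_smoothTransition {y : ℝ → V} (hy : IsSmoothPath y) {t : ℝ}
    (ht : t ∈ Icc (0 : ℝ) 1) : velocity (fun t => y (Real.smoothTransition t)) t =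
      deriv Real.smoothTransition t • velocity y (Real.smoothTransition t) :=
  velocity_eq_of_hasDerivAt ht (hy.hasDerivAt_comp_smoothTransition t)

theorem IsSmoothPath.signature_comp_smoothTransition {y : ℝ → V} (hy : IsSmoothPath y) :
    signature m (fun t => y (Real.smoothTransition t)) 0 1 = signature m y 0 1 := by
  have h := signature_reparam (m := m)
    (isSmoothPath_of_contDiff hy.isFlatPath_comp_smoothTransition.contDiff) hy
    (φ := Real.smoothTransition) (α := 0) (β := 1) le_rfl le_rfl
    (fun t _ => (hasDerivAt_smoothTransition t).hasDerivWithinAt)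
    (fun t _ => smoothTransition_mem_Icc t) (fun t ht => hy.velocity_comp_smoothTransition ht)
    (right_mem_Icc.2 zero_le_one)
  rw [Real.smoothTransition.zero, Real.smoothTransition.one, signature_self, one_mul] at h
  exact h.symm

theorem IsSmoothPath.length_comp_smoothTransition {y : ℝ → V} (hy : IsSmoothPath y) :
    ∫ u in (0 : ℝ)..1, ‖velocity (fun t => y (Real.smoothTransition t)) u‖ =
      ∫ u in (0 : ℝ)..1, ‖velocity y u‖ := by
  have h1 : ∫ u in (0 : ℝ)..1, ‖velocity (fun t => y (Real.smoothTransition t)) u‖ =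
      ∫ u in (0 : ℝ)..1, deriv Real.smoothTransition u •
        ((fun s => ‖velocity y s‖) ∘ Real.smoothTransition) u := by
    refine intervalIntegral.integral_congr fun u hu => ?_
    rw [uIcc_of_le zero_le_one] at hu
    simp only [hy.velocity_comp_smoothTransition hu, norm_smul, smul_eq_mul, Function.comp,
      Real.norm_of_nonneg Real.smoothTransition.monotone.deriv_nonneg]
  rw [h1, intervalIntegral.integral_deriv_smul_comp''
    Real.smoothTransition.continuous.continuousOn
    (fun t _ => (hasDerivAt_smoothTransition t).hasDerivWithinAt)
    ((Real.smoothTransition.contDiff (n := 1)).continuous_deriv le_rfl).continuousOn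
    (hy.continuousOn_velocity.norm.mono
      (image_subset_iff.2 fun t _ => smoothTransition_mem_Icc t)),
    Real.smoothTransition.zero, Real.smoothTransition.one]

/-! ### Paths with prescribed signature -/

/-- `g` is the signature of a flat path of speed at most `B`. -/
def IsReached (B : ℝ) (g : TruncTensor m V) : Prop :=
  ∃ z : ℝ → V, IsFlatPath z ∧ (∀ t, ‖deriv z t‖ ≤ B) ∧ signature m z 0 1 = g

theorem IsReached.mono {A B : ℝ} (h : A ≤ B) {g : TruncTensor m V} (hg : IsReached A g) :
    IsReached B g := by
  obtain ⟨z, hz, h1, h2⟩ := hg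
  exact ⟨z, hz, fun t => (h1 t).trans h, h2⟩

theorem isReached_one : IsReached 0 (1 : TruncTensor m V) := by
  have hz : IsFlatPath fun _ : ℝ => (0 : V) := ⟨contDiff_const, by simp⟩
  refine ⟨_, hz, by simp, ?_⟩
  refine signature_eq_one_of_length_eq_zero (isSmoothPath_of_contDiff hz.contDiff) le_rfl
    zero_le_one le_rfl ?_
  simp [velocity]

theorem IsReached.mul {A B : ℝ} {g h : TruncTensor m V} (hg : IsReached A g)
    (hh : IsReached B h) : IsReached (2 * (A + B)) (g * h) := by
  obtain ⟨z, hz, hzA, rfl⟩ := hg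
  obtain ⟨w, hw, hwB, rfl⟩ := hh
  have hA : 0 ≤ A := (norm_nonneg _).trans (hzA 0)
  have hB : 0 ≤ B := (norm_nonneg _).trans (hwB 0)
  set f : ℕ → ℝ → V := fun k => if k = 0 then z else w with hf
  have hfl : ∀ k < 2, IsFlatPath (f k) := by
    intro k _
    by_cases h : k = 0
    · simpa [hf, h] using hz
    · simpa [hf, h] using hw
  refine ⟨concat 2 f, isFlatPath_concat hfl, fun t => ?_, ?_⟩
  · rw [(hasDerivAt_concat hfl t).deriv, Finset.sum_range_succ, Finset.sum_range_one]
    refine (norm_add_le _ _).trans ?_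
    rw [norm_smul, norm_smul, mul_add]
    simp only [hf, Nat.cast_ofNat, Real.norm_ofNat]
    exact add_le_add (by gcongr; exact hzA _) (by gcongr; exact hwB _)
  · have h := signature_concat_node (m := m) hfl (g := fun k => if k = 0 then 1 else
      if k = 1 then signature m z 0 1 else signature m z 0 1 * signature m w 0 1) rfl
      (fun k hk => by interval_cases k <;> simp [hf]) (k := 2) le_rfl
    simpa using h

theorem IsReached.dilation {B : ℝ} {g : TruncTensor m V} (hg : IsReached B g) (r : ℝ) :
    IsReached (|r| * B) (dilation m V r g) := by
  obtain ⟨z, hz, hzB, rfl⟩ := hg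
  have hd : ∀ t, HasDerivAt (fun t => r • z t) (r • deriv z t) t := fun t =>
    (hasDerivAt_of_contDiff hz.contDiff t).fun_const_smul r
  refine ⟨fun t => r • z t, ⟨hz.contDiff.const_smul r, fun t ht => ?_⟩, fun t => ?_, ?_⟩
  · rw [(hd t).deriv, hz.deriv_eq_zero t ht, smul_zero]
  · rw [(hd t).deriv, norm_smul, Real.norm_eq_abs]
    gcongr
    exact hzB t
  · exact (dilation_signature r (isSmoothPath_of_contDiff hz.contDiff) le_rfl zero_le_one
      le_rfl).symm

variable (m) in
/-- The signature of a straight line run with variable speed is an exponential. -/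
theorem isReached_texp_inc {C : ℝ} (hC : ∀ t, ‖deriv Real.smoothTransition t‖ ≤ C) (v : V) :
    IsReached (C * ‖v‖) (texp (inc m V v)) := by
  have hd : ∀ t, HasDerivAt (fun t => Real.smoothTransition t • v)
      (deriv Real.smoothTransition t • v) t := fun t =>
    (hasDerivAt_smoothTransition t).smul_const v
  have hsm : ContDiff ℝ (⊤ : ℕ∞) fun t => Real.smoothTransition t • v :=
    Real.smoothTransition.contDiff.smul contDiff_const
  refine ⟨fun t => Real.smoothTransition t • v, ⟨hsm, fun t ht => ?_⟩, fun t => ?_, ?_⟩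
  · rw [(hd t).deriv, deriv_smoothTransition_eq_zero ht, zero_smul]
  · rw [(hd t).deriv, norm_smul]
    gcongr
    exact hC t
  · have h := eq_mul_signature (m := m) (isSmoothPath_of_contDiff hsm) (α := 0) (β := 1)
      (T := fun t => texp (Real.smoothTransition t • inc m V v)) le_rfl le_rfl (fun t ht => ?_)
      (right_mem_Icc.2 zero_le_one)
    · simpa [texp_zero] using h.symm
    · have h1 := (hasDerivWithinAt_texp_smul (inc_mem_filt (m := m) v) univ
        (Real.smoothTransition t)).scomp t
        (hasDerivAt_smoothTransition t).hasDerivWithinAt (s := Icc 0 1) (mapsTo_univ _ _)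
      refine h1.congr_deriv ?_
      rw [velocity_eq_of_hasDerivAt ht (hd t), map_smul, mul_smul_comm,
        (commute_texp_smul _ _).eq]

variable (m V) in
theorem exists_isReached_letters_pow (n k : ℕ) :
    ∃ B : ℝ, 0 ≤ B ∧ ∀ g ∈ letters m V n ^ k, IsReached B g := by
  obtain ⟨C, hC0, hC⟩ := exists_bound_deriv_smoothTransition
  set A : ℝ := C * (n * ∑ i, ‖Module.finBasis ℝ V i‖) with hA
  have hA0 : 0 ≤ A := by positivity
  have h1 : ∀ g ∈ letters m V n, IsReached A g := by
    rintro g (rfl | hg)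
    · exact isReached_one.mono hA0
    · obtain ⟨i, t, ht, rfl⟩ := mem_iUnion.1 hg
      rw [letter, ← map_smul]
      refine (isReached_texp_inc m hC _).mono ?_
      rw [norm_smul, hA]
      have h2 : ‖Module.finBasis ℝ V i‖ ≤ ∑ i, ‖Module.finBasis ℝ V i‖ :=
        Finset.single_le_sum (f := fun i => ‖Module.finBasis ℝ V i‖) (fun i _ => norm_nonneg _)
          (Finset.mem_univ i)
      have h3 : ‖t‖ ≤ n := abs_le.2 ht
      gcongr
  induction k with
  | zero =>
    refine ⟨0, le_rfl, ?_⟩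
    rw [pow_zero]
    rintro _ rfl
    exact isReached_one
  | succ k ih =>
    obtain ⟨B, hB0, hB⟩ := ih
    refine ⟨2 * (B + A), by positivity, ?_⟩
    rw [pow_succ]
    rintro _ ⟨x, hx, y, hy, rfl⟩
    exact (hB x hx).mul (h1 y hy)

theorem exists_isReached {g : TruncTensor m V} (hg : g ∈ freeNilpotentGroup m V) :
    ∃ B, IsReached B g := by
  obtain ⟨n, k, h⟩ := exists_mem_letters_pow hg
  obtain ⟨B, -, hB⟩ := exists_isReached_letters_pow m V n k
  exact ⟨B, hB g h⟩

/-- Every element of the group is the signature of a flat path whose speed is at most a constant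
times the norm of that element. -/
theorem IsHomogeneousNorm.exists_isReached {N : TruncTensor m V → ℝ} (hN : IsHomogeneousNorm N) :
    ∃ C > 0, ∀ g ∈ freeNilpotentGroup m V, IsReached (C * N g) g := by
  obtain ⟨n, k, ε, hε, h⟩ := exists_nhds_subset_letters_pow m V
  obtain ⟨B, hB0, hB⟩ := exists_isReached_letters_pow m V n k
  obtain ⟨c, hc, hc'⟩ := hN.exists_norm_sub_one_lt hε
  refine ⟨2 * (B + 1) / c, by positivity, fun g hg => ?_⟩
  rcases (hN.nonneg g hg).eq_or_lt with h0 | h0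
  · rw [← h0, mul_zero, (hN.eq_zero_iff g hg).1 h0.symm]
    exact isReached_one
  · -- the dilation by `r⁻¹` brings the norm of `g` to `c / 2`
    set r : ℝ := 2 * N g / c with hr
    have hr0 : 0 < r := by positivity
    have h1 : N (RoughPath.dilation m V r⁻¹ g) < c := by
      rw [hN.dilation g hg, abs_of_pos (inv_pos.2 hr0), hr, inv_div, div_mul_eq_mul_div,
        div_lt_iff₀ (by positivity)]
      nlinarith
    have h2 := dilation_mem_group r⁻¹ hg
    have h3 := (hB _ (h _ h2 (hc' _ h2 h1))).dilation r
    rw [dilation_dilation, mul_inv_cancel₀ hr0.ne', dilation_one, abs_of_pos hr0] at h3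
    refine h3.mono ?_
    rw [hr, div_mul_eq_mul_div, div_mul_eq_mul_div]
    gcongr ?_ / _
    nlinarith

/-! ### The Carnot–Carathéodory norm -/

theorem ccNorm_le {y : ℝ → V} (hy : IsSmoothPath y) :
    ccNorm m V (signature m y 0 1) ≤ ∫ u in (0 : ℝ)..1, ‖velocity y u‖ := by
  refine csInf_le ⟨0, ?_⟩ ⟨y, hy, rfl, rfl⟩
  rintro _ ⟨y, -, -, rfl⟩
  exact intervalIntegral.integral_nonneg zero_le_one fun _ _ => norm_nonneg _

theorem exists_length_lt_ccNorm_add {g : TruncTensor m V} (hg : g ∈ freeNilpotentGroup m V)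
    {δ : ℝ} (hδ : 0 < δ) : ∃ y : ℝ → V, IsSmoothPath y ∧ signature m y 0 1 = g ∧
      ∫ u in (0 : ℝ)..1, ‖velocity y u‖ < ccNorm m V g + δ := by
  obtain ⟨B, z, hz, -, hzg⟩ := exists_isReached hg
  obtain ⟨L, ⟨y, hy, hyg, rfl⟩, hL⟩ := exists_lt_of_csInf_lt
    (s := {L | ∃ y : ℝ → V, IsSmoothPath y ∧ signature m y 0 1 = g ∧
      L = ∫ u in (0 : ℝ)..1, ‖velocity y u‖})
    ⟨_, z, isSmoothPath_of_contDiff hz.contDiff, hzg, rfl⟩ (lt_add_of_pos_right (ccNorm m V g) hδ)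
  exact ⟨y, hy, hyg, hL⟩

theorem ccNorm_nonneg (g : TruncTensor m V) : 0 ≤ ccNorm m V g := by
  refine Real.sInf_nonneg ?_
  rintro _ ⟨y, -, -, rfl⟩
  exact intervalIntegral.integral_nonneg zero_le_one fun _ _ => norm_nonneg _

theorem ccNorm_one : ccNorm m V 1 = 0 := by
  have hz : IsSmoothPath fun _ : ℝ => (0 : V) := contDiffOn_const
  have hl : ∫ u in (0 : ℝ)..1, ‖velocity (fun _ : ℝ => (0 : V)) u‖ = 0 := by simp [velocity]
  have h := ccNorm_le (m := m) hz
  rw [signature_eq_one_of_length_eq_zero hz le_rfl zero_le_one le_rfl hl, hl] at h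
  exact le_antisymm h (ccNorm_nonneg 1)

theorem ccNorm_dilation_le {g : TruncTensor m V} (hg : g ∈ freeNilpotentGroup m V) {r : ℝ} :
    ccNorm m V (dilation m V r g) ≤ |r| * ccNorm m V g := by
  refine le_of_forall_pos_le_add fun δ hδ => ?_
  obtain ⟨y, hy, rfl, hL⟩ := exists_length_lt_ccNorm_add hg (δ := δ / (|r| + 1)) (by positivity)
  rw [dilation_signature r hy le_rfl zero_le_one le_rfl]
  refine (ccNorm_le (hy.const_smul r)).trans ?_
  have h1 : ∫ u in (0 : ℝ)..1, ‖velocity (fun t => r • y t) u‖ =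
      |r| * ∫ u in (0 : ℝ)..1, ‖velocity y u‖ := by
    rw [← intervalIntegral.integral_const_mul]
    refine intervalIntegral.integral_congr fun u hu => ?_
    rw [uIcc_of_le zero_le_one] at hu
    rw [velocity_const_smul r hy hu, norm_smul, Real.norm_eq_abs]
  rw [h1]
  have h2 : |r| * (δ / (|r| + 1)) ≤ δ := by
    rw [mul_div_assoc', div_le_iff₀ (by positivity)]
    nlinarith [abs_nonneg r]
  have h3 := mul_le_mul_of_nonneg_left hL.le (abs_nonneg r)
  linarith

theorem ccNorm_mul_le {g h : TruncTensor m V} (hg : g ∈ freeNilpotentGroup m V)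
    (hh : h ∈ freeNilpotentGroup m V) : ccNorm m V (g * h) ≤ ccNorm m V g + ccNorm m V h := by
  refine le_of_forall_pos_le_add fun δ hδ => ?_
  obtain ⟨y, hy, rfl, hyL⟩ := exists_length_lt_ccNorm_add hg (half_pos hδ)
  obtain ⟨w, hw, rfl, hwL⟩ := exists_length_lt_ccNorm_add hh (half_pos hδ)
  set f : ℕ → ℝ → V := fun k t => (if k = 0 then y else w) (Real.smoothTransition t) with hf
  have hfl : ∀ k < 2, IsFlatPath (f k) := by
    intro k _
    by_cases h : k = 0
    · simpa [hf, h] using hy.isFlatPath_comp_smoothTransition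
    · simpa [hf, h] using hw.isFlatPath_comp_smoothTransition
  have hs0 : signature m (f 0) 0 1 = signature m y 0 1 := hy.signature_comp_smoothTransition
  have hs1 : signature m (f 1) 0 1 = signature m w 0 1 := hw.signature_comp_smoothTransition
  have hsm := isSmoothPath_of_contDiff (contDiff_concat hfl)
  have hsig := signature_concat_node (m := m) hfl (g := fun k => if k = 0 then 1 else
      if k = 1 then signature m y 0 1 else signature m y 0 1 * signature m w 0 1) rfl
      (fun k hk => by interval_cases k <;> simp [hs0, hs1]) (k := 2) le_rfl
  simp only [Nat.cast_ofNat, OfNat.ofNat_ne_zero, ↓reduceIte, OfNat.ofNat_ne_one, ne_eq,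
    not_false_eq_true, div_self] at hsig
  rw [← hsig]
  refine (ccNorm_le hsm).trans ?_
  have hl0 := length_concat_piece hfl (k := 0) (by norm_num)
  have hl1 := length_concat_piece hfl (k := 1) (by norm_num)
  norm_num at hl0 hl1
  rw [show ∫ u in (0 : ℝ)..1, ‖velocity (f 0) u‖ = _ from hy.length_comp_smoothTransition] at hl0
  rw [show ∫ u in (0 : ℝ)..1, ‖velocity (f 1) u‖ = _ from hw.length_comp_smoothTransition] at hl1
  rw [← intervalIntegral.integral_add_adjacent_intervals
    (hsm.intervalIntegrable_norm_velocity le_rfl (by norm_num : (0 : ℝ) ≤ 1 / 2) (by norm_num))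
    (hsm.intervalIntegrable_norm_velocity (by norm_num) (by norm_num : (1 / 2 : ℝ) ≤ 1) le_rfl),
    hl0, hl1]
  linarith

theorem ccNorm_inverse_le {g : TruncTensor m V} (hg : g ∈ freeNilpotentGroup m V) :
    ccNorm m V (Ring.inverse g) ≤ ccNorm m V g := by
  refine le_of_forall_pos_le_add fun δ hδ => ?_
  obtain ⟨y, hy, rfl, hyL⟩ := exists_length_lt_ccNorm_add hg hδ
  have hmap : MapsTo (fun t : ℝ => 1 - t) (Icc 0 1) (Icc 0 1) := fun t ht =>
    ⟨by linarith [ht.2], by linarith [ht.1]⟩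
  have hφ : ∀ t ∈ Icc (0 : ℝ) 1, HasDerivWithinAt (fun t : ℝ => 1 - t) (-1) (Icc 0 1) t :=
    fun t _ => ((hasDerivAt_id t).const_sub 1).hasDerivWithinAt
  have hw : IsSmoothPath fun t => y (1 - t) :=
    ContDiffOn.comp hy (contDiff_const.sub contDiff_id).contDiffOn hmap
  have hv : ∀ t ∈ Icc (0 : ℝ) 1,
      velocity (fun t => y (1 - t)) t = (-1 : ℝ) • velocity y (1 - t) := fun t ht =>
    velocity_eq_of_hasDerivWithinAt ht ((hy.hasDerivWithinAt (hmap ht)).scomp t (hφ t ht) hmap)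
  -- the signature of the reversed path is the inverse of the signature
  have h := signature_reparam (m := m) hw hy le_rfl le_rfl hφ hmap hv (right_mem_Icc.2 zero_le_one)
  simp only [sub_self, sub_zero, signature_self] at h
  have h2 : Ring.inverse (signature m y 0 1) = signature m (fun t => y (1 - t)) 0 1 := by
    rw [← mul_one (Ring.inverse _), h, ← mul_assoc, inverse_mul_of_mem_group hg, one_mul]
  rw [h2]
  refine (ccNorm_le hw).trans ?_
  have h3 : ∫ u in (0 : ℝ)..1, ‖velocity (fun t => y (1 - t)) u‖ =
      ∫ u in (0 : ℝ)..1, ‖velocity y (1 - u)‖ := by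
    refine intervalIntegral.integral_congr fun u hu => ?_
    rw [uIcc_of_le zero_le_one] at hu
    simp only [hv u hu, neg_smul, one_smul, norm_neg]
  rw [h3, intervalIntegral.integral_comp_sub_left (fun u => ‖velocity y u‖)]
  simpa using hyL.le

variable (m V) in
theorem isHomogeneousNorm_ccNorm : IsHomogeneousNorm (ccNorm m V) where
  nonneg g _ := ccNorm_nonneg g
  eq_zero_iff g hg := by
    refine ⟨fun h0 => ?_, fun h => by rw [h, ccNorm_one]⟩
    by_contra hne
    obtain ⟨η, hη, h⟩ := exists_norm_signature_sub_one_lt m V (norm_pos_iff.2 (sub_ne_zero.2 hne))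
    obtain ⟨y, hy, hyg, hL⟩ := exists_length_lt_ccNorm_add hg hη
    rw [h0, zero_add] at hL
    have h1 := h y hy 0 1 le_rfl zero_le_one le_rfl hL.le
    rw [hyg] at h1
    exact lt_irrefl _ h1
  dilation g hg r := by
    refine le_antisymm (ccNorm_dilation_le hg) ?_
    rcases eq_or_ne r 0 with rfl | hr
    · rw [abs_zero, zero_mul]
      exact ccNorm_nonneg _
    · have h := ccNorm_dilation_le (dilation_mem_group r hg) (r := r⁻¹)
      rw [dilation_dilation, inv_mul_cancel₀ hr, dilation_one, abs_inv] at h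
      have hr' : 0 < |r| := abs_pos.2 hr
      rwa [inv_mul_eq_div, le_div_iff₀ hr', mul_comm] at h
  mul_le g hg h hh := ccNorm_mul_le hg hh
  inverse g hg := by
    refine le_antisymm (ccNorm_inverse_le hg) ?_
    have h := ccNorm_inverse_le (inverse_mem_group hg)
    rwa [inverse_inverse_of_mem_group hg] at h

end FlatPath

/-! ### Controls -/

section Control

variable {ω : ℝ → ℝ → ℝ} {p : ℝ}

theorem IsControl.superadditive_le (hω : IsControl ω) {s t u : ℝ} (h0 : 0 ≤ s) (hst : s ≤ t)
    (htu : t ≤ u) (h1 : u ≤ 1) : ω s t + ω t u ≤ ω s u := by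
  rcases hst.eq_or_lt with rfl | hst
  · rw [hω.diag s h0 (htu.trans h1), zero_add]
  rcases htu.eq_or_lt with rfl | htu
  · rw [hω.diag t (h0.trans hst.le) h1, add_zero]
  exact hω.superadditive s t u h0 hst htu h1

theorem IsControl.mono (hω : IsControl ω) {r s t u : ℝ} (h0 : 0 ≤ r) (hrs : r ≤ s) (hst : s ≤ t)
    (htu : t ≤ u) (h1 : u ≤ 1) : ω s t ≤ ω r u := by
  have h2 := hω.superadditive_le h0 hrs (hst.trans htu) h1
  have h3 := hω.superadditive_le (h0.trans hrs) hst htu h1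
  have h4 := hω.nonneg r s h0 hrs (hst.trans (htu.trans h1))
  have h5 := hω.nonneg t u (h0.trans (hrs.trans hst)) htu h1
  linarith

/-- Condition `(H_p)`, extended to weak inequalities between the times. -/
theorem IsControl.exists_bound (hω : IsControl ω) (hH : ConditionH p ω) :
    ∃ C : ℝ, 0 ≤ C ∧ ∀ r s t u, 0 ≤ r → r ≤ s → s < t → t ≤ u → u ≤ 1 →
      ω r u / (u - r) ^ p ≤ C * (ω s t / (t - s) ^ p) := by
  obtain ⟨C, hC⟩ := hH.bound
  refine ⟨max C 0, le_max_right _ _, fun r s t u h0 hrs hst htu h1 => ?_⟩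
  have hlim : Tendsto (fun e : ℝ => max C 0 * (ω s t / (t - s - 2 * e) ^ p)) (𝓝[>] 0)
      (𝓝 (max C 0 * (ω s t / (t - s) ^ p))) := by
    have hc : ContinuousAt (fun e : ℝ => max C 0 * (ω s t / (t - s - 2 * e) ^ p)) 0 := by
      have hne : t - s - 2 * 0 ≠ 0 := by linarith [sub_pos.2 hst]
      have hpos : (t - s - 2 * 0 : ℝ) ^ p ≠ 0 :=
        (Real.rpow_pos_of_pos (by linarith) p).ne'
      exact continuousAt_const.mul (continuousAt_const.div
        (ContinuousAt.rpow_const (by fun_prop) (Or.inl hne)) hpos)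
    have h := hc.tendsto.mono_left (nhdsWithin_le_nhds (s := Ioi 0))
    simpa using h
  -- `(H_p)` for `r < s + e < t - e < u`, and monotonicity of `ω`
  refine ge_of_tendsto hlim ?_
  filter_upwards [Ioo_mem_nhdsGT (show (0 : ℝ) < (t - s) / 2 by linarith)] with e he
  obtain ⟨he0, he1⟩ := he
  have h2 := hC r (s + e) (t - e) u h0 (by linarith) (by linarith) (by linarith) h1
  have e1 : t - e - (s + e) = t - s - 2 * e := by ring
  rw [e1] at h2
  have h3 : ω (s + e) (t - e) ≤ ω s t :=
    hω.mono (h0.trans hrs) (by linarith) (by linarith) (by linarith) (htu.trans h1)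
  have h4 : 0 ≤ ω (s + e) (t - e) := hω.nonneg _ _ (by linarith) (by linarith) (by linarith)
  have h5 : 0 < (t - s - 2 * e) ^ p := Real.rpow_pos_of_pos (by linarith) p
  refine h2.trans ?_
  gcongr
  exact le_max_left _ _

theorem IsControl.pos (hω : IsControl ω) (hH : ConditionH p ω) {s t : ℝ} (h0 : 0 ≤ s)
    (hst : s < t) (h1 : t ≤ 1) : 0 < ω s t := by
  obtain ⟨C, hC0, hC⟩ := hω.exists_bound hH
  obtain ⟨a, b, ha, hab, hb, hne⟩ := hH.ne_zero
  have h2 : 0 < ω a b := (hω.nonneg a b ha hab hb).lt_of_ne' hne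
  have h3 := hω.mono le_rfl ha hab hb le_rfl
  refine (hω.nonneg s t h0 hst.le h1).lt_of_ne' fun h4 => ?_
  have h5 := hC 0 s t 1 le_rfl h0 hst h1 le_rfl
  rw [h4, zero_div, mul_zero, sub_zero, Real.one_rpow, div_one] at h5
  linarith

/-- Condition `(H_p)` says that `ω ^ (1 / p)` is, up to a constant, at least linear on
subintervals. -/
theorem IsControl.exists_root_bound (hω : IsControl ω) (hH : ConditionH p ω) (hp : 0 < p) :
    ∃ D : ℝ, 0 ≤ D ∧ ∀ r s t u, 0 ≤ r → r ≤ s → s ≤ t → t ≤ u → u ≤ 1 →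
      (t - s) * ω r u ^ (1 / p) ≤ D * ((u - r) * ω s t ^ (1 / p)) := by
  obtain ⟨C, hC0, hC⟩ := hω.exists_bound hH
  refine ⟨C ^ (1 / p), by positivity, fun r s t u h0 hrs hst htu h1 => ?_⟩
  have hω1 := hω.nonneg r u h0 (hrs.trans (hst.trans htu)) h1
  have hω2 := hω.nonneg s t (h0.trans hrs) hst (htu.trans h1)
  have hur : 0 ≤ u - r := by linarith
  rcases hst.eq_or_lt with rfl | hst
  · rw [sub_self, zero_mul]
    positivity
  have hts : 0 < t - s := by linarith
  have hur' : 0 < u - r := by linarith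
  have h2 := hC r s t u h0 hrs hst htu h1
  rw [← mul_div_assoc, div_le_div_iff₀ (Real.rpow_pos_of_pos hur' p)
    (Real.rpow_pos_of_pos hts p)] at h2
  have h3 := Real.rpow_le_rpow (by positivity) h2 (show 0 ≤ 1 / p by positivity)
  rw [Real.mul_rpow hω1 (by positivity), Real.mul_rpow (by positivity) (by positivity),
    Real.mul_rpow hC0 hω2, ← Real.rpow_mul hts.le, ← Real.rpow_mul hur,
    mul_one_div_cancel hp.ne', Real.rpow_one, Real.rpow_one] at h3
  linarith

theorem IsControl.tendsto (hω : IsControl ω) {ι : Type*} {l : Filter ι} {s t : ι → ℝ} {a b : ℝ}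
    (h : ∀ i, 0 ≤ s i ∧ s i ≤ t i ∧ t i ≤ 1) (hab : 0 ≤ a ∧ a ≤ b ∧ b ≤ 1)
    (hs : Tendsto s l (𝓝 a)) (ht : Tendsto t l (𝓝 b)) :
    Tendsto (fun i => ω (s i) (t i)) l (𝓝 (ω a b)) :=
  (hω.continuousOn (a, b) hab).tendsto.comp
    (tendsto_nhdsWithin_iff.2 ⟨hs.prodMk_nhds ht, Eventually.of_forall h⟩)

theorem IsControl.tendsto_rpow (hω : IsControl ω) {ι : Type*} {l : Filter ι} {s t : ι → ℝ} {a : ℝ}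
    (h : ∀ i, 0 ≤ s i ∧ s i ≤ t i ∧ t i ≤ 1) (ha : a ∈ Icc (0 : ℝ) 1)
    (hs : Tendsto s l (𝓝 a)) (ht : Tendsto t l (𝓝 a)) {r : ℝ} (hr : 0 < r) :
    Tendsto (fun i => ω (s i) (t i) ^ r) l (𝓝 0) := by
  have h1 := (hω.tendsto h ⟨ha.1, le_rfl, ha.2⟩ hs ht).rpow_const (p := r) (Or.inr hr.le)
  rwa [hω.diag a ha.1 ha.2, Real.zero_rpow hr.ne'] at h1

end Control

/-! ### The distances `d_{ω,p}` -/

section OmegaDist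

variable {m : ℕ} {V : Type*} [NormedAddCommGroup V] [NormedSpace ℝ V] [FiniteDimensional ℝ V]
  {N : TruncTensor m V → ℝ} {ω : ℝ → ℝ → ℝ} {p : ℝ} {X Y : ℝ → TruncTensor m V}

theorem omegaDist_le (hω : IsControl ω) (hH : ConditionH p ω) {q M : ℝ}
    (h : ∀ s t, 0 ≤ s → s < t → t ≤ 1 →
      groupDist N (increment X s t) (increment Y s t) ≤ M * ω s t ^ (1 / q)) :
    omegaDist N ω q X Y ≤ ENNReal.ofReal M := by
  refine iSup_le fun s => iSup_le fun t => iSup_le fun ⟨h0, hst, h1⟩ => ?_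
  have hpos : 0 < ω s t ^ (1 / q) := Real.rpow_pos_of_pos (hω.pos hH h0 hst h1) _
  refine ENNReal.div_le_of_le_mul ?_
  rw [← ENNReal.ofReal_mul' hpos.le]
  exact ENNReal.ofReal_le_ofReal (h s t h0 hst h1)

theorem groupDist_le_of_omegaDist_le (hω : IsControl ω) (hH : ConditionH p ω) {q M : ℝ}
    (hM : 0 ≤ M) (h : omegaDist N ω q X Y ≤ ENNReal.ofReal M) {s t : ℝ} (h0 : 0 ≤ s) (hst : s < t)
    (h1 : t ≤ 1) : groupDist N (increment X s t) (increment Y s t) ≤ M * ω s t ^ (1 / q) := by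
  have hpos : 0 < ω s t ^ (1 / q) := Real.rpow_pos_of_pos (hω.pos hH h0 hst h1) _
  have h2 : ENNReal.ofReal (groupDist N (increment X s t) (increment Y s t)) /
      ENNReal.ofReal (ω s t ^ (1 / q)) ≤ ENNReal.ofReal M :=
    by
    refine le_trans ?_ h
    exact le_iSup₂_of_le s t (le_iSup_of_le (And.intro h0 (And.intro hst h1)) le_rfl)
  rw [ENNReal.div_le_iff (ENNReal.ofReal_pos.2 hpos).ne' ENNReal.ofReal_ne_top,
    ← ENNReal.ofReal_mul hM, ENNReal.ofReal_le_ofReal_iff (by positivity)] at h2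
  exact h2

theorem groupDist_increment_one (hN : IsHomogeneousNorm N) {s t : ℝ}
    (h : increment X s t ∈ freeNilpotentGroup m V) :
    groupDist N (increment X s t) (increment (fun _ => 1) s t) = N (increment X s t) := by
  rw [groupDist, increment, increment, Ring.inverse_one, one_mul, mul_one]
  exact hN.inverse _ h

/-- `‖X‖_{ω,p} < ∞`, spelled out; the bound holds also for `s = t`. -/
theorem omegaNorm_le_ofReal_iff (hN : IsHomogeneousNorm N) (hω : IsControl ω)
    (hH : ConditionH p ω) {M : ℝ} (hM : 0 ≤ M)
    (hX : ∀ t ∈ Icc (0 : ℝ) 1, X t ∈ freeNilpotentGroup m V) :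
    omegaNorm N ω p X ≤ ENNReal.ofReal M ↔ ∀ s t, 0 ≤ s → s ≤ t → t ≤ 1 →
      N (increment X s t) ≤ M * ω s t ^ (1 / p) := by
  have hmem : ∀ s t, 0 ≤ s → s ≤ t → t ≤ 1 → increment X s t ∈ freeNilpotentGroup m V :=
    fun s t h0 hst h1 => mul_mem_group (inverse_mem_group (hX s ⟨h0, hst.trans h1⟩))
      (hX t ⟨h0.trans hst, h1⟩)
  constructor
  · intro h s t h0 hst h1
    rcases hst.eq_or_lt with rfl | hlt
    · rw [increment, inverse_mul_of_mem_group (hX s ⟨h0, h1⟩), hN.one]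
      exact mul_nonneg hM (Real.rpow_nonneg (hω.nonneg s s h0 le_rfl h1) _)
    · rw [← groupDist_increment_one hN (hmem s t h0 hst h1)]
      exact groupDist_le_of_omegaDist_le hω hH hM h h0 hlt h1
  · intro h
    refine omegaDist_le hω hH fun s t h0 hst h1 => ?_
    rw [groupDist_increment_one hN (hmem s t h0 hst.le h1)]
    exact h s t h0 hst.le h1

theorem signaturePath_mem_group {y : ℝ → V} (hy : IsSmoothPath y) :
    ∀ t ∈ Icc (0 : ℝ) 1, signaturePath m y t ∈ freeNilpotentGroup m V :=
  fun _ ht => signature_mem_group hy le_rfl ht.1 ht.2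

/-! ### Interpolation by smooth paths -/

theorem exists_piece {n : ℕ} (hn : 0 < n) {t : ℝ} (ht : t ∈ Icc (0 : ℝ) 1) :
    ∃ k < n, t ∈ Icc ((k : ℝ) / n) ((k + 1) / n) := by
  have hn' : (0 : ℝ) < n := by exact_mod_cast hn
  rcases ht.2.eq_or_lt with rfl | h1
  · refine ⟨n - 1, by omega, ?_⟩
    rw [mem_piece (by omega), Nat.cast_sub hn]
    simp
  · have h0 : 0 ≤ n * t := mul_nonneg hn'.le ht.1
    have hk : ⌊n * t⌋₊ < n := (Nat.floor_lt h0).2 (by nlinarith)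
    refine ⟨⌊n * t⌋₊, hk, (mem_piece hk).2 ⟨?_, ?_⟩⟩
    · linarith [Nat.floor_le h0]
    · linarith [Nat.lt_floor_add_one (n * t)]

/-- A path in `C^{ω,p}` is interpolated along the nodes `k / n` by signatures of smooth paths
with uniformly bounded `‖·‖_{ω,p}`. On each interval of the partition, the interpolating path
joins the nodes with speed proportional to the norm of the increment; condition `(H_p)` controls
its signature on shorter intervals. -/
theorem exists_interpolation (hN : IsHomogeneousNorm N) (hp : 0 < p) (hω : IsControl ω)
    (hH : ConditionH p ω) (hY : IsGroupPath Y) {M : ℝ} (hM : 0 ≤ M)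
    (hYM : ∀ s t, 0 ≤ s → s ≤ t → t ≤ 1 → N (increment Y s t) ≤ M * ω s t ^ (1 / p)) :
    ∃ A : ℝ, 0 ≤ A ∧ ∀ n : ℕ, 0 < n → ∃ y : ℝ → V, IsSmoothPath y ∧
      (∀ k ≤ n, signature m y 0 (k / n) = Y (k / n)) ∧
      ∀ s t, 0 ≤ s → s ≤ t → t ≤ 1 → N (signature m y s t) ≤ A * ω s t ^ (1 / p) := by
  obtain ⟨C₁, hC₁, hlen⟩ := hN.exists_le_length
  obtain ⟨C₂, hC₂, hreach⟩ := hN.exists_isReached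
  obtain ⟨D, hD, hroot⟩ := hω.exists_root_bound hH hp
  set A₀ := C₁ * (C₂ * M) * D with hA₀
  have hA₀0 : 0 ≤ A₀ := by positivity
  -- an interval is split at nodes into two subintervals of pieces, with constant `A₀` each, and
  -- an interval between nodes, where the signature is an increment of `Y`
  refine ⟨A₀ + M + A₀, by positivity, fun n hn => ?_⟩
  have hn' : (0 : ℝ) < n := by exact_mod_cast hn
  have hmem : ∀ k < n, increment Y (k / n) ((k + 1) / n) ∈ freeNilpotentGroup m V := by
    intro k hk
    have h01 := piece_subset hk
    have hle : (k : ℝ) / n ≤ (k + 1) / n := by gcongr; linarith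
    exact mul_mem_group (inverse_mem_group (hY.mem _ ⟨h01.1, hle.trans h01.2⟩))
      (hY.mem _ ⟨h01.1.trans hle, h01.2⟩)
  have hz : ∀ k, ∃ z : ℝ → V, k < n → IsFlatPath z ∧
      (∀ t, ‖deriv z t‖ ≤ C₂ * N (increment Y (k / n) ((k + 1) / n))) ∧
      signature m z 0 1 = increment Y (k / n) ((k + 1) / n) := by
    intro k
    by_cases hk : k < n
    · obtain ⟨z, h⟩ := hreach _ (hmem k hk)
      exact ⟨z, fun _ => h⟩
    · exact ⟨0, fun h => absurd h hk⟩
  choose z hz using hz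
  have hflat : ∀ k < n, IsFlatPath (z k) := fun k hk => (hz k hk).1
  have hy := isSmoothPath_of_contDiff (contDiff_concat hflat)
  have hnode : ∀ k ≤ n, signature m (concat n z) 0 (k / n) = Y (k / n) := by
    intro k hk
    refine signature_concat_node hflat (g := fun k : ℕ => Y (k / n)) (by simp [hY.start])
      (fun k hk => ?_) hk
    have h01 := piece_subset hk
    have hle : (k : ℝ) / n ≤ (k + 1) / n := by gcongr; linarith
    rw [(hz k hk).2.2, increment, ← mul_assoc,
      mul_inverse_of_mem_group (hY.mem _ ⟨h01.1, hle.trans h01.2⟩), one_mul, Nat.cast_succ]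
  have hpiece : ∀ k < n, ∀ s t, (k : ℝ) / n ≤ s → s ≤ t → t ≤ (k + 1) / n →
      N (signature m (concat n z) s t) ≤ A₀ * ω s t ^ (1 / p) := by
    intro k hk s t hks hst htk
    have h01 := piece_subset hk
    have h0 := h01.1.trans hks
    have h1 := htk.trans h01.2
    have hle : (k : ℝ) / n ≤ (k + 1) / n := hks.trans (hst.trans htk)
    set B := C₂ * N (increment Y (k / n) ((k + 1) / n)) with hB
    have h2 : ∫ u in s..t, ‖velocity (concat n z) u‖ ≤ n * B * (t - s) := by
      have h3 := intervalIntegral.norm_integral_le_of_norm_le_const (a := s) (b := t)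
        (f := fun u => ‖velocity (concat n z) u‖) (C := n * B) (fun u hu => by
          rw [uIoc_of_le hst] at hu
          have hu' : u ∈ Icc ((k : ℝ) / n) ((k + 1) / n) := ⟨hks.trans hu.1.le, hu.2.trans htk⟩
          rw [velocity_concat hflat hk hu', norm_norm, norm_smul, Real.norm_natCast,
            velocity_eq_of_hasDerivAt ((mem_piece hk).1 hu')
              (hasDerivAt_of_contDiff (hflat k hk).contDiff _)]
          gcongr
          exact (hz k hk).2.1 _)
      rw [abs_of_nonneg (sub_nonneg.2 hst)] at h3
      exact (le_abs_self _).trans h3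
    have h3 := hYM _ _ h01.1 hle h01.2
    have h4 := hroot _ s t _ h01.1 hks hst htk h01.2
    have e : ((k : ℝ) + 1) / n - k / n = 1 / n := by ring
    rw [e] at h4
    have hts := sub_nonneg.2 hst
    calc N (signature m (concat n z) s t) ≤ C₁ * (n * B * (t - s)) :=
          (hlen _ hy s t h0 hst h1).trans (by gcongr)
      _ ≤ C₁ * (n * (C₂ * (M * ω (k / n) ((k + 1) / n) ^ (1 / p))) * (t - s)) := by
          rw [hB]; gcongr
      _ = C₁ * (C₂ * M) * n * ((t - s) * ω (k / n) ((k + 1) / n) ^ (1 / p)) := by ring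
      _ ≤ C₁ * (C₂ * M) * n * (D * (1 / n * ω s t ^ (1 / p))) := by gcongr
      _ = A₀ * ω s t ^ (1 / p) := by rw [hA₀]; field_simp
  refine ⟨concat n z, hy, hnode, fun s t h0 hst h1 => ?_⟩
  have hrp : ∀ a b, s ≤ a → a ≤ b → b ≤ t → ω a b ^ (1 / p) ≤ ω s t ^ (1 / p) :=
    fun a b h2 h3 h4 => Real.rpow_le_rpow (hω.nonneg a b (h0.trans h2) h3 (h4.trans h1))
      (hω.mono h0 h2 h3 h4 h1) (by positivity)
  have hωst : 0 ≤ ω s t ^ (1 / p) := Real.rpow_nonneg (hω.nonneg s t h0 hst h1) _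
  obtain ⟨k, hk, hsk⟩ := exists_piece hn ⟨h0, hst.trans h1⟩
  obtain ⟨l, hl, htl⟩ := exists_piece hn ⟨h0.trans hst, h1⟩
  rcases le_or_gt t ((k + 1) / n) with h2 | h2
  · refine (hpiece k hk s t hsk.1 hst h2).trans ?_
    nlinarith
  · have hkl : k + 1 ≤ l := by
      have h3 := h2.trans_le htl.2
      rw [div_lt_div_iff_of_pos_right hn'] at h3
      have h4 : k + 1 < l + 1 := by exact_mod_cast h3
      omega
    have hkl' : ((k : ℝ) + 1) / n ≤ l / n := by
      have : ((k : ℝ) + 1) ≤ l := by exact_mod_cast hkl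
      gcongr
    have hkle : (k : ℝ) / n ≤ (k + 1) / n := hsk.1.trans hsk.2
    have hk0 : (0 : ℝ) ≤ (k + 1) / n := by positivity
    have hl1 : (l : ℝ) / n ≤ 1 := htl.1.trans h1
    have hmid : signature m (concat n z) ((k + 1) / n) (l / n) =
        increment Y ((k + 1) / n) (l / n) := by
      rw [← increment_signaturePath hy hk0 hkl' hl1, increment, increment, signaturePath]
      have h5 := hnode (k + 1) hk
      rw [Nat.cast_succ] at h5
      rw [h5, hnode l hl.le]
    have hg1 := signature_mem_group (m := m) hy h0 hsk.2 (hkl'.trans hl1)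
    have hg2 := signature_mem_group (m := m) hy hk0 hkl' hl1
    have hg3 := signature_mem_group (m := m) hy (hk0.trans hkl') htl.1 h1
    rw [← signature_mul_signature hy h0 (hsk.2.trans hkl') htl.1 h1,
      ← signature_mul_signature hy h0 hsk.2 hkl' hl1]
    have h3 := hN.mul_le _ (mul_mem_group hg1 hg2) _ hg3
    have h4 := hN.mul_le _ hg1 _ hg2
    have h5 := hpiece k hk s _ hsk.1 hsk.2 le_rfl
    have h6 := hpiece l hl _ t le_rfl htl.1 htl.2
    rw [hmid] at h3 h4 ⊢
    have h7 := hYM _ _ hk0 hkl' hl1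
    have h8 := mul_le_mul_of_nonneg_left (hrp _ _ le_rfl hsk.2 h2.le) hA₀0
    have h9 := mul_le_mul_of_nonneg_left (hrp _ _ hsk.2 hkl' htl.1) hM
    have h10 := mul_le_mul_of_nonneg_left (hrp _ _ (hsk.2.trans hkl') htl.1 le_rfl) hA₀0
    linarith

theorem exists_smooth_approximation (hN : IsHomogeneousNorm N) (hp : 0 < p) (hω : IsControl ω)
    (hH : ConditionH p ω) (hY : IsGroupPath Y) {M : ℝ} (hM : 0 ≤ M)
    (hYM : ∀ s t, 0 ≤ s → s ≤ t → t ≤ 1 → N (increment Y s t) ≤ M * ω s t ^ (1 / p)) :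
    ∃ y : ℕ → ℝ → V, (∀ n, IsSmoothPath (y n)) ∧
      (∃ M : ℝ, ∀ n, omegaNorm N ω p (signaturePath m (y n)) ≤ ENNReal.ofReal M) ∧
      ∀ t ∈ Icc (0 : ℝ) 1, Tendsto (fun n => signaturePath m (y n) t) atTop (𝓝 (Y t)) := by
  obtain ⟨A, hA0, hA⟩ := exists_interpolation hN hp hω hH hY hM hYM
  choose y hy hnode hbound using fun n : ℕ => hA (n + 1) n.succ_pos
  refine ⟨y, hy, ⟨A, fun n => ?_⟩, fun t ht => ?_⟩
  · rw [omegaNorm_le_ofReal_iff hN hω hH hA0 (signaturePath_mem_group (hy n))]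
    intro s t h0 hst h1
    rw [increment_signaturePath (hy n) h0 hst h1]
    exact hbound n s t h0 hst h1
  · choose k hk htk using fun n : ℕ => exists_piece n.succ_pos ht
    set r : ℕ → ℝ := fun n => (k n : ℝ) / (n + 1 : ℕ) with hr
    have hr01 : ∀ n, 0 ≤ r n ∧ r n ≤ t ∧ t ≤ 1 := fun n =>
      ⟨by positivity, (htk n).1, ht.2⟩
    have hrt : Tendsto r atTop (𝓝 t) := by
      have h1 : Tendsto (fun n : ℕ => t - 1 / ((n : ℝ) + 1)) atTop (𝓝 t) := by
        simpa using tendsto_const_nhds.sub (tendsto_one_div_add_atTop_nhds_zero_nat (𝕜 := ℝ))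
      refine tendsto_of_tendsto_of_tendsto_of_le_of_le h1 tendsto_const_nhds (fun n => ?_)
        fun n => (hr01 n).2.1
      have h2 := (htk n).2
      rw [add_div] at h2
      simp only [hr]
      push_cast at h2 ⊢
      linarith
    have hYr : Tendsto (fun n => Y (r n)) atTop (𝓝 (Y t)) :=
      (hY.continuousOn t ht).tendsto.comp (tendsto_nhdsWithin_iff.2
        ⟨hrt, Eventually.of_forall fun n => ⟨(hr01 n).1, (hr01 n).2.1.trans ht.2⟩⟩)
    have hmem : ∀ n, signature m (y n) (r n) t ∈ freeNilpotentGroup m V := fun n =>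
      signature_mem_group (hy n) (hr01 n).1 (hr01 n).2.1 ht.2
    have hS : Tendsto (fun n => signature m (y n) (r n) t) atTop (𝓝 1) := by
      refine hN.tendsto_one hmem ?_
      have h1 := (hω.tendsto_rpow hr01 ht hrt tendsto_const_nhds
        (show 0 < 1 / p by positivity)).const_mul A
      rw [mul_zero] at h1
      exact squeeze_zero (fun n => hN.nonneg _ (hmem n))
        (fun n => hbound n _ _ (hr01 n).1 (hr01 n).2.1 ht.2) h1
    have h2 := hYr.mul hS
    rw [mul_one] at h2
    refine h2.congr fun n => ?_
    rw [signaturePath, ← signature_mul_signature (hy n) le_rfl (hr01 n).1 (hr01 n).2.1 ht.2,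
      hnode n (k n) (hk n).le]

/-! ### Limits of bounded sequences -/

theorem norm_increment_le_of_tendsto (hN : IsHomogeneousNorm N) (hY : IsGroupPath Y) {M : ℝ}
    {X : ℕ → ℝ → TruncTensor m V} (hX : ∀ n, ∀ t ∈ Icc (0 : ℝ) 1, X n t ∈ freeNilpotentGroup m V)
    (hXM : ∀ n s t, 0 ≤ s → s ≤ t → t ≤ 1 → N (increment (X n) s t) ≤ M * ω s t ^ (1 / p))
    (hlim : ∀ t ∈ Icc (0 : ℝ) 1, Tendsto (fun n => X n t) atTop (𝓝 (Y t))) {s t : ℝ} (h0 : 0 ≤ s)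
    (hst : s ≤ t) (h1 : t ≤ 1) : N (increment Y s t) ≤ M * ω s t ^ (1 / p) := by
  have hs : s ∈ Icc (0 : ℝ) 1 := ⟨h0, hst.trans h1⟩
  have ht : t ∈ Icc (0 : ℝ) 1 := ⟨h0.trans hst, h1⟩
  have h2 := tendsto_inverse_mul (fun n => hX n s hs) (hY.mem s hs) (hlim s hs) (hlim t ht)
  exact le_of_tendsto (hN.tendsto
    (fun n => mul_mem_group (inverse_mem_group (hX n s hs)) (hX n t ht))
    (mul_mem_group (inverse_mem_group (hY.mem s hs)) (hY.mem t ht)) h2)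
    (Eventually.of_forall fun n => hXM n s t h0 hst h1)

/-- A uniform bound on `‖X n‖_{ω,p}` makes the sequence equicontinuous, so that pointwise
convergence implies convergence along converging times. -/
theorem tendsto_apply_of_tendsto (hN : IsHomogeneousNorm N) (hp : 0 < p) (hω : IsControl ω) {M : ℝ}
    {X : ℕ → ℝ → TruncTensor m V} (hX : ∀ n, ∀ t ∈ Icc (0 : ℝ) 1, X n t ∈ freeNilpotentGroup m V)
    (hXM : ∀ n s t, 0 ≤ s → s ≤ t → t ≤ 1 → N (increment (X n) s t) ≤ M * ω s t ^ (1 / p))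
    (hlim : ∀ t ∈ Icc (0 : ℝ) 1, Tendsto (fun n => X n t) atTop (𝓝 (Y t))) {s : ℕ → ℝ} {a : ℝ}
    (hs : ∀ k, s k ∈ Icc (0 : ℝ) 1) (ha : a ∈ Icc (0 : ℝ) 1) (hsa : Tendsto s atTop (𝓝 a))
    {φ : ℕ → ℕ} (hφ : Tendsto φ atTop atTop) :
    Tendsto (fun k => X (φ k) (s k)) atTop (𝓝 (Y a)) := by
  have hmem : ∀ k, Ring.inverse (X (φ k) a) * X (φ k) (s k) ∈ freeNilpotentGroup m V := fun k =>
    mul_mem_group (inverse_mem_group (hX _ a ha)) (hX _ _ (hs k))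
  have hle : ∀ k, N (Ring.inverse (X (φ k) a) * X (φ k) (s k)) ≤
      M * ω (min a (s k)) (max a (s k)) ^ (1 / p) := by
    intro k
    rcases le_total a (s k) with h | h
    · rw [min_eq_left h, max_eq_right h]
      exact hXM _ _ _ ha.1 h (hs k).2
    · rw [min_eq_right h, max_eq_left h, ← hN.inverse _ (hmem k),
        inverse_mul_rev (inverse_mem_group (hX _ a ha)) (hX _ _ (hs k)),
        inverse_inverse_of_mem_group (hX _ a ha)]
      exact hXM _ _ _ (hs k).1 h ha.2
  have h1 : Tendsto (fun k => M * ω (min a (s k)) (max a (s k)) ^ (1 / p)) atTop (𝓝 0) := by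
    have h2 := hω.tendsto_rpow (s := fun k => min a (s k)) (t := fun k => max a (s k))
      (fun k => ⟨le_min ha.1 (hs k).1, min_le_max, max_le ha.2 (hs k).2⟩) ha
      (by simpa using (tendsto_const_nhds (x := a)).min hsa)
      (by simpa using (tendsto_const_nhds (x := a)).max hsa)
      (show 0 < 1 / p by positivity)
    simpa using h2.const_mul M
  have h2 := hN.tendsto_one hmem (squeeze_zero (fun k => hN.nonneg _ (hmem k)) hle h1)
  have h3 := ((hlim a ha).comp hφ).mul h2
  rw [mul_one] at h3
  refine h3.congr fun k => ?_
  rw [Function.comp, ← mul_assoc, mul_inverse_of_mem_group (hX _ a ha), one_mul]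

/-- Interpolation between the uniform distance and `d_{ω,p}`: a sequence that is bounded in
`C^{ω,p}` and converges pointwise converges in `d_{ω,q}` for every `q > p`. Otherwise there would
be times `s k < t k`, converging to `a ≤ b`, at which the quotients defining `d_{ω,q}` stay away
from zero: for `a < b` this contradicts equicontinuity, and for `a = b` the bound in `C^{ω,p}`. -/
theorem tendsto_omegaDist (hN : IsHomogeneousNorm N) (hp : 0 < p) (hω : IsControl ω)
    (hH : ConditionH p ω) (hY : IsGroupPath Y) {M : ℝ}
    {X : ℕ → ℝ → TruncTensor m V} (hX : ∀ n, ∀ t ∈ Icc (0 : ℝ) 1, X n t ∈ freeNilpotentGroup m V)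
    (hXM : ∀ n s t, 0 ≤ s → s ≤ t → t ≤ 1 → N (increment (X n) s t) ≤ M * ω s t ^ (1 / p))
    (hlim : ∀ t ∈ Icc (0 : ℝ) 1, Tendsto (fun n => X n t) atTop (𝓝 (Y t))) {q : ℝ} (hpq : p < q) :
    Tendsto (fun n => omegaDist N ω q (X n) Y) atTop (𝓝 0) := by
  have hq : 0 < q := hp.trans hpq
  suffices h : ∀ e : ℝ, 0 < e → ∀ᶠ n in atTop, ∀ s t, 0 ≤ s → s < t → t ≤ 1 →
      groupDist N (increment (X n) s t) (increment Y s t) ≤ e * ω s t ^ (1 / q) by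
    refine ENNReal.tendsto_nhds_zero.2 fun ε hε => ?_
    obtain ⟨e, he0, heε⟩ := ENNReal.lt_iff_exists_nnreal_btwn.1 hε
    filter_upwards [h e (by exact_mod_cast he0)] with n hn
    refine (omegaDist_le hω hH hn).trans ?_
    rw [ENNReal.ofReal_coe_nnreal]
    exact heε.le
  intro e he
  by_contra hcon
  obtain ⟨φ, hφ, hφ'⟩ := extraction_of_frequently_atTop (not_eventually.1 hcon)
  push Not at hφ'
  choose s t h0 hst h1 hlt using hφ'
  obtain ⟨⟨a, b⟩, -, ψ, hψ, hab⟩ := (isCompact_Icc.prod isCompact_Icc).tendsto_subseq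
    (x := fun k => (s k, t k)) (s := Icc (0 : ℝ) 1 ×ˢ Icc (0 : ℝ) 1)
    fun k => ⟨⟨h0 k, (hst k).le.trans (h1 k)⟩, ⟨(h0 k).trans (hst k).le, h1 k⟩⟩
  have hsa : Tendsto (fun k => s (ψ k)) atTop (𝓝 a) := (continuous_fst.tendsto _).comp hab
  have htb : Tendsto (fun k => t (ψ k)) atTop (𝓝 b) := (continuous_snd.tendsto _).comp hab
  have hab' : a ≤ b := le_of_tendsto_of_tendsto' hsa htb fun k => (hst _).le
  have ha0 : 0 ≤ a := ge_of_tendsto' hsa fun k => h0 _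
  have hb1 : b ≤ 1 := le_of_tendsto' htb fun k => h1 _
  have ha : a ∈ Icc (0 : ℝ) 1 := ⟨ha0, hab'.trans hb1⟩
  have hb : b ∈ Icc (0 : ℝ) 1 := ⟨ha0.trans hab', hb1⟩
  have hs : ∀ k, s (ψ k) ∈ Icc (0 : ℝ) 1 := fun k => ⟨h0 _, (hst _).le.trans (h1 _)⟩
  have ht : ∀ k, t (ψ k) ∈ Icc (0 : ℝ) 1 := fun k => ⟨(h0 _).trans (hst _).le, h1 _⟩
  have hφψ : Tendsto (fun k => φ (ψ k)) atTop atTop := (hφ.comp hψ).tendsto_atTop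
  have hXinc : ∀ k, increment (X (φ (ψ k))) (s (ψ k)) (t (ψ k)) ∈ freeNilpotentGroup m V :=
    fun k => mul_mem_group (inverse_mem_group (hX _ _ (hs k))) (hX _ _ (ht k))
  have hYinc : ∀ k, increment Y (s (ψ k)) (t (ψ k)) ∈ freeNilpotentGroup m V :=
    fun k => mul_mem_group (inverse_mem_group (hY.mem _ (hs k))) (hY.mem _ (ht k))
  have htri : ∀ k, 0 ≤ s (ψ k) ∧ s (ψ k) ≤ t (ψ k) ∧ t (ψ k) ≤ 1 := fun k =>
    ⟨h0 _, (hst _).le, h1 _⟩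
  rcases hab'.eq_or_lt with rfl | hlt'
  · have hle : ∀ k, e ≤ 2 * M * ω (s (ψ k)) (t (ψ k)) ^ (1 / p - 1 / q) := by
      intro k
      have h2 := hN.mul_le _ (inverse_mem_group (hXinc k)) _ (hYinc k)
      rw [hN.inverse _ (hXinc k)] at h2
      have h3 := hXM (φ (ψ k)) _ _ (h0 (ψ k)) (hst (ψ k)).le (h1 (ψ k))
      have h4 := norm_increment_le_of_tendsto hN hY hX hXM hlim (h0 (ψ k)) (hst (ψ k)).le
        (h1 (ψ k))
      have h5 := hlt (ψ k)
      have hpos := hω.pos hH (h0 (ψ k)) (hst (ψ k)) (h1 (ψ k))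
      rw [Real.rpow_sub hpos, ← mul_div_assoc, le_div_iff₀ (Real.rpow_pos_of_pos hpos _)]
      rw [groupDist] at h5
      linarith
    have h2 : Tendsto (fun k => 2 * M * ω (s (ψ k)) (t (ψ k)) ^ (1 / p - 1 / q)) atTop (𝓝 0) := by
      have h3 := hω.tendsto_rpow htri ha hsa htb
        (show 0 < 1 / p - 1 / q from sub_pos.2 (one_div_lt_one_div_of_lt hp hpq))
      simpa using h3.const_mul (2 * M)
    exact absurd (ge_of_tendsto' h2 hle) (not_le.2 he)
  · have hXs := tendsto_apply_of_tendsto hN hp hω hX hXM hlim hs ha hsa hφψ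
    have hXt := tendsto_apply_of_tendsto hN hp hω hX hXM hlim ht hb htb hφψ
    have hYs : Tendsto (fun k => Y (s (ψ k))) atTop (𝓝 (Y a)) :=
      (hY.continuousOn a ha).tendsto.comp
        (tendsto_nhdsWithin_iff.2 ⟨hsa, Eventually.of_forall hs⟩)
    have hYt : Tendsto (fun k => Y (t (ψ k))) atTop (𝓝 (Y b)) :=
      (hY.continuousOn b hb).tendsto.comp
        (tendsto_nhdsWithin_iff.2 ⟨htb, Eventually.of_forall ht⟩)
    have hmem : increment Y a b ∈ freeNilpotentGroup m V :=
      mul_mem_group (inverse_mem_group (hY.mem a ha)) (hY.mem b hb)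
    have h2 := tendsto_inverse_mul hXinc hmem
      (tendsto_inverse_mul (fun k => hX _ _ (hs k)) (hY.mem a ha) hXs hXt)
      (tendsto_inverse_mul (fun k => hY.mem _ (hs k)) (hY.mem a ha) hYs hYt)
    have h3 : Ring.inverse (increment Y a b) * (Ring.inverse (Y a) * Y b) = 1 :=
      inverse_mul_of_mem_group hmem
    rw [h3] at h2
    have h4 := hN.tendsto_zero
      (fun k => mul_mem_group (inverse_mem_group (hXinc k)) (hYinc k)) h2
    have h5 : Tendsto (fun k => e * ω (s (ψ k)) (t (ψ k)) ^ (1 / q)) atTop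
        (𝓝 (e * ω a b ^ (1 / q))) :=
      ((hω.tendsto htri ⟨ha0, hab', hb1⟩ hsa htb).rpow_const (Or.inr (by positivity))).const_mul e
    have h6 := le_of_tendsto_of_tendsto' h5 h4 fun k => (hlt (ψ k)).le
    have h7 : 0 < ω a b ^ (1 / q) := Real.rpow_pos_of_pos (hω.pos hH ha0 hlt' hb1) _
    nlinarith

end OmegaDist

end RoughPath

end

theorem mainTheorem2 {V : Type*} [NormedAddCommGroup V] [NormedSpace ℝ V] [FiniteDimensional ℝ V]
    (m : ℕ) (N : TruncTensor m V → ℝ) (hN : N = ccNorm m V ∨ IsHomogeneousNorm N)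
    (p : ℝ) (hp : 1 ≤ p) (ω : ℝ → ℝ → ℝ) (hω : IsControl ω) (hH : ConditionH p ω)
    (Y : ℝ → TruncTensor m V) (hY : IsGroupPath Y) :
    (Y ∈ omegaPathSpace N ω p ↔
      ∃ y : ℕ → ℝ → V, (∀ n, IsSmoothPath (y n)) ∧
        (∃ M : ℝ, ∀ n, omegaNorm N ω p (signaturePath m (y n)) ≤ ENNReal.ofReal M) ∧
        ∀ t ∈ Icc (0 : ℝ) 1, Tendsto (fun n => signaturePath m (y n) t) atTop (𝓝 (Y t))) ∧
    (∀ y : ℕ → ℝ → V, (∀ n, IsSmoothPath (y n)) →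
      (∃ M : ℝ, ∀ n, omegaNorm N ω p (signaturePath m (y n)) ≤ ENNReal.ofReal M) →
      (∀ t ∈ Icc (0 : ℝ) 1, Tendsto (fun n => signaturePath m (y n) t) atTop (𝓝 (Y t))) →
      ∀ q : ℝ, p < q →
        Tendsto (fun n => omegaDist N ω q (signaturePath m (y n)) Y) atTop (𝓝 0)) := by
  have hN' : IsHomogeneousNorm N := by
    rcases hN with rfl | hN
    · exact isHomogeneousNorm_ccNorm m V
    · exact hN
  have hp0 : 0 < p := by linarith
  have hbound : ∀ y : ℕ → ℝ → V, (∀ n, IsSmoothPath (y n)) →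
      (∃ M : ℝ, ∀ n, omegaNorm N ω p (signaturePath m (y n)) ≤ ENNReal.ofReal M) →
      ∃ M : ℝ, 0 ≤ M ∧ ∀ n s t, 0 ≤ s → s ≤ t → t ≤ 1 →
        N (increment (signaturePath m (y n)) s t) ≤ M * ω s t ^ (1 / p) := by
    rintro y hy ⟨M, hM⟩
    refine ⟨max M 0, le_max_right _ _, fun n => ?_⟩
    rw [← omegaNorm_le_ofReal_iff hN' hω hH (le_max_right _ _) (signaturePath_mem_group (hy n))]
    exact (hM n).trans (ENNReal.ofReal_le_ofReal (le_max_left _ _))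
  refine ⟨⟨fun hYω => ?_, ?_⟩, fun y hy hM hlim q hpq => ?_⟩
  · have h1 : omegaNorm N ω p Y ≤ ENNReal.ofReal (omegaNorm N ω p Y).toReal :=
      (ENNReal.ofReal_toReal hYω.2.ne).ge
    rw [omegaNorm_le_ofReal_iff hN' hω hH ENNReal.toReal_nonneg hY.mem] at h1
    exact exists_smooth_approximation hN' hp0 hω hH hY ENNReal.toReal_nonneg h1
  · rintro ⟨y, hy, hM, hlim⟩
    obtain ⟨M, hM0, hM⟩ := hbound y hy hM
    refine ⟨hY, lt_of_le_of_lt ?_ (ENNReal.ofReal_lt_top (r := M))⟩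
    rw [omegaNorm_le_ofReal_iff hN' hω hH hM0 hY.mem]
    exact fun s t => norm_increment_le_of_tendsto hN' hY
      (fun n => signaturePath_mem_group (hy n)) hM hlim
  · obtain ⟨M, -, hM⟩ := hbound y hy hM
    exact tendsto_omegaDist hN' hp0 hω hH hY (fun n => signaturePath_mem_group (hy n)) hM hlim hpq
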